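/- **Semi-coarse spaces.** A semi-coarse structure on a set $X$ is a family $\mathcal V$ of subsets of $X\times X$ (the controlled sets) that contains the diagonal and is closed under subsets, finite unions and inverses. A map is bornologous if it sends controlled sets to controlled sets. A subset $S\subset X$ carries the structure $\mathcal V_S=\{V\cap(S\times S)\mid V\in\mathcal V\}$. The controlled sets of a product are the subsets of the sets $V\boxtimes W=\{((v,w),(v',w'))\mid (v,v')\in V,(w,w')\in W\}$. $\mathbb Z_1$ is $\mathbb Z$ with the controlled sets $E\subset\{(i,i')\mid |i-i'|\le 1\}$; intervals of $\mathbb Z$ are subspaces of $\mathbb Z_1$. A space is connected if any two of its points are the end points of a bornologous path $\{0,\dots,n\}\to X$; components of a subset are the path components of that subspace. **Well-splitting.** Let $A,B\subset X$ be non-empty with $X=A\cup B$, and let $\mathcal V_{A\sqcup_{A\cap B}B}=\{E\cup F\mid E\in\mathcal V_A,F\in\mathcal V_B\}$ be the pushout structure on $X$. Then $A,B$ well-split $X$ if for all $x,y,y'\in X$ with $\{(x,y),(x,y')\}\in\mathcal V\setminus\mathcal V_{A\sqcup_{A\cap B}B}$ and $\{(y,y')\}\in\mathcal V_{A\sqcup_{A\cap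 B}B}$: (1) there are paths $\gamma,\gamma':\{0,1,2\}\to X$, bornologous for $\mathcal V_{A\sqcup_{A\cap B}B}$, with $\gamma(0)=\gamma'(0)=x$, $\gamma(2)=y$, $\gamma'(2)=y'$, $\gamma(1)=\gamma'(1)$; (2) the set of all $\gamma(1)$, where $\gamma$ runs over the paths $\{0,1,2\}\to X$ that are bornologous for $\mathcal V_{A\sqcup_{A\cap B}B}$ with $\gamma(0)=x$ and $\gamma(2)=y$, is connected as a subspace of $X$. **The relative fundamental groupoid** $\pi_{\le1}(X,\mathcal U)$, for $\mathcal U\subset 2^X$. All maps $f:\mathbb Z_1\to X$ below are bornologous and controlled by $\mathcal U$: $f((-\infty,n])\subset U_1$ and $f([m,\infty))\subset U_2$ for some $U_1,U_2\in\mathcal U$ and some $n,m$. A homotopy of maps $f,g:\mathbb Z_1\to X$, or of their restrictions to a ray, is a bornologous map $H$ on the product of the domain with $\mathbb Z_1$ with $H(\cdot,k)=f$ for all sufficiently small $k$, $H(\cdot,k)=g$ for all sufficiently large $k$, and such that the tails of every stage $H(\cdot,k)$ lie in members of $\mathcal U$. Write $\overline f(z)=f(-z)$; $f$ is symmetric if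 $\overline f=f$. *Objects:* classes $\langle f\rangle$ of symmetric maps under the equivalence relation generated by homotopy and by eventual equality ($f(N+k)=g(M+k)$ for all $k\ge0$, for some $N,M\ge 0$). *Strings:* a string from $\langle f_0\rangle$ to $\langle f_{n+1}\rangle$ is a tuple $(f_1,\dots,f_n)$, $n\ge1$, such that for each $0\le i\le n$ there are integers $N_i,M_i$ for which $z\mapsto f_i(z+N_i)$ and $z\mapsto f_{i+1}(-z+M_i)$ are homotopic on $[0,\infty)$. *Admissibility:* $g$ is admissible at $j$ if (a) whenever $g|_{[j-1,\infty)}$ is periodic and $g|_{[j-k,\infty)}$ is not periodic for some $k>1$, then $g|_{[j,\infty)}$ is homotopic to a constant map; and (b) whenever $g|_{(-\infty,j+1]}$ is periodic and $g|_{(-\infty,j+k]}$ is not periodic for some $k>1$, then $g|_{(-\infty,j]}$ is homotopic to a constant map. *Morphisms:* strings from $a$ to $b$ modulo the equivalence relation generated on them by (i) deleting two consecutive entries $f_i,f_{i+1}$ of a string of length at least $3$ with $f_i(z)=\overline{f_{i+1}}(z+N)$ for all $z$ and some $N$; (ii) merging: if $f_i(z)=x_0$ for $z\ge N$, $f_{i+1}(z)=x_0$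 for $z\le M$ and $N\le j\le M$, replacing $f_i,f_{i+1}$ by the one map $g$ with $g(z)=f_i(z)$ for $z\le j$ and $g(z)=f_{i+1}(z)$ for $z>j$, provided that $g$ is admissible at $j$; (iii) replacing every $f_i$ by some $g_i\simeq_d f_i$, where $\simeq_d$ is the equivalence relation generated by passing from $f$ to the map $g$ with $g(z)=f(z)$ for $z<z_0$ and $g(z)=f(z+1)$ for $z\ge z_0$, provided that $g$ is bornologous and admissible at $z_0$. Composition is concatenation; this is a groupoid. For $S\subset X$ write $\mathcal U\cap S=\{U\cap S\mid U\in\mathcal U\}$, and use the subspace $S$ to form $\pi_{\le1}(S,\mathcal U\cap S)$. **Corollary.** Let $X$ be a semi-coarse space, $U\subset X$, $\mathcal U=\{U\}$, and let $\mathcal U'$ be the collection of all components of $U$. Let $A,B\subset X$ be such that 1. $A,B$ well-split $X$; 2. for every component $C$ of $A$, of $B$ and of $A\cap B$ there is a $U'\in\mathcal U'$ with $C\cap U'\neq\varnothing$; 3. every $U'\in\mathcal U'$ satisfies $U'\subset A$ or $U'\subset B$. Then the square of functors induced by the inclusions $$\begin{array}{ccc}\pi_{\le1}(A\cap B,\mathcal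 U'\cap A\cap B)&\longrightarrow&\pi_{\le1}(A,\mathcal U'\cap A)\\ \downarrow&&\downarrow\\ \pi_{\le1}(B,\mathcal U'\cap B)&\longrightarrow&\pi_{\le1}(X,\mathcal U)\end{array}$$ is a pushout in the category of groupoids. -/

import Mathlib

open CategoryTheory

universe u

/-- A semi-coarse structure on `X`. -/
structure SemiCoarse (X : Type u) where
  /-- the controlled sets -/
  sets : Set (Set (X × X))
  diagonal_mem : Set.diagonal X ∈ sets
  mem_of_subset : ∀ {E F : Set (X × X)}, F ∈ sets → E ⊆ F → E ∈ sets
  union_mem : ∀ {E F : Set (X × X)}, E ∈ sets → F ∈ sets → E ∪ F ∈ sets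
  inv_mem : ∀ {E : Set (X × X)}, E ∈ sets → Prod.swap ⁻¹' E ∈ sets

/-- Bornologous maps: images of controlled sets are controlled. -/
def Bornologous {X Y : Type*} (V : SemiCoarse X) (W : SemiCoarse Y) (f : X → Y) : Prop :=
  ∀ E ∈ V.sets, Prod.map f f '' E ∈ W.sets

namespace SemiCoarse

/-- The semi-coarse subspace: controlled sets are the traces `E ∩ (S × S)`. -/
def sub {X : Type*} (V : SemiCoarse X) (S : Set X) : SemiCoarse S where
  sets := {E | ∃ F ∈ V.sets, E = Prod.map Subtype.val Subtype.val ⁻¹' F}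
  diagonal_mem := ⟨_, V.diagonal_mem, by ext ⟨a, b⟩; simp [Subtype.ext_iff]⟩
  mem_of_subset := by
    rintro E _ ⟨F, hF, rfl⟩ h
    refine ⟨Prod.map Subtype.val Subtype.val '' E, V.mem_of_subset hF (Set.image_subset_iff.2 h), ?_⟩
    exact (Set.preimage_image_eq _
      (Subtype.val_injective.prodMap Subtype.val_injective)).symm
  union_mem := by
    rintro _ _ ⟨E, hE, rfl⟩ ⟨F, hF, rfl⟩
    exact ⟨E ∪ F, V.union_mem hE hF, rfl⟩
  inv_mem := by
    rintro _ ⟨E, hE, rfl⟩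
    exact ⟨_, V.inv_mem hE, rfl⟩

/-- The product structure: subsets of the sets `E ⊠ F`. -/
def prod {X Y : Type*} (V : SemiCoarse X) (W : SemiCoarse Y) : SemiCoarse (X × Y) where
  sets := {K | ∃ E ∈ V.sets, ∃ F ∈ W.sets, K ⊆ {p | (p.1.1, p.2.1) ∈ E ∧ (p.1.2, p.2.2) ∈ F}}
  diagonal_mem := ⟨_, V.diagonal_mem, _, W.diagonal_mem, by
    rintro ⟨a, b⟩ h
    obtain rfl : a = b := h
    exact ⟨rfl, rfl⟩⟩
  mem_of_subset := by
    rintro K L ⟨E, hE, F, hF, h⟩ hKL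
    exact ⟨E, hE, F, hF, hKL.trans h⟩
  union_mem := by
    rintro K L ⟨E, hE, F, hF, h⟩ ⟨E', hE', F', hF', h'⟩
    refine ⟨E ∪ E', V.union_mem hE hE', F ∪ F', W.union_mem hF hF', ?_⟩
    rintro p (hp | hp)
    · exact ⟨Or.inl (h hp).1, Or.inl (h hp).2⟩
    · exact ⟨Or.inr (h' hp).1, Or.inr (h' hp).2⟩
  inv_mem := by
    rintro K ⟨E, hE, F, hF, h⟩
    exact ⟨_, V.inv_mem hE, _, W.inv_mem hF, fun p hp => h hp⟩

/-- The semi-coarse space `ℤ₁`: controlled sets are the subsets of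
`{(i, i + j) | j ∈ {-1, 0, 1}}`. -/
def zOne : SemiCoarse ℤ where
  sets := {E | ∀ p ∈ E, |p.2 - p.1| ≤ 1}
  diagonal_mem := by
    rintro ⟨a, b⟩ h
    obtain rfl : a = b := h
    simp
  mem_of_subset := fun hF h p hp => hF p (h hp)
  union_mem := fun hE hF p hp => hp.elim (hE p) (hF p)
  inv_mem := fun hE p hp => by
    have := hE _ hp
    rw [abs_sub_comm] at this
    exact this

/-- The structure of the pushout `A ⊔_{A ∩ B} B` of the subspaces `A` and `B`, carried by
`X = A ∪ B`: a controlled set is a controlled set of `A` together with one of `B`. -/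
def glue {X : Type*} (V : SemiCoarse X) (A B : Set X) (h : A ∪ B = Set.univ) : SemiCoarse X where
  sets := {K | ∃ E ∈ V.sets, ∃ F ∈ V.sets, K = (E ∩ A ×ˢ A) ∪ (F ∩ B ×ˢ B)}
  diagonal_mem := ⟨_, V.diagonal_mem, _, V.diagonal_mem, by
    ext ⟨a, b⟩
    have : a ∈ A ∪ B := h ▸ Set.mem_univ a
    simp only [Set.mem_diagonal_iff, Set.mem_union, Set.mem_inter_iff, Set.mem_prod] at this ⊢
    constructor
    · rintro rfl
      tauto
    · tauto⟩
  mem_of_subset := by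
    rintro K _ ⟨E, hE, F, hF, rfl⟩ hK
    refine ⟨K ∩ E, V.mem_of_subset hE Set.inter_subset_right,
      K ∩ F, V.mem_of_subset hF Set.inter_subset_right, ?_⟩
    ext p
    have := @hK p
    simp only [Set.mem_union, Set.mem_inter_iff] at this ⊢
    tauto
  union_mem := by
    rintro _ _ ⟨E, hE, F, hF, rfl⟩ ⟨E', hE', F', hF', rfl⟩
    refine ⟨E ∪ E', V.union_mem hE hE', F ∪ F', V.union_mem hF hF', ?_⟩
    ext p
    simp only [Set.mem_union, Set.mem_inter_iff]
    tauto
  inv_mem := by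
    rintro _ ⟨E, hE, F, hF, rfl⟩
    refine ⟨_, V.inv_mem hE, _, V.inv_mem hF, ?_⟩
    ext ⟨a, b⟩
    simp only [Set.mem_preimage, Set.mem_union, Set.mem_inter_iff, Set.mem_prod, Prod.swap]
    tauto

/-- `x` and `y` are joined by a bornologous path `{0, …, n} → X`, where `{0, …, n} ⊆ ℤ₁`. -/
def Joined {X : Type*} (V : SemiCoarse X) (x y : X) : Prop :=
  ∃ (n : ℕ) (γ : Set.Icc (0 : ℤ) n → X), Bornologous (zOne.sub _) V γ ∧
    γ ⟨0, by simp⟩ = x ∧ γ ⟨n, by simp⟩ = y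

/-- Connectedness of a semi-coarse space. -/
def IsConn {X : Type*} (V : SemiCoarse X) : Prop := ∀ x y, V.Joined x y

/-- The connected components of the subspace `S`, as subsets of `X`. -/
def components {X : Type*} (V : SemiCoarse X) (S : Set X) : Set (Set X) :=
  {C | ∃ x : S, C = Subtype.val '' {y : S | (V.sub S).Joined x y}}

/-- There is a bornologous path `γ : {0, 1, 2} → X` with values `x`, `m`, `y`. -/
def ShortPath {X : Type*} (W : SemiCoarse X) (x m y : X) : Prop :=
  ∃ γ : Set.Icc (0 : ℤ) 2 → X, Bornologous (zOne.sub _) W γ ∧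
    γ ⟨0, by simp⟩ = x ∧ γ ⟨1, by simp⟩ = m ∧ γ ⟨2, by simp⟩ = y

/-- The non-empty sets `A`, `B` with `A ∪ B = X` well-split `X`. -/
def WellSplit {X : Type*} (V : SemiCoarse X) (A B : Set X) : Prop :=
  A.Nonempty ∧ B.Nonempty ∧ ∃ h : A ∪ B = Set.univ, ∀ x y y' : X,
    {(x, y), (x, y')} ∈ V.sets → {(x, y), (x, y')} ∉ (V.glue A B h).sets →
    {(y, y')} ∈ (V.glue A B h).sets →
      (∃ m, (V.glue A B h).ShortPath x m y ∧ (V.glue A B h).ShortPath x m y') ∧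
      (V.sub {m | (V.glue A B h).ShortPath x m y}).IsConn

end SemiCoarse

open SemiCoarse

/-- `f` and `g` are joined by a homotopy `H : S × ℤ₁ → Y` all of whose stages `H (·, k)`
satisfy `P`. -/
def HomotopicThrough {S Y : Type*} (P : (S → Y) → Prop) (VS : SemiCoarse S) (VY : SemiCoarse Y)
    (f g : S → Y) : Prop :=
  ∃ H : S × ℤ → Y, Bornologous (VS.prod zOne) VY H ∧
    (∃ M N : ℤ, ∀ s, (∀ k ≤ M, H (s, k) = f s) ∧ ∀ k ≥ N, H (s, k) = g s) ∧
    ∀ k, P fun s => H (s, k)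

/-- Some right tail of `f : [j, ∞) → X` lies in a member of `𝒰`. -/
def RayIn {X : Type*} (𝒰 : Set (Set X)) {j : ℤ} (f : Set.Ici j → X) : Prop :=
  ∃ U ∈ 𝒰, ∃ n : ℤ, ∀ z : Set.Ici j, n ≤ z → f z ∈ U

/-- The left tail and the right tail of `f : ℤ → X` lie in members of `𝒰`. -/
def TailsIn {X : Type*} (𝒰 : Set (Set X)) (f : ℤ → X) : Prop :=
  (∃ U ∈ 𝒰, ∃ n : ℤ, ∀ z ≤ n, f z ∈ U) ∧ (∃ U ∈ 𝒰, ∃ n : ℤ, ∀ z ≥ n, f z ∈ U)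

/-- The restrictions of `f` and `g` to `[j, ∞)` are homotopic through maps whose tail is
controlled by `𝒰`. -/
def RayHomotopic {X : Type*} (V : SemiCoarse X) (𝒰 : Set (Set X)) (j : ℤ) (f g : ℤ → X) : Prop :=
  HomotopicThrough (RayIn 𝒰) (zOne.sub (Set.Ici j)) V (fun z => f z) (fun z => g z)

/-- The restriction of `g` to `[a, ∞)` is periodic. -/
def PeriodicFrom {X : Type*} (g : ℤ → X) (a : ℤ) : Prop :=
  ∃ p : ℤ, 0 < p ∧ ∀ z ≥ a, g (z + p) = g z

/-- The condition on right tails in the definitions of merging and deleting: if `g` is periodic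
on `[j - 1, ∞)` but not on some `[j - k, ∞)` with `k > 1`, then it is homotopic to a constant
on `[j, ∞)`. -/
def TailCond {X : Type*} (V : SemiCoarse X) (𝒰 : Set (Set X)) (g : ℤ → X) (j : ℤ) : Prop :=
  PeriodicFrom g (j - 1) → (∃ k : ℤ, 1 < k ∧ ¬ PeriodicFrom g (j - k)) →
    ∃ c : X, RayHomotopic V 𝒰 j g (fun _ => c)

/-- The condition `TailCond` on the right tail, and its mirror image on the left tail. -/
def Admissible {X : Type*} (V : SemiCoarse X) (𝒰 : Set (Set X)) (g : ℤ → X) (j : ℤ) : Prop :=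
  TailCond V 𝒰 g j ∧ TailCond V 𝒰 (fun z => g (-z)) (-j)

/-- Bornologous maps `ℤ₁ → X` whose tails are controlled by `𝒰`. -/
@[ext]
structure CMap {X : Type u} (V : SemiCoarse X) (𝒰 : Set (Set X)) where
  toFun : ℤ → X
  born : Bornologous zOne V toFun
  tails : TailsIn 𝒰 toFun

section basic

variable {X Y : Type*}

theorem Bornologous.comp {Z : Type*} {V : SemiCoarse X} {W : SemiCoarse Y} {T : SemiCoarse Z}
    {g : Y → Z} {f : X → Y} (hg : Bornologous W T g) (hf : Bornologous V W f) :
    Bornologous V T (g ∘ f) := by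
  intro E hE
  have := hg _ (hf E hE)
  rwa [← Set.image_comp] at this

theorem Bornologous.prodMap {S T S' T' : Type*} {V : SemiCoarse S} {W : SemiCoarse T}
    {V' : SemiCoarse S'} {W' : SemiCoarse T'} {f : S → S'} {g : T → T'}
    (hf : Bornologous V V' f) (hg : Bornologous W W' g) :
    Bornologous (V.prod W) (V'.prod W') (Prod.map f g) := by
  rintro K ⟨E, hE, F, hF, h⟩
  refine ⟨_, hf E hE, _, hg F hF, ?_⟩
  rintro _ ⟨⟨⟨a, b⟩, ⟨c, d⟩⟩, hp, rfl⟩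
  exact ⟨⟨_, (h hp).1, rfl⟩, ⟨_, (h hp).2, rfl⟩⟩

theorem bornologous_fst {S T : Type*} (V : SemiCoarse S) (W : SemiCoarse T) :
    Bornologous (V.prod W) V Prod.fst := by
  rintro K ⟨E, hE, F, hF, h⟩
  refine V.mem_of_subset hE ?_
  rintro _ ⟨p, hp, rfl⟩
  exact (h hp).1

theorem bornologous_id (V : SemiCoarse X) : Bornologous V V (fun x => x) := by
  intro E hE
  refine V.mem_of_subset hE ?_
  rintro _ ⟨p, hp, rfl⟩
  exact hp

theorem bornologous_val (V : SemiCoarse X) (S : Set X) :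
    Bornologous (V.sub S) V Subtype.val := by
  rintro _ ⟨F, hF, rfl⟩
  exact V.mem_of_subset hF (Set.image_preimage_subset _ _)

theorem bornologous_sub {V : SemiCoarse X} {W : SemiCoarse Y} {S : Set Y} {f : X → S}
    (h : Bornologous V W (fun x => (f x : Y))) : Bornologous V (W.sub S) f := by
  intro E hE
  refine (W.sub S).mem_of_subset (F := Prod.map Subtype.val Subtype.val ⁻¹' _) ⟨_, h E hE, rfl⟩ ?_
  rintro _ ⟨p, hp, rfl⟩
  exact ⟨p, hp, rfl⟩

theorem bornologous_zOne {f : ℤ → ℤ} (h : ∀ a b, |b - a| ≤ 1 → |f b - f a| ≤ 1) :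
    Bornologous zOne zOne f := by
  rintro E hE _ ⟨p, hp, rfl⟩
  exact h _ _ (hE p hp)

theorem bornologous_neg : Bornologous zOne zOne (fun z => -z) :=
  bornologous_zOne fun a b h => by
    have : -b - -a = -(b - a) := by ring
    rw [this, abs_neg]
    exact h

theorem bornologous_add (d : ℤ) : Bornologous zOne zOne (fun z => z + d) :=
  bornologous_zOne fun a b h => by simpa using h

variable {S S' : Type*} {P : (S → Y) → Prop} {VS : SemiCoarse S} {VY : SemiCoarse Y}

theorem HomotopicThrough.refl {f : S → Y} (hf : Bornologous VS VY f) (hP : P f) :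
    HomotopicThrough P VS VY f f :=
  ⟨fun p => f p.1, hf.comp (bornologous_fst _ _), ⟨0, 0, fun _ => ⟨fun _ _ => rfl, fun _ _ => rfl⟩⟩,
    fun _ => hP⟩

theorem HomotopicThrough.symm {f g : S → Y} (h : HomotopicThrough P VS VY f g) :
    HomotopicThrough P VS VY g f := by
  obtain ⟨H, hH, ⟨M, N, hMN⟩, hP⟩ := h
  refine ⟨H ∘ Prod.map (fun s => s) (fun z => -z),
    hH.comp ((bornologous_id VS).prodMap bornologous_neg), ⟨-N, -M, fun s => ⟨?_, ?_⟩⟩, fun k => hP _⟩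
  · intro k hk
    exact (hMN s).2 (-k) (by omega)
  · intro k hk
    exact (hMN s).1 (-k) (by omega)

theorem HomotopicThrough.precomp {f g : S → Y} (h : HomotopicThrough P VS VY f g)
    {VS' : SemiCoarse S'} {P' : (S' → Y) → Prop} {φ : S' → S} (hφ : Bornologous VS' VS φ)
    (hPP : ∀ h, P h → P' (fun s => h (φ s))) :
    HomotopicThrough P' VS' VY (fun s => f (φ s)) (fun s => g (φ s)) := by
  obtain ⟨H, hH, ⟨M, N, hMN⟩, hP⟩ := h
  exact ⟨H ∘ Prod.map φ (fun z => z), hH.comp (hφ.prodMap (bornologous_id _)),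
    ⟨M, N, fun s => hMN (φ s)⟩, fun k => hPP _ (hP k)⟩

theorem HomotopicThrough.postcomp {Y' : Type*} {f g : S → Y} (h : HomotopicThrough P VS VY f g)
    {VY' : SemiCoarse Y'} {P' : (S → Y') → Prop} {φ : Y → Y'} (hφ : Bornologous VY VY' φ)
    (hPP : ∀ h, P h → P' (fun s => φ (h s))) :
    HomotopicThrough P' VS VY' (fun s => φ (f s)) (fun s => φ (g s)) := by
  obtain ⟨H, hH, ⟨M, N, hMN⟩, hP⟩ := h
  exact ⟨φ ∘ H, hφ.comp hH, ⟨M, N, fun s => ⟨fun k hk => congrArg φ ((hMN s).1 k hk),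
    fun k hk => congrArg φ ((hMN s).2 k hk)⟩⟩, fun k => hPP _ (hP k)⟩

theorem HomotopicThrough.trans {f g h : S → Y} (h₁ : HomotopicThrough P VS VY f g)
    (h₂ : HomotopicThrough P VS VY g h) : HomotopicThrough P VS VY f h := by
  obtain ⟨H, hH, ⟨M, N, hMN⟩, hP⟩ := h₁
  obtain ⟨H', hH', ⟨M', N', hMN'⟩, hP'⟩ := h₂
  refine ⟨fun p => if p.2 ≤ N then H p else H' (p.1, p.2 - N + M'), ?_,
    ⟨min M N, max (N + 1) (N' + N - M'), fun s => ⟨?_, ?_⟩⟩, ?_⟩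
  · rintro K ⟨E, hE, F, hF, hK⟩
    set L : Set ((S × ℤ) × S × ℤ) := {p | (p.1.1, p.2.1) ∈ E ∧ |p.2.2 - p.1.2| ≤ 1} with hL
    have hLm : L ∈ (VS.prod zOne).sets :=
      ⟨E, hE, {q | |q.2 - q.1| ≤ 1}, fun q hq => hq, fun p hp => hp⟩
    refine VY.mem_of_subset (VY.union_mem (hH L hLm) (hH' L hLm)) ?_
    rintro _ ⟨⟨⟨s, k⟩, ⟨t, l⟩⟩, hp, rfl⟩
    have h1 : (s, t) ∈ E := (hK hp).1
    have h2 : |l - k| ≤ 1 := hF _ (hK hp).2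
    have h3 := abs_le.1 h2
    simp only [Prod.map_apply]
    by_cases hk : k ≤ N <;> by_cases hl : l ≤ N
    · left
      exact ⟨((s, k), (t, l)), ⟨h1, h2⟩, by simp [hk, hl]⟩
    · right
      refine ⟨((s, M'), (t, l - N + M')), ⟨h1, abs_le.2 ⟨?_, ?_⟩⟩, ?_⟩
      · dsimp only; omega
      · dsimp only; omega
      · have hkN : k = N := by omega
        simp only [Prod.map_apply, hk, hl, if_true, if_false]
        rw [(hMN' s).1 M' le_rfl, (hMN s).2 k (by omega)]
    · right
      refine ⟨((s, k - N + M'), (t, M')), ⟨h1, abs_le.2 ⟨?_, ?_⟩⟩, ?_⟩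
      · dsimp only; omega
      · dsimp only; omega
      · have hkN : l = N := by omega
        simp only [Prod.map_apply, hk, hl, if_true, if_false]
        rw [(hMN' t).1 M' le_rfl, (hMN t).2 l (by omega)]
    · right
      refine ⟨((s, k - N + M'), (t, l - N + M')), ⟨h1, abs_le.2 ⟨?_, ?_⟩⟩, ?_⟩
      · dsimp only; omega
      · dsimp only; omega
      · simp [hk, hl]
  · intro k hk
    have : k ≤ N := by omega
    simp only [this, if_true]
    exact (hMN s).1 k (by omega)
  · intro k hk
    have : ¬ k ≤ N := by omega
    simp only [this, if_false]
    exact (hMN' s).2 _ (by omega)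
  · intro k
    by_cases hk : k ≤ N
    · simpa only [hk, if_true] using hP k
    · simpa only [hk, if_false] using hP' (k - N + M')

end basic

namespace CMap

variable {X : Type u} {V : SemiCoarse X} {𝒰 : Set (Set X)}

/-- The opposite direction `z ↦ f (-z)`. -/
def opp (f : CMap V 𝒰) : CMap V 𝒰 where
  toFun z := f.toFun (-z)
  born := f.born.comp bornologous_neg
  tails := by
    obtain ⟨⟨U, hU, n, hn⟩, ⟨U', hU', n', hn'⟩⟩ := f.tails
    exact ⟨⟨U', hU', -n', fun z hz => hn' _ (by omega)⟩,
      ⟨U, hU, -n, fun z hz => hn _ (by omega)⟩⟩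

/-- Symmetric maps. -/
def IsSymm (f : CMap V 𝒰) : Prop := ∀ z, f.toFun (-z) = f.toFun z

/-- `g` is the result of deleting some coordinate `z₀` in `f` (equivalently, `f` is the result
of adding a point at `z₀` in `g`). -/
def Del (f g : CMap V 𝒰) : Prop :=
  ∃ z₀ : ℤ, (∀ z, g.toFun z = if z < z₀ then f.toFun z else f.toFun (z + 1)) ∧
    Admissible V 𝒰 g.toFun z₀

/-- Some right tail of `f` is homotopic to the opposite of some left tail of `g`. -/
def Link (f g : CMap V 𝒰) : Prop :=
  ∃ N M : ℤ, RayHomotopic V 𝒰 0 (fun z => f.toFun (z + N)) (fun z => g.toFun (-z + M))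

/-- Deleting two consecutive opposite maps in a string with at least three entries. -/
def DelOpp (F F' : List (CMap V 𝒰)) : Prop :=
  ∃ (L R : List (CMap V 𝒰)) (f g : CMap V 𝒰) (N : ℤ),
    F = L ++ f :: g :: R ∧ F' = L ++ R ∧ F' ≠ [] ∧ ∀ z, f.toFun z = g.opp.toFun (z + N)

/-- Merging, at a point `j`, two consecutive maps whose facing tails are the same constant. -/
def Merge (F F' : List (CMap V 𝒰)) : Prop :=
  ∃ (L R : List (CMap V 𝒰)) (f g h : CMap V 𝒰) (x₀ : X) (N M j : ℤ),
    F = L ++ f :: g :: R ∧ F' = L ++ h :: R ∧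
    (∀ z ≥ N, f.toFun z = x₀) ∧ (∀ z ≤ M, g.toFun z = x₀) ∧ N ≤ j ∧ j ≤ M ∧
    (∀ z, h.toFun z = if z ≤ j then f.toFun z else g.toFun z) ∧ Admissible V 𝒰 h.toFun j

/-- The elementary relations between strings: deleting opposite maps, merging, and entrywise
deleting and adding of points. -/
def Step (F F' : List (CMap V 𝒰)) : Prop :=
  DelOpp F F' ∨ Merge F F' ∨ List.Forall₂ (Relation.EqvGen Del) F F'

/-- Two symmetric maps are eventually equal or homotopic. -/
def SymRel (f g : {f : CMap V 𝒰 // f.IsSymm}) : Prop :=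
  (∃ N M : ℕ, ∀ k : ℕ, f.1.toFun (N + k) = g.1.toFun (M + k)) ∨
    HomotopicThrough (TailsIn 𝒰) zOne V f.1.toFun g.1.toFun

end CMap

/-- The objects of the `𝒰`-relative fundamental groupoid: the classes of symmetric maps under the
equivalence relation generated by being eventually equal or homotopic. -/
def RelFundGrpd {X : Type u} (V : SemiCoarse X) (𝒰 : Set (Set X)) : Type u :=
  Quot (CMap.SymRel (V := V) (𝒰 := 𝒰))

namespace RelFundGrpd

open CMap

variable {X : Type u} {V : SemiCoarse X} {𝒰 : Set (Set X)}

/-- The class of a symmetric map. -/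
def cls (f : CMap V 𝒰) (hf : f.IsSymm) : RelFundGrpd V 𝒰 := Quot.mk _ ⟨f, hf⟩

/-- The list `F` is a string from `a` to `b`. -/
def IsString (a b : RelFundGrpd V 𝒰) (F : List (CMap V 𝒰)) : Prop :=
  F ≠ [] ∧ ∃ (f g : CMap V 𝒰) (hf : f.IsSymm) (hg : g.IsSymm), cls f hf = a ∧ cls g hg = b ∧
    List.IsChain Link (f :: (F ++ [g]))

/-- Morphisms: strings modulo the equivalence relation generated by the elementary relations. -/
def StrHom (a b : RelFundGrpd V 𝒰) : Type u :=
  Quot fun F F' : {F : List (CMap V 𝒰) // IsString a b F} => Step F.1 F'.1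

/-- Equivalence of right tails up to shifts; used to see that strings compose. -/
def TailRel (V : SemiCoarse X) (𝒰 : Set (Set X)) (f g : ℤ → X) : Prop :=
  ∃ N M : ℤ, RayHomotopic V 𝒰 0 (fun z => f (z + N)) (fun z => g (z + M))

theorem TailRel.symm {f g : ℤ → X} (h : TailRel V 𝒰 f g) : TailRel V 𝒰 g f :=
  let ⟨N, M, h⟩ := h
  ⟨M, N, HomotopicThrough.symm h⟩

theorem TailRel.shift {f g : ℤ → X} {N M : ℤ}
    (h : RayHomotopic V 𝒰 0 (fun z => f (z + N)) (fun z => g (z + M))) {d : ℤ} (hd : 0 ≤ d) :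
    RayHomotopic V 𝒰 0 (fun z => f (z + (d + N))) (fun z => g (z + (d + M))) := by
  let φ : Set.Ici (0 : ℤ) → Set.Ici (0 : ℤ) := fun z => ⟨z + d, by
    have := z.2
    simp only [Set.mem_Ici] at this ⊢
    omega⟩
  have hφ : Bornologous (zOne.sub (Set.Ici (0 : ℤ))) (zOne.sub (Set.Ici (0 : ℤ))) φ :=
    bornologous_sub ((bornologous_add d).comp (bornologous_val zOne _))
  have := HomotopicThrough.precomp h (P' := RayIn 𝒰) hφ (by
    rintro u ⟨U, hU, n, hn⟩
    exact ⟨U, hU, n, fun z hz => hn _ (by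
      change n ≤ (z : ℤ) + d
      omega)⟩)
  simpa [RayHomotopic, φ, add_assoc] using this

theorem TailRel.trans {f g h : ℤ → X} (h₁ : TailRel V 𝒰 f g) (h₂ : TailRel V 𝒰 g h) :
    TailRel V 𝒰 f h := by
  obtain ⟨N, M, h₁⟩ := h₁
  obtain ⟨N', M', h₂⟩ := h₂
  rcases le_total M N' with hle | hle
  · have := TailRel.shift h₁ (d := N' - M) (by omega)
    rw [show N' - M + M = N' by omega] at this
    exact ⟨_, _, HomotopicThrough.trans this h₂⟩
  · have := TailRel.shift h₂ (d := M - N') (by omega)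
    rw [show M - N' + N' = M by omega] at this
    exact ⟨_, _, HomotopicThrough.trans h₁ this⟩

theorem TailRel.refl (f : CMap V 𝒰) : TailRel V 𝒰 f.toFun f.toFun := by
  refine ⟨0, 0, HomotopicThrough.refl ?_ ?_⟩
  · exact (f.born.comp (bornologous_add 0)).comp (bornologous_val zOne _)
  · obtain ⟨U, hU, n, hn⟩ := f.tails.2
    exact ⟨U, hU, n, fun z hz => hn _ (by omega)⟩

theorem link_iff {f g : CMap V 𝒰} : Link f g ↔ TailRel V 𝒰 f.toFun g.opp.toFun := by
  constructor
  · rintro ⟨N, M, h⟩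
    refine ⟨N, -M, ?_⟩
    convert h using 2 with z
    change g.toFun _ = _
    congr 1
    omega
  · rintro ⟨N, M, h⟩
    refine ⟨N, -M, ?_⟩
    convert h using 2 with z
    change _ = g.toFun _
    congr 1
    omega

theorem opp_opp (f : CMap V 𝒰) : f.opp.opp = f := by
  ext z
  exact congrArg f.toFun (neg_neg z)

theorem _root_.CMap.IsSymm.opp_eq {f : CMap V 𝒰} (hf : f.IsSymm) : f.opp = f := by
  ext z
  exact hf z

theorem _root_.CMap.Link.swap {f g : CMap V 𝒰} (h : Link f g) : Link g.opp f.opp := by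
  rw [link_iff] at h ⊢
  rw [opp_opp]
  exact h.symm

theorem link_opp (f : CMap V 𝒰) : Link f f.opp := by
  rw [link_iff, opp_opp]
  exact TailRel.refl f

theorem _root_.CMap.Link.trans_opp {f g h : CMap V 𝒰} (h₁ : Link f g) (h₂ : Link g.opp h) : Link f h := by
  rw [link_iff] at *
  exact h₁.trans h₂

theorem tailRel_of_cls {f g : CMap V 𝒰} {hf : f.IsSymm} {hg : g.IsSymm}
    (h : cls f hf = cls g hg) : TailRel V 𝒰 f.toFun g.toFun := by
  have key : ∀ p q : {f : CMap V 𝒰 // f.IsSymm}, Relation.EqvGen SymRel p q →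
      TailRel V 𝒰 p.1.toFun q.1.toFun := by
    intro p q hpq
    induction hpq with
    | rel p q hpq =>
      rcases hpq with ⟨N, M, h⟩ | h
      · have e : RayHomotopic V 𝒰 0 (fun z => p.1.toFun (z + N)) (fun z => p.1.toFun (z + N)) := by
          refine HomotopicThrough.refl
            ((p.1.born.comp (bornologous_add N)).comp (bornologous_val zOne _)) ?_
          obtain ⟨U, hU, n, hn⟩ := p.1.tails.2
          exact ⟨U, hU, n, fun z hz => hn _ (by omega)⟩
        refine ⟨N, M, ?_⟩
        have e2 : (fun z : Set.Ici (0 : ℤ) => p.1.toFun (z + N)) =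
            fun z : Set.Ici (0 : ℤ) => q.1.toFun (z + M) := by
          funext ⟨z, hz⟩
          lift z to ℕ using hz
          have := h z
          simpa [add_comm] using this
        unfold RayHomotopic at e ⊢
        rw [← e2]
        exact e
      · refine ⟨0, 0, ?_⟩
        have := HomotopicThrough.precomp h (P' := RayIn 𝒰) (bornologous_val zOne (Set.Ici 0)) (by
          rintro u ⟨-, U, hU, n, hn⟩
          exact ⟨U, hU, n, fun z hz => hn z hz⟩)
        simpa [RayHomotopic] using this
    | refl p => exact TailRel.refl p.1
    | symm p q _ ih => exact ih.symm
    | trans p q r _ _ ih₁ ih₂ => exact ih₁.trans ih₂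
  exact key _ _ (Quot.eqvGen_exact h)

theorem _root_.CMap.Link.congr_right {f g g' : CMap V 𝒰} {hg : g.IsSymm} {hg' : g'.IsSymm}
    (h : Link f g) (e : cls g hg = cls g' hg') : Link f g' := by
  rw [link_iff, IsSymm.opp_eq ‹_›] at *
  exact h.trans (tailRel_of_cls e)

theorem _root_.CMap.Link.congr_left {f g g' : CMap V 𝒰} {hg : g.IsSymm} {hg' : g'.IsSymm}
    (h : Link g f) (e : cls g hg = cls g' hg') : Link g' f := by
  rw [link_iff] at *
  exact (tailRel_of_cls e).symm.trans h

theorem _root_.CMap.Link.join {f g g' h : CMap V 𝒰} {hg : g.IsSymm} {hg' : g'.IsSymm}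
    (h₁ : Link f g) (e : cls g hg = cls g' hg') (h₂ : Link g' h) : Link f h := by
  refine h₁.trans_opp ?_
  rw [hg.opp_eq]
  exact h₂.congr_left e.symm

theorem link_symm {f : CMap V 𝒰} (hf : f.IsSymm) : Link f f := by
  have := link_opp f
  rwa [hf.opp_eq] at this

theorem chain_iff {f g : CMap V 𝒰} {F : List (CMap V 𝒰)} (hF : F ≠ []) :
    List.IsChain Link (f :: (F ++ [g])) ↔
      (∀ x ∈ F.head?, Link f x) ∧ List.IsChain Link F ∧ ∀ x ∈ F.getLast?, Link x g := by
  rw [List.isChain_cons, List.isChain_append, List.head?_append_of_ne_nil _ hF]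
  simp

theorem IsString.append {a b c : RelFundGrpd V 𝒰} {F G : List (CMap V 𝒰)}
    (hF : IsString a b F) (hG : IsString b c G) : IsString a c (F ++ G) := by
  obtain ⟨nF, f, g, hf, hg, ha, hb, hc⟩ := hF
  obtain ⟨nG, f', g', hf', hg', ha', hb', hc'⟩ := hG
  refine ⟨by simp [nF], f, g', hf, hg', ha, hb', ?_⟩
  rw [chain_iff nF] at hc
  rw [chain_iff nG] at hc'
  rw [chain_iff (by simp [nF]), List.head?_append_of_ne_nil _ nF, List.isChain_append,
    List.getLast?_append_of_ne_nil _ nG]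
  exact ⟨hc.1, ⟨hc.2.1, hc'.2.1, fun x hx y hy =>
    Link.join (hg := hg) (hg' := hf') (hc.2.2 x hx) (hb.trans ha'.symm) (hc'.1 y hy)⟩, hc'.2.2⟩

/-- The opposite direction of a string. -/
def rev (F : List (CMap V 𝒰)) : List (CMap V 𝒰) := (F.map CMap.opp).reverse

theorem rev_rev (F : List (CMap V 𝒰)) : rev (rev F) = F := by
  simp [rev, List.map_reverse, Function.comp_def, opp_opp]

theorem isChain_rev {F : List (CMap V 𝒰)} (h : List.IsChain Link F) :
    List.IsChain Link (rev F) := by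
  rw [rev, List.isChain_reverse, List.isChain_map]
  exact h.imp fun _ _ h => h.swap

theorem IsString.rev {a b : RelFundGrpd V 𝒰} {F : List (CMap V 𝒰)}
    (hF : IsString a b F) : IsString b a (rev F) := by
  obtain ⟨nF, f, g, hf, hg, ha, hb, hc⟩ := hF
  refine ⟨by simp [RelFundGrpd.rev, nF], g, f, hg, hf, hb, ha, ?_⟩
  have := isChain_rev hc
  simpa [RelFundGrpd.rev, hf.opp_eq, hg.opp_eq] using this

theorem isString_pair {f : CMap V 𝒰} (hf : f.IsSymm) :
    IsString (cls f hf) (cls f hf) [f, f] := by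
  refine ⟨by simp, f, f, hf, hf, rfl, rfl, ?_⟩
  simp [link_symm hf]

theorem _root_.CMap.Step.append_left (L : List (CMap V 𝒰)) {F F' : List (CMap V 𝒰)} (h : Step F F') :
    Step (L ++ F) (L ++ F') := by
  rcases h with h | h | h
  · obtain ⟨A, B, f, g, N, rfl, rfl, hne, h⟩ := h
    refine Or.inl ⟨L ++ A, B, f, g, N, by simp, by simp, ?_, h⟩
    intro h0
    exact hne (List.append_eq_nil_iff.1 h0).2
  · obtain ⟨A, B, f, g, k, x, N, M, j, rfl, rfl, h⟩ := h
    exact Or.inr (Or.inl ⟨L ++ A, B, f, g, k, x, N, M, j, by simp, by simp, h⟩)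
  · refine Or.inr (Or.inr (List.rel_append ?_ h))
    exact List.forall₂_same.2 fun x _ => Relation.EqvGen.refl x

theorem _root_.CMap.Step.append_right (L : List (CMap V 𝒰)) {F F' : List (CMap V 𝒰)} (h : Step F F') :
    Step (F ++ L) (F' ++ L) := by
  rcases h with h | h | h
  · obtain ⟨A, B, f, g, N, rfl, rfl, hne, h⟩ := h
    refine Or.inl ⟨A, B ++ L, f, g, N, by simp, by simp, ?_, h⟩
    intro h0
    exact hne (List.append_eq_nil_iff.1 h0).1
  · obtain ⟨A, B, f, g, k, x, N, M, j, rfl, rfl, h⟩ := h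
    exact Or.inr (Or.inl ⟨A, B ++ L, f, g, k, x, N, M, j, by simp, by simp, h⟩)
  · refine Or.inr (Or.inr (List.rel_append h ?_))
    exact List.forall₂_same.2 fun x _ => Relation.EqvGen.refl x

/-- The class of a string. -/
def hmk {a b : RelFundGrpd V 𝒰} (F : List (CMap V 𝒰)) (hF : IsString a b F) : StrHom a b :=
  Quot.mk _ ⟨F, hF⟩

theorem hmk_sound {a b : RelFundGrpd V 𝒰} {F F' : List (CMap V 𝒰)} {hF : IsString a b F}
    {hF' : IsString a b F'} (h : Step F F') : hmk F hF = hmk F' hF' := Quot.sound h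

theorem hmk_delOpp {a b : RelFundGrpd V 𝒰} (L R : List (CMap V 𝒰)) (f : CMap V 𝒰)
    (h : IsString a b (L ++ f :: f.opp :: R)) (h' : IsString a b (L ++ R)) :
    hmk _ h = hmk _ h' :=
  hmk_sound (Or.inl ⟨L, R, f, f.opp, 0, rfl, rfl, h'.1, fun z => by rw [opp_opp, add_zero]⟩)

/-- Composition: concatenation of strings. -/
def comp {a b c : RelFundGrpd V 𝒰} : StrHom a b → StrHom b c → StrHom a c :=
  Quot.map₂ (fun F G => ⟨F.1 ++ G.1, F.2.append G.2⟩)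
    (fun F _ _ h => Step.append_left F.1 h) (fun _ _ G h => Step.append_right G.1 h)

/-- The identity: the class of `(f, f)` for a symmetric map `f` in the class `a`. -/
noncomputable def ident (a : RelFundGrpd V 𝒰) : StrHom a a :=
  hmk [a.out.1, a.out.1] (by
    have := isString_pair a.out.2
    rwa [show cls a.out.1 a.out.2 = a from Quot.out_eq a] at this)

noncomputable instance : Category (RelFundGrpd V 𝒰) where
  Hom := StrHom
  id := ident
  comp := comp
  id_comp := by
    rintro a b ⟨F, hF⟩
    have hs : a.out.1.opp = a.out.1 := a.out.2.opp_eq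
    refine Quot.sound (Or.inl ⟨[], F, a.out.1, a.out.1, 0, rfl, rfl, hF.1, fun z => ?_⟩)
    rw [hs, add_zero]
  comp_id := by
    rintro a b ⟨F, hF⟩
    have hs : b.out.1.opp = b.out.1 := b.out.2.opp_eq
    refine Quot.sound (Or.inl ⟨F, [], b.out.1, b.out.1, 0, rfl, by simp, by simpa using hF.1,
      fun z => ?_⟩)
    rw [hs, add_zero]
  assoc := by
    rintro a b c d ⟨F⟩ ⟨G⟩ ⟨H⟩
    exact congrArg (Quot.mk _) (Subtype.ext (List.append_assoc _ _ _))

/-- The morphism given by a string. -/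
def mor {a b : RelFundGrpd V 𝒰} (F : List (CMap V 𝒰)) (hF : IsString a b F) : a ⟶ b := hmk F hF

theorem mor_comp {a b c : RelFundGrpd V 𝒰} {F G : List (CMap V 𝒰)} (hF : IsString a b F)
    (hG : IsString b c G) :
    ((mor F hF) ≫ (mor G hG)) = mor (F ++ G) (hF.append hG) := rfl

theorem mor_pair {f : CMap V 𝒰} (hf : f.IsSymm) :
    (mor [f, f] (isString_pair hf)) = 𝟙 _ := by
  rw [← Category.comp_id (mor [f, f] (isString_pair hf))]
  refine Quot.sound (Or.inl ⟨[], _, f, f, 0, rfl, rfl, by simp, fun z => ?_⟩)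
  rw [hf.opp_eq, add_zero]

theorem id_eq_pair (a : RelFundGrpd V 𝒰) {f : CMap V 𝒰} (hf : f.IsSymm) (h : cls f hf = a) :
    𝟙 a = mor [f, f] (h ▸ isString_pair hf) := by
  subst h
  exact (mor_pair hf).symm

theorem isString_loop {f : CMap V 𝒰} (hf : f.IsSymm) {F : List (CMap V 𝒰)}
    (h : List.IsChain Link (f :: F)) : IsString (cls f hf) (cls f hf) ([f, f] ++ (F ++ rev F)) := by
  refine ⟨by simp, f, f, hf, hf, rfl, rfl, ?_⟩
  have h1 : List.IsChain Link ((f :: F) ++ rev (f :: F)) := by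
    rw [List.isChain_append]
    refine ⟨h, isChain_rev h, ?_⟩
    intro x hx y hy
    have : y = x.opp := by
      simp only [rev, List.head?_reverse, List.getLast?_map, Option.mem_def] at hx hy
      rw [hx] at hy
      simpa using hy.symm
    rw [this]
    exact link_opp x
  have h2 : (f :: F) ++ rev (f :: F) = f :: (F ++ rev F ++ [f]) := by
    simp [rev, hf.opp_eq]
  rw [h2] at h1
  simpa [link_symm hf] using h1

theorem mor_loop {f : CMap V 𝒰} (hf : f.IsSymm) (F : List (CMap V 𝒰))
    (h : List.IsChain Link (f :: F)) :
    (mor _ (isString_loop hf h)) = 𝟙 _ := by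
  induction F using List.reverseRecOn with
  | nil => exact mor_pair hf
  | append_singleton F x ih =>
    have h' : List.IsChain Link (f :: F) := by
      rw [← List.cons_append] at h
      exact (List.isChain_append.1 h).1
    refine Eq.trans ?_ (ih h')
    refine hmk_sound (Or.inl ⟨[f, f] ++ F, rev F, x, x.opp, 0, by simp [rev], by simp,
      by simp, fun z => ?_⟩)
    rw [opp_opp, add_zero]

theorem mor_comp_rev {a b : RelFundGrpd V 𝒰} {F : List (CMap V 𝒰)} (hF : IsString a b F) :
    ((mor F hF) ≫ (mor (rev F) hF.rev)) = 𝟙 a := by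
  obtain ⟨nF, f, g, hf, hg, rfl, rfl, hc⟩ := id hF
  have h : List.IsChain Link (f :: F) := by
    rw [← List.cons_append] at hc
    exact (List.isChain_append.1 hc).1
  rw [← mor_loop hf F h, ← Category.id_comp (_ ≫ _), ← mor_pair hf]
  rfl

theorem mor_rev_comp {a b : RelFundGrpd V 𝒰} {F : List (CMap V 𝒰)} (hF : IsString a b F) :
    ((mor (rev F) hF.rev) ≫ (mor F hF)) = 𝟙 b := by
  have := mor_comp_rev hF.rev
  simpa only [rev_rev] using this

noncomputable instance : Groupoid (RelFundGrpd V 𝒰) :=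
  Groupoid.ofIsIso fun {a b} φ => by
    induction φ using Quot.ind with
    | mk F => exact ⟨mor (rev F.1) F.2.rev, mor_comp_rev F.2, mor_rev_comp F.2⟩

section map

variable {Y : Type u} {W : SemiCoarse Y} {𝒲 : Set (Set Y)}

/-- An injective bornologous map which sends every member of `𝒰` into a member of `𝒲`. -/
structure Incl (V : SemiCoarse X) (𝒰 : Set (Set X)) (W : SemiCoarse Y) (𝒲 : Set (Set Y)) where
  toFun : X → Y
  inj : Function.Injective toFun
  born : Bornologous V W toFun
  mapsTo : ∀ U ∈ 𝒰, ∃ T ∈ 𝒲, Set.MapsTo toFun U T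

variable (φ : Incl V 𝒰 W 𝒲)

theorem Incl.rayIn {j : ℤ} {f : Set.Ici j → X} (h : RayIn 𝒰 f) :
    RayIn 𝒲 (fun z => φ.toFun (f z)) := by
  obtain ⟨U, hU, n, hn⟩ := h
  obtain ⟨T, hT, hUT⟩ := φ.mapsTo U hU
  exact ⟨T, hT, n, fun z hz => hUT (hn z hz)⟩

theorem Incl.tailsIn {f : ℤ → X} (h : TailsIn 𝒰 f) : TailsIn 𝒲 (fun z => φ.toFun (f z)) := by
  obtain ⟨⟨U, hU, n, hn⟩, U', hU', n', hn'⟩ := h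
  obtain ⟨T, hT, hUT⟩ := φ.mapsTo U hU
  obtain ⟨T', hT', hUT'⟩ := φ.mapsTo U' hU'
  exact ⟨⟨T, hT, n, fun z hz => hUT (hn z hz)⟩, T', hT', n', fun z hz => hUT' (hn' z hz)⟩

theorem Incl.rayHomotopic {j : ℤ} {f g : ℤ → X} (h : RayHomotopic V 𝒰 j f g) :
    RayHomotopic W 𝒲 j (fun z => φ.toFun (f z)) (fun z => φ.toFun (g z)) :=
  HomotopicThrough.postcomp h φ.born fun _ => φ.rayIn

/-- Composition with `φ`. -/
def Incl.onMaps (f : CMap V 𝒰) : CMap W 𝒲 where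
  toFun z := φ.toFun (f.toFun z)
  born := φ.born.comp f.born
  tails := φ.tailsIn f.tails

theorem Incl.periodic_iff {g : ℤ → X} {a : ℤ} :
    PeriodicFrom (fun z => φ.toFun (g z)) a ↔ PeriodicFrom g a := by
  simp only [PeriodicFrom, φ.inj.eq_iff]

theorem Incl.tailCond {g : ℤ → X} {j : ℤ} (h : TailCond V 𝒰 g j) :
    TailCond W 𝒲 (fun z => φ.toFun (g z)) j := by
  intro h1 h2
  simp only [φ.periodic_iff] at h1 h2
  obtain ⟨c, hc⟩ := h h1 h2
  exact ⟨φ.toFun c, φ.rayHomotopic hc⟩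

theorem Incl.admissible {g : ℤ → X} {j : ℤ} (h : Admissible V 𝒰 g j) :
    Admissible W 𝒲 (fun z => φ.toFun (g z)) j :=
  ⟨φ.tailCond h.1, φ.tailCond h.2⟩

theorem Incl.link {f g : CMap V 𝒰} (h : Link f g) : Link (φ.onMaps f) (φ.onMaps g) :=
  let ⟨N, M, h⟩ := h
  ⟨N, M, φ.rayHomotopic h⟩

theorem Incl.isSymm {f : CMap V 𝒰} (h : f.IsSymm) : (φ.onMaps f).IsSymm :=
  fun z => congrArg φ.toFun (h z)

theorem Incl.del {f g : CMap V 𝒰} (h : Del f g) : Del (φ.onMaps f) (φ.onMaps g) := by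
  obtain ⟨z₀, h, h'⟩ := h
  refine ⟨z₀, fun z => ?_, φ.admissible h'⟩
  change φ.toFun _ = _
  rw [h z, apply_ite φ.toFun]
  rfl

theorem Incl.step {F F' : List (CMap V 𝒰)} (h : Step F F') :
    Step (F.map φ.onMaps) (F'.map φ.onMaps) := by
  rcases h with h | h | h
  · obtain ⟨A, B, f, g, N, rfl, rfl, hne, h⟩ := h
    refine Or.inl ⟨A.map φ.onMaps, B.map φ.onMaps, φ.onMaps f, φ.onMaps g, N, by simp, by simp, ?_,
      fun z => congrArg φ.toFun (h z)⟩
    simpa using hne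
  · obtain ⟨A, B, f, g, k, x, N, M, j, rfl, rfl, h1, h2, h3, h4, h5, h6⟩ := h
    refine Or.inr (Or.inl ⟨A.map φ.onMaps, B.map φ.onMaps, φ.onMaps f, φ.onMaps g, φ.onMaps k,
      φ.toFun x, N, M, j, by simp, by simp, fun z hz => congrArg φ.toFun (h1 z hz),
      fun z hz => congrArg φ.toFun (h2 z hz), h3, h4, fun z => ?_, φ.admissible h6⟩)
    change φ.toFun _ = _
    rw [h5 z, apply_ite φ.toFun]
    rfl
  · refine Or.inr (Or.inr ?_)
    rw [List.forall₂_map_left_iff, List.forall₂_map_right_iff]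
    refine h.imp fun f g hfg => ?_
    induction hfg with
    | rel _ _ h => exact .rel _ _ (φ.del h)
    | refl _ => exact .refl _
    | symm _ _ _ ih => exact .symm _ _ ih
    | trans _ _ _ _ _ ih ih' => exact .trans _ _ _ ih ih'

/-- The map on objects. -/
def Incl.obj : RelFundGrpd V 𝒰 → RelFundGrpd W 𝒲 :=
  Quot.map (fun f => ⟨φ.onMaps f.1, φ.isSymm f.2⟩) (by
    rintro f g (⟨N, M, h⟩ | h)
    · exact Or.inl ⟨N, M, fun k => congrArg φ.toFun (h k)⟩
    · exact Or.inr (HomotopicThrough.postcomp h φ.born fun _ => φ.tailsIn))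

theorem Incl.isString {a b : RelFundGrpd V 𝒰} {F : List (CMap V 𝒰)} (h : IsString a b F) :
    IsString (φ.obj a) (φ.obj b) (F.map φ.onMaps) := by
  obtain ⟨nF, f, g, hf, hg, rfl, rfl, hc⟩ := h
  refine ⟨by simpa using nF, φ.onMaps f, φ.onMaps g, φ.isSymm hf, φ.isSymm hg, rfl, rfl, ?_⟩
  have := List.isChain_map_of_isChain (S := Link) φ.onMaps (fun _ _ => φ.link) hc
  simpa using this

/-- The functor induced by `φ`: it sends `[f₁, …, fₙ]` to `[φ f₁, …, φ fₙ]`. -/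
def Incl.functor : RelFundGrpd V 𝒰 ⥤ RelFundGrpd W 𝒲 where
  obj := φ.obj
  map {a b} := Quot.map (fun F => ⟨F.1.map φ.onMaps, φ.isString F.2⟩) (fun _ _ h => φ.step h)
  map_id a := by
    refine Eq.trans ?_ (id_eq_pair (φ.obj a) (φ.isSymm a.out.2)
      (congrArg φ.obj (Quot.out_eq a))).symm
    rfl
  map_comp := by
    rintro a b c ⟨F⟩ ⟨G⟩
    exact congrArg (Quot.mk _) (Subtype.ext List.map_append)

end map

/-- The relative fundamental groupoid `π_{≤ 1}(X, 𝒰)` in the category of groupoids. -/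
noncomputable def grpd (V : SemiCoarse X) (𝒰 : Set (Set X)) : Grpd.{u, u} :=
  Grpd.of (RelFundGrpd V 𝒰)

/-- The family `𝒰 ∩ S` of subsets of `S`. -/
def trace (𝒰 : Set (Set X)) (S : Set X) : Set (Set S) :=
  (fun U => Subtype.val ⁻¹' U) '' 𝒰

/-- The groupoid `π_{≤ 1}(S, 𝒰 ∩ S)` of the subspace `S`. -/
noncomputable def grpdOn (V : SemiCoarse X) (𝒰 : Set (Set X)) (S : Set X) : Grpd.{u, u} :=
  grpd (V.sub S) (trace 𝒰 S)

/-- The functor `π_{≤ 1}(S, 𝒰 ∩ S) ⥤ π_{≤ 1}(T, 𝒰 ∩ T)` induced by an inclusion `S ⊆ T`. -/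
noncomputable def inclOn (V : SemiCoarse X) (𝒰 : Set (Set X)) {S T : Set X} (h : S ⊆ T) :
    grpdOn V 𝒰 S ⟶ grpdOn V 𝒰 T :=
  Incl.functor (V := V.sub S) (W := V.sub T)
    { toFun := Set.inclusion h
      inj := Set.inclusion_injective h
      born := bornologous_sub (bornologous_val V S)
      mapsTo := by
        rintro _ ⟨U, hU, rfl⟩
        exact ⟨_, ⟨U, hU, rfl⟩, fun x hx => hx⟩ }

theorem subset_of_mem_components (V : SemiCoarse X) {U C : Set X} (hC : C ∈ V.components U) :
    C ⊆ U := by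
  obtain ⟨x, rfl⟩ := hC
  rintro _ ⟨y, -, rfl⟩
  exact y.2

/-- The functor `π_{≤ 1}(S, 𝒰' ∩ S) ⥤ π_{≤ 1}(X, {U})` induced by the inclusion `S ⊆ X`, where
`𝒰'` is the collection of the components of `U`. -/
noncomputable def toWhole (V : SemiCoarse X) (U S : Set X) :
    grpdOn V (V.components U) S ⟶ grpd V {U} :=
  Incl.functor (V := V.sub S) (W := V)
    { toFun := Subtype.val
      inj := Subtype.val_injective
      born := bornologous_val V S
      mapsTo := by
        rintro _ ⟨C, hC, rfl⟩
        exact ⟨U, rfl, fun x hx => subset_of_mem_components V hC hx⟩ }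

end RelFundGrpd

/-! A functor out of the relative fundamental groupoid amounts to a labelling: a morphism for every
map `ℤ₁ → X`, compatible with opposites, merging and deletion (`Labelling.functor`,
`hom_induction`). The universal property thus becomes a statement about labels: compatible functors
on the groupoids of `A` and `B` label the maps with values in `A` or in `B`, and these labels must
extend uniquely to all maps.

The extension is by transport. Every point is tethered to `U` by a finite path that stays in each
member of the cover containing the point; such paths exist because the components of `A`, `B` and `A
∩ B` meet `U`. Conjugation with tethers gives a morphism for every step inside one member, and
deletion makes steps multiply around triangles (`Labelling.step_trans`). Well-splitting extends this
to all steps of `X`: a missing step is replaced by a path of two steps, connectedness makes the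
choice irrelevant, and triangles still close because their corners have a common neighbour
(`WellSplit.extend_trans`). A ray in `U` stays in one component, hence in one member, and is
labelled there, compatibly with steps (`Labelling.ray_step`). A map is then cut into a left ray, a
finite path and a right ray, and its value is the product of their labels (`TransportData.value`).

The delicate point is admissibility, which may forbid cutting a map with periodic tails. A step is
split off a periodic ray by a detour through a deletion (`Labelling.rayStep_of_ne`); the only rays
this misses alternate between two points, and those are null homotopic. A map that is admissible
nowhere lies in `U` (`exists_admOn_or_mem`), so in one component and one member, where its label is
taken directly. Admissibility in `X` and in a member refer to different null homotopies, so it is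
recorded relative to a set (`AdmOn`); for maps in a component of `U` one passes from `X` to the
member because tails of homotopies stay in the component (`AdmOn.of_component`).

For uniqueness, any labelling of a map that can be cut is transport (`Labelling.Agrees.eq_value`),
and the transport data are determined by the labels in `A` and `B`. -/

namespace SemiCoarse

/-! ### Adjacency, finite paths and components. -/

variable {X Y : Type*} {V : SemiCoarse X} {W : SemiCoarse Y}

/-- Two points are adjacent if the pair is controlled. -/
def Adj (V : SemiCoarse X) (x y : X) : Prop := {(x, y)} ∈ V.sets

theorem adj_of_mem {E : Set (X × X)} (hE : E ∈ V.sets) {x y : X} (h : (x, y) ∈ E) : V.Adj x y :=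
  V.mem_of_subset hE (Set.singleton_subset_iff.2 h)

theorem Adj.refl (V : SemiCoarse X) (x : X) : V.Adj x x :=
  adj_of_mem V.diagonal_mem rfl

theorem Adj.symm {x y : X} (h : V.Adj x y) : V.Adj y x :=
  adj_of_mem (V.inv_mem h) rfl

/-- For finite sets of pairs, being controlled is a pointwise condition; hence finite paths are
governed by adjacency alone and only the tails of a map `ℤ₁ → X` need a common controlled set. -/
theorem mem_sets_of_finite {E : Set (X × X)} (hE : E.Finite) (h : ∀ p ∈ E, V.Adj p.1 p.2) :
    E ∈ V.sets := by
  induction E, hE using Set.Finite.induction_on with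
  | empty => exact V.mem_of_subset V.diagonal_mem (Set.empty_subset _)
  | @insert a s _ _ ih =>
    rw [Set.insert_eq]
    exact V.union_mem (h a (Set.mem_insert _ _)) (ih fun p hp => h p (Set.mem_insert_of_mem _ hp))

theorem pair_mem_sets {x y x' y' : X} :
    {(x, y), (x', y')} ∈ V.sets ↔ V.Adj x y ∧ V.Adj x' y' := by
  constructor
  · intro h
    exact ⟨adj_of_mem h (by simp), adj_of_mem h (by simp)⟩
  · rintro ⟨h, h'⟩
    exact V.union_mem h h'

theorem _root_.Bornologous.adj {f : X → Y} (hf : Bornologous V W f) {x y : X} (h : V.Adj x y) :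
    W.Adj (f x) (f y) := by
  have := hf _ h
  rwa [Set.image_singleton] at this

theorem zOne_adj {a b : ℤ} : zOne.Adj a b ↔ |b - a| ≤ 1 := by
  constructor
  · intro h
    exact h (a, b) rfl
  · rintro h _ rfl
    exact h

theorem sub_adj {S : Set X} {x y : S} : (V.sub S).Adj x y ↔ V.Adj x y := by
  constructor
  · exact (bornologous_val V S).adj
  · intro h
    refine (V.sub S).mem_of_subset (F := Prod.map Subtype.val Subtype.val ⁻¹' _) ⟨_, h, rfl⟩ ?_
    rintro _ rfl
    rfl

theorem glue_adj {A B : Set X} {h : A ∪ B = Set.univ} {x y : X} :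
    (V.glue A B h).Adj x y ↔ V.Adj x y ∧ ((x ∈ A ∧ y ∈ A) ∨ (x ∈ B ∧ y ∈ B)) := by
  constructor
  · rintro ⟨E, hE, F, hF, h⟩
    have : (x, y) ∈ E ∩ A ×ˢ A ∪ F ∩ B ×ˢ B := h ▸ rfl
    rcases this with h | h
    · exact ⟨adj_of_mem hE h.1, Or.inl h.2⟩
    · exact ⟨adj_of_mem hF h.1, Or.inr h.2⟩
  · rintro ⟨hxy, h⟩
    refine ⟨_, hxy, _, hxy, ?_⟩
    ext p
    constructor
    · rintro rfl
      exact h.imp (fun h => ⟨rfl, h⟩) fun h => ⟨rfl, h⟩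
    · rintro (h | h)
      · exact h.1
      · exact h.1

theorem bornologous_of_finite {S : Set ℤ} (hS : S.Finite) {f : S → X}
    (h : ∀ a b : S, |(b : ℤ) - a| ≤ 1 → V.Adj (f a) (f b)) : Bornologous (zOne.sub S) V f := by
  rintro _ ⟨E, hE, rfl⟩
  have := hS.to_subtype
  refine mem_sets_of_finite (Set.toFinite _) ?_
  rintro _ ⟨p, hp, rfl⟩
  exact h _ _ (hE _ hp)

theorem joined_iff {x y : X} : V.Joined x y ↔ Relation.ReflTransGen V.Adj x y := by
  constructor
  · rintro ⟨n, γ, hγ, rfl, rfl⟩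
    have : ∀ i : ℕ, ∀ hi : i ≤ n, Relation.ReflTransGen V.Adj (γ ⟨0, by simp⟩)
        (γ ⟨i, by simpa using hi⟩) := by
      intro i
      induction i with
      | zero => exact fun _ => .refl
      | succ i ih =>
        intro hi
        refine (ih (by omega)).tail (hγ.adj (sub_adj.2 (zOne_adj.2 ?_)))
        simp
    exact this n le_rfl
  · intro h
    induction h with
    | refl =>
      exact ⟨0, fun _ => x, bornologous_of_finite (Set.finite_Icc _ _)
        (fun _ _ _ => Adj.refl V x), rfl, rfl⟩
    | @tail b c _ hbc ih =>
      obtain ⟨n, γ, hγ, rfl, rfl⟩ := ih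
      refine ⟨n + 1, fun z => if h : (z : ℤ) ≤ n then γ ⟨z, z.2.1, h⟩ else c,
        bornologous_of_finite (Set.finite_Icc _ _) ?_, ?_, ?_⟩
      · rintro ⟨a, ha⟩ ⟨b, hb⟩ hab
        simp only [Set.mem_Icc, Nat.cast_add, Nat.cast_one] at ha hb hab ⊢
        rw [abs_le] at hab
        split_ifs with h1 h2 h2
        · exact hγ.adj (sub_adj.2 (zOne_adj.2 (abs_le.2 hab)))
        · obtain rfl : a = n := by omega
          exact hbc
        · obtain rfl : b = n := by omega
          exact hbc.symm
        · exact Adj.refl _ _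
      · simp
      · simp

theorem shortPath_iff {x m y : X} : V.ShortPath x m y ↔ V.Adj x m ∧ V.Adj m y := by
  constructor
  · rintro ⟨γ, hγ, rfl, rfl, rfl⟩
    exact ⟨hγ.adj (sub_adj.2 (zOne_adj.2 (by simp))), hγ.adj (sub_adj.2 (zOne_adj.2 (by simp)))⟩
  · rintro ⟨h1, h2⟩
    refine ⟨fun z => if (z : ℤ) = 0 then x else if (z : ℤ) = 1 then m else y,
      bornologous_of_finite (Set.finite_Icc _ _) ?_, by simp, by simp, by simp⟩
    rintro ⟨a, ha⟩ ⟨b, hb⟩ hab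
    simp only [Set.mem_Icc] at ha hb hab ⊢
    rw [abs_le] at hab
    have := Adj.refl V x
    have := Adj.refl V y
    have := Adj.refl V m
    have := h1.symm
    have := h2.symm
    split_ifs <;> first | assumption | omega

/-- A pair of integers at distance at most 1 is a forward step, a backward step or diagonal, so the
set of forward steps together with its inverse and the diagonal covers every image. -/
theorem bornologous_zOne_iff {f : ℤ → X} :
    Bornologous zOne V f ↔ Set.range (fun z => (f z, f (z + 1))) ∈ V.sets := by
  constructor
  · intro h
    refine V.mem_of_subset (h {p | p.2 = p.1 + 1} ?_) ?_
    · rintro ⟨a, b⟩ h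
      obtain rfl : b = a + 1 := h
      simp
    · rintro _ ⟨z, rfl⟩
      exact ⟨(z, z + 1), rfl, rfl⟩
  · intro h E hE
    refine V.mem_of_subset (V.union_mem (V.union_mem h (V.inv_mem h)) V.diagonal_mem) ?_
    rintro _ ⟨⟨a, b⟩, hp, rfl⟩
    have := hE _ hp
    rw [abs_le] at this
    obtain h | h | h : b = a + 1 ∨ a = b + 1 ∨ a = b := by dsimp only at this; omega
    · exact Or.inl (Or.inl ⟨a, by simp [h]⟩)
    · exact Or.inl (Or.inr ⟨b, by simp [h]⟩)
    · exact Or.inr (by simp [h])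

theorem _root_.Bornologous.adj_succ {f : ℤ → X} (hf : Bornologous zOne V f) (z : ℤ) :
    V.Adj (f z) (f (z + 1)) :=
  adj_of_mem (bornologous_zOne_iff.1 hf) ⟨z, rfl⟩

/-- Bornologousness only depends on the steps outside a finite interval. -/
theorem bornologous_of_steps {f : ℤ → X} (h : ∀ z, V.Adj (f z) (f (z + 1))) (n m : ℤ)
    {E : Set (X × X)} (hE : E ∈ V.sets) (h' : ∀ z, z < n ∨ m < z → (f z, f (z + 1)) ∈ E) :
    Bornologous zOne V f := by
  rw [bornologous_zOne_iff]
  have hfin : (fun z => (f z, f (z + 1))) '' Set.Icc n m ∈ V.sets := by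
    refine mem_sets_of_finite ((Set.finite_Icc n m).image _) ?_
    rintro _ ⟨z, -, rfl⟩
    exact h z
  refine V.mem_of_subset (V.union_mem hE hfin) ?_
  rintro _ ⟨z, rfl⟩
  by_cases hz : z < n ∨ m < z
  · exact Or.inl (h' z hz)
  · exact Or.inr ⟨z, by simpa using hz, rfl⟩

theorem mem_component {S : Set X} {C : Set X} (hC : C ∈ V.components S) {x y : X} (hx : x ∈ C)
    (hy : y ∈ S) (h : V.Adj x y) : y ∈ C := by
  obtain ⟨x₀, rfl⟩ := hC
  obtain ⟨x', hx', rfl⟩ := hx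
  exact ⟨⟨y, hy⟩, joined_iff.2 ((joined_iff.1 hx').tail (sub_adj.2 h)), rfl⟩

theorem exists_component {S : Set X} {x : X} (hx : x ∈ S) : ∃ C ∈ V.components S, x ∈ C :=
  ⟨_, ⟨⟨x, hx⟩, rfl⟩, ⟨x, hx⟩, joined_iff.2 .refl, rfl⟩

/-- A path which stays in `S` from the index `n` on stays in one component of `S`. -/
theorem exists_component_ray {S : Set X} {f : ℤ → X} (hf : ∀ z, V.Adj (f z) (f (z + 1))) {n : ℤ}
    (h : ∀ z ≥ n, f z ∈ S) : ∃ C ∈ V.components S, ∀ z ≥ n, f z ∈ C := by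
  obtain ⟨C, hC, hn⟩ := exists_component (V := V) (h n le_rfl)
  refine ⟨C, hC, fun z hz => ?_⟩
  induction z, hz using Int.leInduction with
  | base => exact hn
  | succ z hz ih => exact mem_component hC ih (h _ (by omega)) (hf z)

theorem exists_component_line {S : Set X} {f : ℤ → X} (hf : ∀ z, V.Adj (f z) (f (z + 1)))
    (h : ∀ z, f z ∈ S) : ∃ C ∈ V.components S, ∀ z, f z ∈ C := by
  obtain ⟨C, hC, hn⟩ := exists_component (V := V) (h 0)
  refine ⟨C, hC, fun z => ?_⟩
  induction z using Int.induction_on with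
  | zero => exact hn
  | succ z ih => exact mem_component hC ih (h _) (hf z)
  | pred z ih =>
    refine mem_component hC ih (h _) (Adj.symm ?_)
    have := hf (-z - 1)
    rwa [sub_add_cancel] at this

end SemiCoarse

/-! ### End objects of maps, and strings as composable lists. -/

namespace RelFundGrpd

open CMap

variable {X : Type u} {V : SemiCoarse X} {𝒰 : Set (Set X)}

/-- The symmetric map which runs along the right tail of `f`. -/
def tip (f : CMap V 𝒰) : CMap V 𝒰 where
  toFun z := f.toFun |z|
  born := f.born.comp (bornologous_zOne fun a b h => (abs_abs_sub_abs_le _ _).trans h)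
  tails := by
    obtain ⟨-, U, hU, n, hn⟩ := f.tails
    exact ⟨⟨U, hU, -n, fun z hz => hn _ (by have := neg_le_abs z; omega)⟩,
      U, hU, n, fun z hz => hn _ (by have := le_abs_self z; omega)⟩

theorem tip_symm (f : CMap V 𝒰) : (tip f).IsSymm := fun z => by simp [tip]

/-- The object at the right end of `f`. -/
def tgt (f : CMap V 𝒰) : RelFundGrpd V 𝒰 := cls (tip f) (tip_symm f)

/-- The object at the left end of `f`. -/
def src (f : CMap V 𝒰) : RelFundGrpd V 𝒰 := tgt f.opp

theorem src_opp (f : CMap V 𝒰) : src f.opp = tgt f := by rw [src, opp_opp]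

theorem tip_eq {f : CMap V 𝒰} (hf : f.IsSymm) : tip f = f := by
  ext z
  rcases abs_choice z with h | h
  · simp [tip, h]
  · simp [tip, h, hf z]

theorem tgt_of_symm {f : CMap V 𝒰} (hf : f.IsSymm) : tgt f = cls f hf := by
  simp only [tgt, tip_eq hf]

theorem src_of_symm {f : CMap V 𝒰} (hf : f.IsSymm) : src f = cls f hf := by
  rw [src, hf.opp_eq, tgt_of_symm hf]

theorem exists_tgt (a : RelFundGrpd V 𝒰) : ∃ f : CMap V 𝒰, tgt f = a := by
  induction a using Quot.ind with
  | mk p => exact ⟨p.1, tgt_of_symm p.2⟩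

theorem TailRel.of_eventually {f g : CMap V 𝒰} {N d : ℤ}
    (h : ∀ z ≥ N, f.toFun z = g.toFun (z + d)) : TailRel V 𝒰 f.toFun g.toFun := by
  refine ⟨N, N + d, ?_⟩
  have e : (fun z : Set.Ici (0 : ℤ) => f.toFun (z + N)) =
      fun z : Set.Ici (0 : ℤ) => g.toFun (z + (N + d)) := by
    funext ⟨z, hz⟩
    have hz : 0 ≤ z := hz
    rw [h _ (by dsimp only; omega)]
    simp [add_assoc]
  have e' : RayHomotopic V 𝒰 0 (fun z => f.toFun (z + N)) (fun z => f.toFun (z + N)) := by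
    refine HomotopicThrough.refl ((f.born.comp (bornologous_add N)).comp (bornologous_val zOne _)) ?_
    obtain ⟨-, U, hU, n, hn⟩ := f.tails
    exact ⟨U, hU, n - N, fun z hz => hn _ (by omega)⟩
  unfold RayHomotopic at e' ⊢
  rw [← e]
  exact e'

theorem cls_eq_of_eventually {f g : CMap V 𝒰} (hf : f.IsSymm) (hg : g.IsSymm) {N d : ℤ}
    (h : ∀ z ≥ N, f.toFun z = g.toFun (z + d)) : cls f hf = cls g hg := by
  -- `SymRel` asks for natural indices; `|N| + |d|` is at least `N` and stays nonnegative after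
  -- adding `d`.
  obtain ⟨n, hn⟩ := Int.eq_ofNat_of_zero_le (a := |N| + |d|) (by positivity)
  obtain ⟨m, hm⟩ := Int.eq_ofNat_of_zero_le (a := n + d) (by
    have := neg_abs_le d
    have := abs_nonneg N
    omega)
  refine Quot.sound (Or.inl ⟨n, m, fun k => ?_⟩)
  have := le_abs_self N
  have := abs_nonneg d
  change f.toFun _ = g.toFun _
  rw [h _ (by omega)]
  congr 1
  omega

/-- Converse of `tailRel_of_cls`. A shift of a symmetric map need not be symmetric, so it is
replaced by its `tip`, which is eventually equal to the original map up to a shift; a homotopy of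
rays becomes one of symmetric maps by precomposition with `|·|`. -/
theorem cls_eq_of_tailRel {f g : CMap V 𝒰} (hf : f.IsSymm) (hg : g.IsSymm)
    (h : TailRel V 𝒰 f.toFun g.toFun) : cls f hf = cls g hg := by
  obtain ⟨N, M, h⟩ := h
  let sh (f : CMap V 𝒰) (N : ℤ) : CMap V 𝒰 :=
    ⟨fun z => f.toFun (z + N), f.born.comp (bornologous_add N), by
      obtain ⟨⟨U, hU, n, hn⟩, U', hU', n', hn'⟩ := f.tails
      exact ⟨⟨U, hU, n - N, fun z hz => hn _ (by omega)⟩,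
        U', hU', n' - N, fun z hz => hn' _ (by omega)⟩⟩
  have key : ∀ (f : CMap V 𝒰) (hf : f.IsSymm) (N : ℤ),
      cls f hf = cls (tip (sh f N)) (tip_symm _) := by
    intro f hf N
    refine cls_eq_of_eventually hf _ (N := |N|) (d := -N) fun z hz => ?_
    have := le_abs_self N
    change _ = f.toFun (|z + -N| + N)
    rw [abs_of_nonneg (by omega)]
    congr 1
    omega
  rw [key f hf N, key g hg M]
  refine Quot.sound (Or.inr ?_)
  let φ : ℤ → Set.Ici (0 : ℤ) := fun z => ⟨|z|, abs_nonneg z⟩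
  have hφ : Bornologous zOne (zOne.sub (Set.Ici (0 : ℤ))) φ :=
    bornologous_sub (bornologous_zOne fun a b h => (abs_abs_sub_abs_le _ _).trans h)
  refine HomotopicThrough.precomp h (P' := TailsIn 𝒰) hφ ?_
  rintro u ⟨U, hU, n, hn⟩
  refine ⟨⟨U, hU, -n, fun z hz => hn _ ?_⟩, U, hU, n, fun z hz => hn _ ?_⟩
  · have := neg_le_abs z
    change n ≤ |z|
    omega
  · have := le_abs_self z
    change n ≤ |z|
    omega

theorem tailRel_tip (f : CMap V 𝒰) : TailRel V 𝒰 f.toFun (tip f).toFun :=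
  TailRel.of_eventually (N := 0) (d := 0) fun z hz => by simp [tip, abs_of_nonneg hz]

theorem tgt_eq_iff {f g : CMap V 𝒰} : tgt f = tgt g ↔ TailRel V 𝒰 f.toFun g.toFun := by
  constructor
  · intro h
    exact ((tailRel_tip f).trans (tailRel_of_cls h)).trans (tailRel_tip g).symm
  · intro h
    exact cls_eq_of_tailRel _ _ (((tailRel_tip f).symm.trans h).trans (tailRel_tip g))

theorem tgt_eq_of_eventually {f g : CMap V 𝒰} {N : ℤ} (d : ℤ)
    (h : ∀ z ≥ N, f.toFun z = g.toFun (z + d)) : tgt f = tgt g :=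
  tgt_eq_iff.2 (TailRel.of_eventually h)

theorem src_eq_of_eventually {f g : CMap V 𝒰} {N : ℤ} (d : ℤ)
    (h : ∀ z ≤ N, f.toFun z = g.toFun (z + d)) : src f = src g :=
  tgt_eq_of_eventually (N := -N) (-d) fun z hz => by
    change f.toFun _ = g.toFun _
    rw [h _ (by omega)]
    congr 1
    omega

/-- Turns linkage into an equality of objects, so that strings become paths in a graph whose edges
are the maps. -/
theorem link_iff_tgt_eq_src {f g : CMap V 𝒰} : Link f g ↔ tgt f = src g :=
  link_iff.trans tgt_eq_iff.symm

/-- The list `F` is composable and leads from `a` to `b`. -/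
def Conn (b : RelFundGrpd V 𝒰) : RelFundGrpd V 𝒰 → List (CMap V 𝒰) → Prop
  | a, [] => a = b
  | a, f :: F => src f = a ∧ Conn b (tgt f) F

theorem conn_append {a b : RelFundGrpd V 𝒰} {F G : List (CMap V 𝒰)} :
    Conn b a (F ++ G) ↔ ∃ c, Conn c a F ∧ Conn b c G := by
  induction F generalizing a with
  | nil => simp [Conn]
  | cons f F ih => simp [Conn, ih, and_assoc]

theorem isString_iff {a b : RelFundGrpd V 𝒰} {F : List (CMap V 𝒰)} :
    IsString a b F ↔ F ≠ [] ∧ Conn b a F := by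
  have key : ∀ (F : List (CMap V 𝒰)) (f g : CMap V 𝒰) (hg : g.IsSymm),
      List.IsChain Link (f :: (F ++ [g])) ↔ Conn (cls g hg) (tgt f) F := by
    intro F
    induction F with
    | nil => intro f g hg; simp [Conn, link_iff_tgt_eq_src, src_of_symm hg]
    | cons x F ih =>
      intro f g hg
      rw [List.cons_append, List.isChain_cons_cons, ih x g hg, link_iff_tgt_eq_src, Conn, eq_comm]
  constructor
  · rintro ⟨hF, f, g, hf, hg, rfl, rfl, h⟩
    rw [key F f g hg, tgt_of_symm hf] at h
    exact ⟨hF, h⟩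
  · rintro ⟨hF, h⟩
    induction a using Quot.ind with
    | mk p =>
      induction b using Quot.ind with
      | mk q =>
        refine ⟨hF, p.1, q.1, p.2, q.2, rfl, rfl, ?_⟩
        rw [key F p.1 q.1 q.2, tgt_of_symm p.2]
        exact h

theorem isString_single {a b : RelFundGrpd V 𝒰} {f : CMap V 𝒰} :
    IsString a b [f] ↔ src f = a ∧ tgt f = b := by
  simp [isString_iff, Conn]

/-- The morphism given by a single map. -/
def edge {a b : RelFundGrpd V 𝒰} (f : CMap V 𝒰) (ha : src f = a) (hb : tgt f = b) : a ⟶ b :=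
  mor [f] (isString_single.2 ⟨ha, hb⟩)

/-- A property of morphisms which holds for single maps and is stable under composition holds for
all morphisms. -/
theorem hom_induction {P : ∀ {a b : RelFundGrpd V 𝒰}, (a ⟶ b) → Prop}
    (h1 : ∀ (f : CMap V 𝒰), P (edge f rfl rfl))
    (h2 : ∀ {a b c : RelFundGrpd V 𝒰} (φ : a ⟶ b) (ψ : b ⟶ c), P φ → P ψ → P (φ ≫ ψ))
    {a b : RelFundGrpd V 𝒰} (φ : a ⟶ b) : P φ := by
  induction φ using Quot.ind with
  | mk p =>
    obtain ⟨F, hF⟩ := p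
    induction F generalizing a with
    | nil => exact absurd rfl hF.1
    | cons f F ih =>
      obtain ⟨-, rfl, hc⟩ := isString_iff.1 hF
      rcases eq_or_ne F [] with rfl | hne
      · obtain rfl : tgt f = b := hc
        exact h1 f
      · have hF' : IsString (tgt f) b F := isString_iff.2 ⟨hne, hc⟩
        exact h2 (edge f rfl rfl) (mor F hF') (h1 f) (ih hF')

end RelFundGrpd

/-! ### Labellings and the functors they define. -/

namespace RelFundGrpd

open CMap

variable {X : Type u} {V : SemiCoarse X} {𝒰 : Set (Set X)}

/-- Homotopy of the restrictions to `[j, ∞)`, all of whose stages take values in `S`. -/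
def RayHomotopicOn (V : SemiCoarse X) (𝒰 : Set (Set X)) (S : Set X) (j : ℤ) (f g : ℤ → X) : Prop :=
  HomotopicThrough (fun h => RayIn 𝒰 h ∧ ∀ z, h z ∈ S) (zOne.sub (Set.Ici j)) V
    (fun z => f z) (fun z => g z)

/-- The condition `TailCond`, with homotopies inside `S`. -/
def TailCondOn (V : SemiCoarse X) (𝒰 : Set (Set X)) (S : Set X) (g : ℤ → X) (j : ℤ) : Prop :=
  PeriodicFrom g (j - 1) → (∃ k : ℤ, 1 < k ∧ ¬ PeriodicFrom g (j - k)) →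
    ∃ c : X, RayHomotopicOn V 𝒰 S j g (fun _ => c)

/-- Admissibility, with homotopies inside `S`. -/
def AdmOn (V : SemiCoarse X) (𝒰 : Set (Set X)) (S : Set X) (g : ℤ → X) (j : ℤ) : Prop :=
  TailCondOn V 𝒰 S g j ∧ TailCondOn V 𝒰 S (fun z => g (-z)) (-j)

theorem tailCondOn_univ {g : ℤ → X} {j : ℤ} :
    TailCondOn V 𝒰 Set.univ g j ↔ TailCond V 𝒰 g j := by
  simp [TailCondOn, TailCond, RayHomotopicOn, RayHomotopic]

theorem admOn_univ {g : ℤ → X} {j : ℤ} : AdmOn V 𝒰 Set.univ g j ↔ Admissible V 𝒰 g j := by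
  simp [AdmOn, Admissible, tailCondOn_univ]

/-- `f` takes values in `S`. -/
def InSet (S : Set X) (f : CMap V 𝒰) : Prop := ∀ z, f.toFun z ∈ S

variable {G : Type*} [Groupoid G]

/-- An assignment of morphisms of a groupoid `G` to the maps with values in `S`, which satisfies the
relations between the morphisms of the relative fundamental groupoid. -/
structure Labelling (V : SemiCoarse X) (𝒰 : Set (Set X)) (S : Set X) {G : Type*} [Groupoid G]
    (ob : RelFundGrpd V 𝒰 → G) where
  /-- the morphism assigned to a map -/
  E : ∀ {a b : RelFundGrpd V 𝒰} (f : CMap V 𝒰), InSet S f → src f = a → tgt f = b → (ob a ⟶ ob b)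
  opp : ∀ {a b : RelFundGrpd V 𝒰} (f g : CMap V 𝒰) (hf : InSet S f) (hg : InSet S g)
    (ha : src f = a) (hb : tgt f = b) (hb' : src g = b) (ha' : tgt g = a) (N : ℤ),
    (∀ z, f.toFun z = g.toFun (-(z + N))) → E f hf ha hb ≫ E g hg hb' ha' = 𝟙 _
  merge : ∀ {a b c : RelFundGrpd V 𝒰} (f g h : CMap V 𝒰) (hf : InSet S f) (hg : InSet S g)
    (hh : InSet S h) (ha : src f = a) (hb : tgt f = b) (hb' : src g = b) (hc : tgt g = c)
    (ha' : src h = a) (hc' : tgt h = c) (x₀ : X) (N M j : ℤ),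
    (∀ z ≥ N, f.toFun z = x₀) → (∀ z ≤ M, g.toFun z = x₀) → N ≤ j → j ≤ M →
    (∀ z, h.toFun z = if z ≤ j then f.toFun z else g.toFun z) → AdmOn V 𝒰 S h.toFun j →
    E h hh ha' hc' = E f hf ha hb ≫ E g hg hb' hc
  del : ∀ {a b : RelFundGrpd V 𝒰} (f g : CMap V 𝒰) (hf : InSet S f) (hg : InSet S g)
    (ha : src f = a) (hb : tgt f = b) (ha' : src g = a) (hb' : tgt g = b) (z₀ : ℤ),
    (∀ z, g.toFun z = if z < z₀ then f.toFun z else f.toFun (z + 1)) →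
    AdmOn V 𝒰 S g.toFun z₀ → E f hf ha hb = E g hg ha' hb'

theorem src_eq_of_del {f g : CMap V 𝒰} {z₀ : ℤ}
    (h : ∀ z, g.toFun z = if z < z₀ then f.toFun z else f.toFun (z + 1)) : src f = src g :=
  src_eq_of_eventually (N := z₀ - 1) 0 fun z hz => by
    rw [h, add_zero, if_pos (by omega)]

theorem tgt_eq_of_del {f g : CMap V 𝒰} {z₀ : ℤ}
    (h : ∀ z, g.toFun z = if z < z₀ then f.toFun z else f.toFun (z + 1)) : tgt f = tgt g :=
  (tgt_eq_of_eventually (N := z₀) 1 fun z hz => by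
    rw [h, if_neg (by omega)]).symm

theorem src_eq_of_merge {f g h : CMap V 𝒰} {j : ℤ}
    (e : ∀ z, h.toFun z = if z ≤ j then f.toFun z else g.toFun z) : src h = src f :=
  src_eq_of_eventually (N := j) 0 fun z hz => by rw [e, add_zero, if_pos hz]

theorem tgt_eq_of_merge {f g h : CMap V 𝒰} {j : ℤ}
    (e : ∀ z, h.toFun z = if z ≤ j then f.toFun z else g.toFun z) : tgt h = tgt g :=
  tgt_eq_of_eventually (N := j + 1) 0 fun z hz => by rw [e, add_zero, if_neg (by omega)]

/-- The tautological labelling, by the morphisms of the relative fundamental groupoid. -/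
def edgeLabelling (V : SemiCoarse X) (𝒰 : Set (Set X)) :
    Labelling V 𝒰 Set.univ (fun a : RelFundGrpd V 𝒰 => a) where
  E f _ ha hb := edge f ha hb
  opp := by
    intro a b f g _ _ ha hb hb' ha' N h
    have hc : edge f ha hb ≫ edge g hb' ha' =
        mor [f, g] ((isString_single.2 ⟨ha, hb⟩).append (isString_single.2 ⟨hb', ha'⟩)) := rfl
    rw [hc, ← Category.comp_id (mor _ _)]
    exact Quot.sound (Or.inl ⟨[], _, f, g, N, rfl, rfl, by simp, h⟩)
  merge := by
    intro a b c f g h _ _ _ ha hb hb' hc ha' hc' x₀ N M j h1 h2 h3 h4 h5 h6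
    have hs : Step [f, g] [h] := Or.inr (Or.inl
      ⟨[], [], f, g, h, x₀, N, M, j, rfl, rfl, h1, h2, h3, h4, h5, admOn_univ.1 h6⟩)
    exact (hmk_sound hs (hF := (isString_single.2 ⟨ha, hb⟩).append
      (isString_single.2 ⟨hb', hc⟩))).symm
  del := by
    intro a b f g _ _ ha hb ha' hb' z₀ h h'
    exact Quot.sound (Or.inr (Or.inr (.cons (.rel _ _ ⟨z₀, h, admOn_univ.1 h'⟩) .nil)))

namespace Labelling

variable {ob : RelFundGrpd V 𝒰 → G} {S : Set X} (L : Labelling V 𝒰 S ob)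

theorem congr {a b : RelFundGrpd V 𝒰} {f g : CMap V 𝒰} (h : f = g) (hf : InSet S f)
    (hg : InSet S g) (ha : src f = a) (hb : tgt f = b) (ha' : src g = a) (hb' : tgt g = b) :
    L.E f hf ha hb = L.E g hg ha' hb' := by
  subst h
  rfl

end Labelling

section lift

variable {ob : RelFundGrpd V 𝒰 → G} (L : Labelling V 𝒰 Set.univ ob)

/-- The value of a labelling on a string. -/
def Labelling.eval (b : RelFundGrpd V 𝒰) :
    (a : RelFundGrpd V 𝒰) → (F : List (CMap V 𝒰)) → Conn b a F → (ob a ⟶ ob b)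
  | _, [], h => eqToHom (congrArg ob h)
  | _, f :: F, h => L.E f (fun _ => trivial) h.1 rfl ≫ Labelling.eval b (tgt f) F h.2

theorem Labelling.eval_append {a b c : RelFundGrpd V 𝒰} {F F' : List (CMap V 𝒰)}
    (h1 : Conn c a F) (h2 : Conn b c F') (h : Conn b a (F ++ F')) :
    L.eval b a (F ++ F') h = L.eval c a F h1 ≫ L.eval b c F' h2 := by
  induction F generalizing a with
  | nil =>
    obtain rfl : a = c := h1
    simp [eval]
  | cons f F ih =>
    simp only [List.cons_append, eval, Category.assoc]
    rw [ih h1.2]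

theorem Labelling.eval_step {a b : RelFundGrpd V 𝒰} {F F' : List (CMap V 𝒰)} (hs : Step F F')
    (h : Conn b a F) (h' : Conn b a F') : L.eval b a F h = L.eval b a F' h' := by
  rcases hs with hs | hs | hs
  · obtain ⟨A, B, f, g, N, rfl, rfl, -, e⟩ := hs
    obtain ⟨c, h1, rfl, h2, h3⟩ := conn_append.1 h
    have e' : tgt g = src f := tgt_eq_of_eventually (g := f.opp) (N := 0) N fun z _ => by
      change _ = f.toFun _
      rw [e]
      change _ = g.toFun _
      congr 1
      ring
    rw [L.eval_append h1 (F' := f :: g :: B) ⟨rfl, h2, h3⟩,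
      L.eval_append h1 (F' := B) (e' ▸ h3)]
    congr 1
    simp only [eval]
    have := L.opp f g (fun _ => trivial) (fun _ => trivial) rfl rfl h2 e' N e
    rw [← Category.assoc]
    -- `eval` continues from `tgt g`, which equals `src f` only propositionally; with the middle
    -- object a variable the equality can be substituted.
    have key : ∀ (d : RelFundGrpd V 𝒰) (hd : tgt g = d) (h3 : Conn b (tgt g) B)
        (h3' : Conn b d B), L.E g (fun _ => trivial) h2 rfl ≫ L.eval b (tgt g) B h3 =
          L.E g (fun _ => trivial) h2 hd ≫ L.eval b d B h3' := by
      rintro d rfl _ _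
      rfl
    rw [Category.assoc, key (src f) e' h3 (e' ▸ h3), ← Category.assoc, this, Category.id_comp]
  · obtain ⟨A, B, f, g, k, x, N, M, j, rfl, rfl, e1, e2, e3, e4, e5, e6⟩ := hs
    obtain ⟨c, h1, rfl, h2, h3⟩ := conn_append.1 h
    have es := src_eq_of_merge e5
    have et := tgt_eq_of_merge e5
    rw [L.eval_append h1 (F' := f :: g :: B) ⟨rfl, h2, h3⟩,
      L.eval_append h1 (F' := k :: B) ⟨es, et ▸ h3⟩]
    congr 1
    simp only [eval]
    have := L.merge f g k (fun _ => trivial) (fun _ => trivial) (fun _ => trivial) rfl rfl h2 rfl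
      es et x N M j e1 e2 e3 e4 e5 (admOn_univ.2 e6)
    rw [← Category.assoc, ← this]
    have key : ∀ (d : RelFundGrpd V 𝒰) (hd : tgt k = d) (h3 : Conn b (tgt k) B)
        (h3' : Conn b d B), L.E k (fun _ => trivial) es rfl ≫ L.eval b (tgt k) B h3 =
          L.E k (fun _ => trivial) es hd ≫ L.eval b d B h3' := by
      rintro d rfl _ _
      rfl
    exact (key _ et _ _).symm
  · have key : ∀ f g : CMap V 𝒰, Relation.EqvGen Del f g → src f = src g ∧ tgt f = tgt g ∧
        ∀ (a b : RelFundGrpd V 𝒰) (ha : src f = a) (hb : tgt f = b) (ha' : src g = a)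
          (hb' : tgt g = b), L.E f (fun _ => trivial) ha hb = L.E g (fun _ => trivial) ha' hb' := by
      intro f g hfg
      induction hfg with
      | rel f g h =>
        obtain ⟨z₀, h, hadm⟩ := h
        exact ⟨src_eq_of_del h, tgt_eq_of_del h, fun a b ha hb ha' hb' =>
          L.del f g _ _ _ _ _ _ z₀ h (admOn_univ.2 hadm)⟩
      | refl f => exact ⟨rfl, rfl, fun _ _ _ _ _ _ => rfl⟩
      | symm f g _ ih =>
        exact ⟨ih.1.symm, ih.2.1.symm, fun a b ha hb ha' hb' => (ih.2.2 a b _ _ _ _).symm⟩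
      | trans f g k _ _ ih ih' =>
        exact ⟨ih.1.trans ih'.1, ih.2.1.trans ih'.2.1, fun a b ha hb ha' hb' =>
          (ih.2.2 a b ha hb (ih.1.symm.trans ha) (ih.2.1.symm.trans hb)).trans
            (ih'.2.2 a b _ _ _ _)⟩
    induction hs generalizing a with
    | nil => rfl
    | @cons f g F F' hfg _ ih =>
      obtain ⟨es, et, e⟩ := key f g hfg
      simp only [eval]
      have key' : ∀ (d : RelFundGrpd V 𝒰) (hd : tgt f = d) (h3 : Conn b (tgt f) F)
          (h3' : Conn b d F), L.E f (fun _ => trivial) h.1 rfl ≫ L.eval b (tgt f) F h3 =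
          L.E f (fun _ => trivial) h.1 hd ≫ L.eval b d F h3' := by
        rintro d rfl _ _
        rfl
      rw [key' _ et h.2 (et ▸ h.2), ih (et ▸ h.2) h'.2, e _ _ h.1 et h'.1 rfl]

/-- The functor defined by a labelling of all maps. -/
def Labelling.functor : RelFundGrpd V 𝒰 ⥤ G where
  obj := ob
  map {a b} := Quot.lift (fun F => L.eval b a F.1 (isString_iff.1 F.2).2)
    (fun _ _ h => L.eval_step h _ _)
  map_id a := by
    rw [id_eq_pair a a.out.2 (Quot.out_eq a)]
    have hs : src a.out.1 = a := (src_of_symm a.out.2).trans (Quot.out_eq a)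
    have ht : tgt a.out.1 = a := (tgt_of_symm a.out.2).trans (Quot.out_eq a)
    have hF : Conn a a [a.out.1] := ⟨hs, ht⟩
    refine (L.eval_append hF hF _).trans ?_
    have : L.eval a a [a.out.1] hF = L.E a.out.1 (fun _ => trivial) hs ht := by
      have : ∀ (d : RelFundGrpd V 𝒰) (hd : tgt a.out.1 = d) (h : Conn d a [a.out.1]),
          L.eval d a [a.out.1] h = L.E a.out.1 (fun _ => trivial) hs hd := by
        rintro d rfl h
        simp [eval]
      exact this _ _ _
    rw [this]
    -- A symmetric map is its own opposite, so its label is an involution.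
    exact L.opp _ _ _ _ _ _ _ _ 0 fun z => by rw [add_zero, a.out.2 z]
  map_comp := by
    rintro a b c ⟨F⟩ ⟨G⟩
    exact L.eval_append _ _ _

theorem Labelling.functor_edge {a b : RelFundGrpd V 𝒰} (f : CMap V 𝒰) (ha : src f = a)
    (hb : tgt f = b) : L.functor.map (edge f ha hb) = L.E f (fun _ => trivial) ha hb := by
  subst ha hb
  change L.E f _ _ _ ≫ eqToHom rfl = _
  simp

end lift

end RelFundGrpd

/-! ### Periodic tails. -/

section periodic

variable {X : Type*} {g : ℤ → X} {a b : ℤ}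

theorem PeriodicFrom.mono (h : PeriodicFrom g a) (hab : a ≤ b) : PeriodicFrom g b :=
  let ⟨p, hp, h⟩ := h
  ⟨p, hp, fun z hz => h z (hab.trans hz)⟩

theorem periodic_mul {p : ℤ} (hp : 0 < p) (h : ∀ z ≥ a, g (z + p) = g z) (n : ℕ) {z : ℤ}
    (hz : a ≤ z) : g (z + n * p) = g z := by
  induction n with
  | zero => simp
  | succ n ih =>
    have hn : 0 ≤ n * p := by positivity
    rw [← ih, ← h (z + n * p) (by omega)]
    congr 1
    push_cast
    ring

theorem exists_add_mul_le {p : ℤ} (hp : 0 < p) (z w : ℤ) : ∃ n : ℕ, w ≤ z + n * p := by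
  refine ⟨(w - z).toNat, ?_⟩
  have h1 := Int.self_le_toNat (w - z)
  nlinarith

theorem eq_const_of_periodic {c : X} {N : ℤ} (hc : ∀ z ≥ N, g z = c) (h : PeriodicFrom g a) {z : ℤ}
    (hz : a ≤ z) : g z = c := by
  obtain ⟨p, hp, h⟩ := h
  obtain ⟨n, hn⟩ := exists_add_mul_le hp z N
  rw [← periodic_mul hp h n hz, hc _ hn]

end periodic

/-! ### Labels of finite paths, tethers and steps. -/

namespace RelFundGrpd

open CMap

variable {X : Type u} {V : SemiCoarse X} {𝒰 : Set (Set X)} {S : Set X}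

theorem mem_of_const_right (f : CMap V 𝒰) {c : X} {N : ℤ} (h : ∀ z ≥ N, f.toFun z = c) :
    c ∈ ⋃₀ 𝒰 := by
  obtain ⟨-, U, hU, n, hn⟩ := f.tails
  rw [← h _ (le_max_left N n)]
  exact ⟨U, hU, hn _ (le_max_right N n)⟩

/-- A periodic tail that is eventually constant is constant, so it is null homotopic by the constant
homotopy. Maps with constant ends are therefore admissible everywhere, and finite paths can be
merged and shortened freely. -/
theorem tailCondOn_of_const {g : ℤ → X} {c : X} {N : ℤ} (hU : c ∈ ⋃₀ 𝒰) (hc : c ∈ S)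
    (h : ∀ z ≥ N, g z = c) (j : ℤ) : TailCondOn V 𝒰 S g j := by
  intro hp _
  refine ⟨c, ?_⟩
  have e : (fun z : Set.Ici j => g z) = fun _ => c := by
    funext z
    have : j ≤ z := z.2
    exact eq_const_of_periodic h hp (by omega)
  unfold RayHomotopicOn
  rw [e]
  obtain ⟨U, hU, hcU⟩ := hU
  refine HomotopicThrough.refl ?_ ⟨⟨U, hU, 0, fun _ _ => hcU⟩, fun _ => hc⟩
  intro E _
  refine V.mem_of_subset V.diagonal_mem ?_
  rintro _ ⟨p, -, rfl⟩
  rfl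

theorem tailCondOn_of_const_right {f : CMap V 𝒰} (hf : InSet S f) {c : X} {N : ℤ}
    (h : ∀ z ≥ N, f.toFun z = c) (j : ℤ) : TailCondOn V 𝒰 S f.toFun j :=
  tailCondOn_of_const (mem_of_const_right f h) (h N le_rfl ▸ hf N) h j

theorem tailCondOn_of_const_left {f : CMap V 𝒰} (hf : InSet S f) {c : X} {N : ℤ}
    (h : ∀ z ≤ N, f.toFun z = c) (j : ℤ) : TailCondOn V 𝒰 S (fun z => f.toFun (-z)) j :=
  tailCondOn_of_const_right (f := f.opp) (fun z => hf (-z)) (N := -N)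
    (fun z hz => h (-z) (by omega)) j

/-- The constant map. -/
def constMap (V : SemiCoarse X) {x : X} (hx : x ∈ ⋃₀ 𝒰) : CMap V 𝒰 where
  toFun _ := x
  born := by
    rw [bornologous_zOne_iff]
    refine V.mem_of_subset V.diagonal_mem ?_
    rintro _ ⟨z, rfl⟩
    rfl
  tails := by
    obtain ⟨U, hU, hx⟩ := hx
    exact ⟨⟨U, hU, 0, fun _ _ => hx⟩, U, hU, 0, fun _ _ => hx⟩

/-- The object given by a point of a member of `𝒰`. -/
def pt (V : SemiCoarse X) {x : X} (hx : x ∈ ⋃₀ 𝒰) : RelFundGrpd V 𝒰 := tgt (constMap V hx)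

theorem tgt_eq_pt {f : CMap V 𝒰} {x : X} (hx : x ∈ ⋃₀ 𝒰) {N : ℤ} (h : ∀ z ≥ N, f.toFun z = x) :
    tgt f = pt V hx :=
  tgt_eq_of_eventually (N := N) 0 h

theorem src_eq_pt {f : CMap V 𝒰} {x : X} (hx : x ∈ ⋃₀ 𝒰) {N : ℤ} (h : ∀ z ≤ N, f.toFun z = x) :
    src f = pt V hx :=
  tgt_eq_pt (f := f.opp) (N := -N) hx fun z hz => h _ (by omega)

/-- A list of successively adjacent points of `S` leading from `x` to `y`. -/
structure Walk (V : SemiCoarse X) (S : Set X) (x y : X) (l : List X) : Prop where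
  head : l.head? = some x
  last : l.getLast? = some y
  chain : l.IsChain V.Adj
  mem : ∀ z ∈ l, z ∈ S

namespace Walk

variable {x y x' y' : X} {l l' : List X}

theorem ne_nil (h : Walk V S x y l) : l ≠ [] := by
  rintro rfl
  simpa using h.head

theorem append (h : Walk V S x y l) (h' : Walk V S x' y' l') (hadj : V.Adj y x') :
    Walk V S x y' (l ++ l') where
  head := by simp [h.head]
  last := by simp [h'.last]
  chain := by
    rw [List.isChain_append]
    refine ⟨h.chain, h'.chain, ?_⟩
    simp only [h.last, h'.head, Option.mem_some_iff]
    rintro _ rfl _ rfl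
    exact hadj
  mem z hz := (List.mem_append.1 hz).elim (h.mem z) (h'.mem z)

theorem reverse (h : Walk V S x y l) : Walk V S y x l.reverse where
  head := by simp [h.last]
  last := by simp [h.head]
  chain := by
    rw [List.isChain_reverse]
    exact h.chain.imp fun _ _ h => h.symm
  mem z hz := h.mem z (List.mem_reverse.1 hz)

theorem single (hx : x ∈ S) : Walk V S x x [x] where
  head := rfl
  last := rfl
  chain := by simp
  mem z hz := by rwa [List.mem_singleton.1 hz]

end Walk

/-- The map `ℤ → X` which runs through a list. -/
def pathFun (l : List X) (hl : l ≠ []) (z : ℤ) : X :=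
  l[min z.toNat (l.length - 1)]'(by have := List.length_pos_iff.2 hl; omega)

theorem pathFun_eq {l : List X} (hl : l ≠ []) {z : ℤ} {i : ℕ} (hi : i < l.length)
    (h : i = min z.toNat (l.length - 1)) : pathFun l hl z = l[i] := by
  subst h
  rfl

theorem pathFun_of_nonpos {x y : X} {l : List X} (h : Walk V S x y l) {z : ℤ} (hz : z ≤ 0) :
    pathFun l h.ne_nil z = x := by
  have h0 := List.length_pos_iff.2 h.ne_nil
  rw [pathFun_eq h.ne_nil h0 (by omega)]
  have := h.head
  rw [List.head?_eq_getElem?, List.getElem?_eq_some_iff] at this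
  exact this.2

theorem pathFun_of_le {x y : X} {l : List X} (h : Walk V S x y l) {z : ℤ}
    (hz : (l.length : ℤ) - 1 ≤ z) : pathFun l h.ne_nil z = y := by
  have h0 := List.length_pos_iff.2 h.ne_nil
  rw [pathFun_eq h.ne_nil (i := l.length - 1) (by omega) (by omega)]
  have := h.last
  rw [List.getLast?_eq_getElem?, List.getElem?_eq_some_iff] at this
  exact this.2

theorem pathFun_mem {l : List X} (hl : l ≠ []) (z : ℤ) : pathFun l hl z ∈ l :=
  List.getElem_mem _

theorem pathFun_append {x y x' y' : X} {l l' : List X} (h : Walk V S x y l) (h' : Walk V S x' y' l')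
    (hl : l ++ l' ≠ []) (z : ℤ) : pathFun (l ++ l') hl z =
      if z < l.length then pathFun l h.ne_nil z else pathFun l' h'.ne_nil (z - l.length) := by
  have h0 := List.length_pos_iff.2 h.ne_nil
  have h0' := List.length_pos_iff.2 h'.ne_nil
  unfold pathFun
  rw [List.getElem_append]
  simp only [List.length_append]
  split_ifs with h1 h2 h2
  · congr 1
    omega
  · omega
  · omega
  · congr 1
    omega

theorem pathFun_cons {w x y : X} {l : List X} (h : Walk V S x y l) (hl : w :: l ≠ []) {z : ℤ}
    (hz : 1 ≤ z) : pathFun (w :: l) hl z = pathFun l h.ne_nil (z - 1) := by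
  have h0 := List.length_pos_iff.2 h.ne_nil
  rw [pathFun_eq (l := w :: l) hl (i := min (z - 1).toNat (l.length - 1) + 1) (by simp; omega)
    (by simp; omega)]
  rfl

/-- The map `ℤ₁ → X` which runs through a list of successively adjacent points. -/
def pathMap {x y : X} {l : List X} (h : Walk V S x y l) (hx : x ∈ ⋃₀ 𝒰) (hy : y ∈ ⋃₀ 𝒰) :
    CMap V 𝒰 where
  toFun := pathFun l h.ne_nil
  born := by
    have h0 := List.length_pos_iff.2 h.ne_nil
    refine bornologous_of_steps (fun z => ?_) 0 (l.length - 2) V.diagonal_mem ?_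
    · by_cases hz : 0 ≤ z ∧ z + 1 < l.length
      · rw [pathFun_eq h.ne_nil (i := z.toNat) (by omega) (by omega),
          pathFun_eq h.ne_nil (i := z.toNat + 1) (by omega) (by omega)]
        exact h.chain.getElem _ _
      · rcases lt_or_ge z 0 with h1 | h1
        · rw [pathFun_of_nonpos h h1.le, pathFun_of_nonpos h (by omega)]
          exact Adj.refl _ _
        · rw [pathFun_of_le h (by omega), pathFun_of_le h (by omega)]
          exact Adj.refl _ _
    · rintro z (hz | hz)
      · rw [pathFun_of_nonpos h hz.le, pathFun_of_nonpos h (by omega)]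
        rfl
      · rw [pathFun_of_le h (by omega), pathFun_of_le h (by omega)]
        rfl
  tails := by
    obtain ⟨U, hU, hx⟩ := hx
    obtain ⟨U', hU', hy⟩ := hy
    refine ⟨⟨U, hU, 0, fun z hz => ?_⟩, U', hU', l.length - 1, fun z hz => ?_⟩
    · rwa [pathFun_of_nonpos h hz]
    · rwa [pathFun_of_le h hz]

section pathMap

variable {x y : X} {l : List X} (h : Walk V S x y l) (hx : x ∈ ⋃₀ 𝒰) (hy : y ∈ ⋃₀ 𝒰)

theorem inSet_pathMap : InSet S (pathMap h hx hy) := fun z => h.mem _ (pathFun_mem h.ne_nil z)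

theorem src_pathMap : src (pathMap h hx hy) = pt V hx :=
  src_eq_pt hx (N := 0) fun _ hz => pathFun_of_nonpos h hz

theorem tgt_pathMap : tgt (pathMap h hx hy) = pt V hy :=
  tgt_eq_pt hy (N := l.length - 1) fun _ hz => pathFun_of_le h hz

theorem admOn_of_const {f : CMap V 𝒰} (hf : InSet S f) {c d : X} {N M : ℤ}
    (h : ∀ z ≥ N, f.toFun z = c) (h' : ∀ z ≤ M, f.toFun z = d) (j : ℤ) :
    AdmOn V 𝒰 S f.toFun j :=
  ⟨tailCondOn_of_const_right hf h j, tailCondOn_of_const_left hf h' _⟩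

theorem admOn_pathMap (j : ℤ) : AdmOn V 𝒰 S (pathMap h hx hy).toFun j :=
  admOn_of_const (inSet_pathMap h hx hy) (fun _ hz => pathFun_of_le h hz)
    (fun _ hz => pathFun_of_nonpos h hz) j

end pathMap

namespace Labelling

variable {G : Type*} [Groupoid G] {ob : RelFundGrpd V 𝒰 → G} (L : Labelling V 𝒰 S ob)

/-- The relation `opp` allows any offset, so both labels are inverse to the label of `g.opp`. -/
theorem shift {a b : RelFundGrpd V 𝒰} {f g : CMap V 𝒰} (d : ℤ)
    (h : ∀ z, f.toFun z = g.toFun (z + d)) (hf : InSet S f) (hg : InSet S g) (ha : src f = a)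
    (hb : tgt f = b) (ha' : src g = a) (hb' : tgt g = b) : L.E f hf ha hb = L.E g hg ha' hb' := by
  have hg' : InSet S g.opp := fun z => hg (-z)
  have h1 := L.opp f g.opp hf hg' ha hb ((src_opp g).trans hb') ha' d fun z => by
    rw [h]
    change _ = g.toFun _
    rw [neg_neg]
  have h2 := L.opp g g.opp hg hg' ha' hb' ((src_opp g).trans hb') ha' 0 fun z => by
    change _ = g.toFun _
    rw [neg_neg, add_zero]
  rw [← h2] at h1
  exact (cancel_mono _).1 h1

/-- A constant map merged with itself is itself, and an idempotent of a groupoid is an identity. -/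
theorem const {a : RelFundGrpd V 𝒰} {f : CMap V 𝒰} {x : X} (h : ∀ z, f.toFun z = x)
    (hf : InSet S f) (ha : src f = a) (hb : tgt f = a) : L.E f hf ha hb = 𝟙 _ := by
  have := L.merge f f f hf hf hf ha hb ha hb ha hb x 0 0 0 (fun z _ => h z) (fun z _ => h z)
    le_rfl le_rfl (fun z => by simp) (admOn_of_const hf (N := 0) (M := 0) (fun z _ => h z)
      (fun z _ => h z) 0)
  rw [← cancel_epi (L.E f hf ha hb), ← this, Category.comp_id]

/-- The morphism assigned to a list of successively adjacent points. -/
def path {x y : X} {l : List X} (h : Walk V S x y l) (hx : x ∈ ⋃₀ 𝒰) (hy : y ∈ ⋃₀ 𝒰) :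
    ob (pt V hx) ⟶ ob (pt V hy) :=
  L.E (pathMap h hx hy) (inSet_pathMap h hx hy) (src_pathMap h hx hy) (tgt_pathMap h hx hy)

variable {x y z : X} {l l' : List X} (hx : x ∈ ⋃₀ 𝒰) (hy : y ∈ ⋃₀ 𝒰) (hz : z ∈ ⋃₀ 𝒰)

theorem path_congr (e : l = l') (h : Walk V S x y l) (h' : Walk V S x y l') :
    L.path h hx hy = L.path h' hx hy := by
  subst e
  rfl

theorem path_append (h : Walk V S x y l) (h' : Walk V S y z l') (h'' : Walk V S x z (l ++ l')) :
    L.path h'' hx hz = L.path h hx hy ≫ L.path h' hy hz := by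
  have h0 := List.length_pos_iff.2 h.ne_nil
  -- The second path is delayed by the length of the first, so that around `l.length - 1` the end of
  -- one and the start of the other are both constant at `y`.
  let g : CMap V 𝒰 := ⟨fun z => (pathMap h' hy hz).toFun (z - l.length),
    (pathMap h' hy hz).born.comp (bornologous_add _), by
      obtain ⟨⟨U, hU, n, hn⟩, U', hU', n', hn'⟩ := (pathMap h' hy hz).tails
      exact ⟨⟨U, hU, n + l.length, fun z hz => hn _ (by omega)⟩,
        U', hU', n' + l.length, fun z hz => hn' _ (by omega)⟩⟩
  have hg : InSet S g := fun z => inSet_pathMap h' hy hz _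
  have es : src g = pt V hy :=
    src_eq_pt hy (N := l.length) fun z hz => pathFun_of_nonpos h' (by omega)
  have et : tgt g = pt V hz :=
    tgt_eq_pt hz (N := l.length + l'.length - 1) fun z hz => pathFun_of_le h' (by omega)
  have hs : L.E g hg es et = L.path h' hy hz :=
    L.shift (-l.length) (fun _ => rfl) _ _ _ _ _ _
  rw [← hs]
  refine L.merge _ g _ _ _ _ _ _ _ _ _ _ y (l.length - 1) l.length (l.length - 1)
    (fun z hz => pathFun_of_le h hz) (fun z hz => pathFun_of_nonpos h' (by omega)) le_rfl
    (by omega) (fun z => ?_) (admOn_pathMap _ _ _ _)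
  change pathFun (l ++ l') h''.ne_nil z =
    if z ≤ (l.length : ℤ) - 1 then pathFun l h.ne_nil z else pathFun l' h'.ne_nil (z - l.length)
  rw [pathFun_append h h']
  congr 1
  simp only [eq_iff_iff]
  omega

/-- Both ends of the shortened path are constant, so admissibility is automatic: an interior point
can be dropped as soon as its neighbours are adjacent. -/
theorem path_erase {w : X} (h : Walk V S x y (l ++ w :: l')) (h' : Walk V S x y (l ++ l'))
    (hl : l ≠ []) (hl' : l' ≠ []) : L.path h hx hy = L.path h' hx hy := by
  refine L.del _ _ _ _ _ _ _ _ l.length (fun z => ?_) (admOn_pathMap _ _ _ _)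
  change pathFun (l ++ l') h'.ne_nil z = if z < (l.length : ℤ) then
    pathFun (l ++ w :: l') h.ne_nil z else pathFun (l ++ w :: l') h.ne_nil (z + 1)
  have h0 := List.length_pos_iff.2 hl
  have h0' := List.length_pos_iff.2 hl'
  unfold pathFun
  simp only [List.getElem_append, List.length_append, List.length_cons]
  by_cases hz : z < l.length
  · rw [if_pos hz, dif_pos (by omega), dif_pos (by omega)]
    congr 1
    omega
  · rw [if_neg hz, dif_neg (by omega), dif_neg (by omega), List.getElem_cons, dif_neg (by omega)]
    congr 1
    omega

theorem path_dup {w : X} (h : Walk V S x y (l ++ w :: w :: l'))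
    (h' : Walk V S x y (l ++ w :: l')) (hl : l ≠ []) : L.path h hx hy = L.path h' hx hy :=
  L.path_erase hx hy h h' hl (by simp)

/-- The excursion is cancelled from its far end. Once the part beyond the head `v` has shrunk to a
point `v'`, the list reads `v, v', v`; here `v'` can be erased because `v` is adjacent to itself,
and then the repeated `v` too. -/
theorem path_cancel {w : X} {t : List X} (ht : t.head? = some w)
    (h : Walk V S x y (l ++ (t ++ t.reverse) ++ l')) (h' : Walk V S x y (l ++ w :: l'))
    (hl : l ≠ []) : L.path h hx hy = L.path h' hx hy := by
  induction t generalizing l l' w with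
  | nil => simp at ht
  | cons v t ih =>
    obtain rfl : v = w := by simpa using ht
    rcases t with _ | ⟨v', t⟩
    · rw [L.path_congr hx hy (l' := l ++ v :: v :: l') (by simp) h (by simpa using h)]
      exact L.path_dup hx hy _ _ hl
    · have e : l ++ (v :: v' :: t ++ (v :: v' :: t).reverse) ++ l' =
          (l ++ [v]) ++ ((v' :: t) ++ (v' :: t).reverse) ++ (v :: l') := by simp
      have hv : V.Adj v v' ∧ v' ∈ S := by
        constructor
        · have := h.chain
          simp only [List.append_assoc, List.cons_append, List.isChain_append_cons_cons] at this
          exact this.2.1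
        · exact h.mem _ (by simp)
      have h1 : Walk V S x y ((l ++ [v]) ++ v' :: (v :: l')) := by
        refine ⟨?_, ?_, ?_, ?_⟩
        · have := h'.head
          rw [List.head?_append_of_ne_nil _ hl] at this
          rw [List.append_assoc, List.head?_append_of_ne_nil _ hl, this]
        · have := h'.last
          rw [List.getLast?_append_of_ne_nil _ (by simp)] at this
          rw [List.getLast?_append_of_ne_nil _ (by simp), List.getLast?_cons_cons, this]
        · have := h'.chain
          rw [List.isChain_split] at this
          rw [List.append_assoc, List.singleton_append, List.isChain_split]
          refine ⟨this.1, ?_⟩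
          simp [hv.1, hv.1.symm, this.2]
        · intro z hz
          simp only [List.mem_append, List.mem_cons, List.not_mem_nil, or_false] at hz
          have := h'.mem z
          simp only [List.mem_append, List.mem_cons] at this
          rcases hz with (hz | rfl) | rfl | rfl | hz
          · exact this (Or.inl hz)
          · exact this (Or.inr (Or.inl rfl))
          · exact hv.2
          · exact this (Or.inr (Or.inl rfl))
          · exact this (Or.inr (Or.inr hz))
      have h2 : Walk V S x y (l ++ v :: v :: l') := by
        refine ⟨?_, ?_, ?_, ?_⟩
        · have := h'.head
          rwa [List.head?_append_of_ne_nil _ hl] at this ⊢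
        · have := h'.last
          rwa [List.getLast?_append_of_ne_nil _ (by simp)] at this ⊢
        · have := h'.chain
          rw [List.isChain_split] at this ⊢
          exact ⟨this.1, by simp [Adj.refl, this.2]⟩
        · intro z hz
          apply h'.mem
          simpa using hz
      rw [L.path_congr hx hy e h (e ▸ h), ih rfl (e ▸ h) h1 (by simp)]
      rw [L.path_erase hx hy h1 (by simpa using h2) (by simp) (by simp),
        L.path_congr hx hy (l' := l ++ v :: v :: l') (by simp) _ h2]
      exact L.path_dup hx hy _ _ hl

end Labelling

/-- A choice, for every point `x`, of a list of successively adjacent points leading from `x` to a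
point of a member of `𝒰`. -/
structure Tether (V : SemiCoarse X) (𝒰 : Set (Set X)) where
  /-- the list -/
  list : X → List X
  /-- its last point -/
  base : X → X
  walk : ∀ x, Walk V Set.univ x (base x) (list x)
  base_mem : ∀ x, base x ∈ ⋃₀ 𝒰
  list_of_mem : ∀ x ∈ ⋃₀ 𝒰, list x = [x]

namespace Tether

variable (T : Tether V 𝒰)

/-- The lists of the points of `S` run in `S`. -/
def Stays (S : Set X) : Prop := ∀ x ∈ S, ∀ y ∈ T.list x, y ∈ S

theorem base_of_mem {x : X} (hx : x ∈ ⋃₀ 𝒰) : T.base x = x := by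
  have := (T.walk x).last
  rw [T.list_of_mem x hx] at this
  simpa using this.symm

/-- The object over a point. -/
abbrev pt (x : X) : RelFundGrpd V 𝒰 := RelFundGrpd.pt V (T.base_mem x)

theorem pt_of_mem {x : X} (hx : x ∈ ⋃₀ 𝒰) : T.pt x = RelFundGrpd.pt V hx := by
  have : ∀ y (hy : y ∈ ⋃₀ 𝒰), y = x → RelFundGrpd.pt V hy = RelFundGrpd.pt V hx := by
    rintro y hy rfl
    rfl
  exact this _ _ (T.base_of_mem hx)

variable {T}

theorem Stays.walk (hT : T.Stays S) {x : X} (hx : x ∈ S) :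
    Walk V S x (T.base x) (T.list x) :=
  ⟨(T.walk x).head, (T.walk x).last, (T.walk x).chain, hT x hx⟩

theorem stays_univ : T.Stays Set.univ := fun _ _ _ _ => trivial

variable (T)

theorem walk_step {x y : X} (h : V.Adj x y) :
    Walk V Set.univ (T.base x) (T.base y) ((T.list x).reverse ++ T.list y) :=
  (T.walk x).reverse.append (T.walk y) h

/-- The map which runs to `x` against its list, steps to `y`, and runs through the list of `y`. -/
def stepMap {x y : X} (h : V.Adj x y) : CMap V 𝒰 :=
  pathMap (T.walk_step h) (T.base_mem x) (T.base_mem y)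

theorem src_stepMap {x y : X} (h : V.Adj x y) : src (T.stepMap h) = T.pt x := src_pathMap _ _ _

theorem tgt_stepMap {x y : X} (h : V.Adj x y) : tgt (T.stepMap h) = T.pt y := tgt_pathMap _ _ _

variable {T}

theorem Stays.inSet_stepMap (hT : T.Stays S) {x y : X} (hx : x ∈ S) (hy : y ∈ S) (h : V.Adj x y) :
    InSet S (T.stepMap (𝒰 := 𝒰) h) :=
  inSet_pathMap ((hT.walk hx).reverse.append (hT.walk hy) h) (T.base_mem x) (T.base_mem y)

end Tether

namespace Labelling

variable {G : Type*} [Groupoid G] {ob : RelFundGrpd V 𝒰 → G} (L : Labelling V 𝒰 S ob)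
variable {T : Tether V 𝒰} (hT : T.Stays S)

/-- The morphism assigned to a step between adjacent points. -/
def step {x y : X} (hx : x ∈ S) (hy : y ∈ S) (h : V.Adj x y) : ob (T.pt x) ⟶ ob (T.pt y) :=
  L.E (T.stepMap h) (hT.inSet_stepMap hx hy h) (T.src_stepMap h) (T.tgt_stepMap h)

theorem step_eq_path {x y : X} (hx : x ∈ S) (hy : y ∈ S) (h : V.Adj x y) :
    L.step hT hx hy h = L.path ((hT.walk hx).reverse.append (hT.walk hy) h)
      (T.base_mem x) (T.base_mem y) := rfl

/-- At the junction the tether of `y` is run back and forth; it cancels and leaves only the point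
`y`. -/
theorem path_step {x y z : X} {l : List X} (hy : y ∈ S) (hz : z ∈ S)
    (h : Walk V S (T.base x) (T.base y) (l ++ T.list y)) (hl : l ≠ []) (hyz : V.Adj y z)
    (h' : Walk V S (T.base x) (T.base z) ((l ++ [y]) ++ T.list z)) :
    L.path h (T.base_mem x) (T.base_mem y) ≫ L.step hT hy hz hyz =
      L.path h' (T.base_mem x) (T.base_mem z) := by
  have hy' := (hT.walk hy).reverse.append (hT.walk hz) hyz
  rw [step_eq_path, ← L.path_append _ _ _ h hy' (h.append hy' (Adj.refl _ _))]
  have h'' := h.append hy' (Adj.refl _ _)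
  have e : l ++ T.list y ++ ((T.list y).reverse ++ T.list z) =
    l ++ (T.list y ++ (T.list y).reverse) ++ T.list z := by simp
  rw [L.path_congr _ _ e h'' (e ▸ h''), L.path_cancel _ _ (T.walk y).head _ (by simpa using h') hl]
  exact L.path_congr _ _ (by simp) _ _

/-- After the tether of `y` has cancelled, `y` is a single interior point, which can be erased
because `x` and `z` are adjacent. This is the relation that well-splitting later propagates to all
of `X`. -/
theorem step_trans {x y z : X} (hx : x ∈ S) (hy : y ∈ S) (hz : z ∈ S) (hxy : V.Adj x y)
    (hyz : V.Adj y z) (hxz : V.Adj x z) :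
    L.step hT hx hy hxy ≫ L.step hT hy hz hyz = L.step hT hx hz hxz := by
  have h' : Walk V S (T.base x) (T.base z) (((T.list x).reverse ++ [y]) ++ T.list z) :=
    ((hT.walk hx).reverse.append (.single hy) hxy).append (hT.walk hz) hyz
  rw [step_eq_path, L.path_step hT hy hz _ (by simpa using (T.walk x).ne_nil) hyz h',
    L.path_congr _ _ (l' := (T.list x).reverse ++ y :: T.list z) (by simp) h' (by simpa using h')]
  exact L.path_erase _ _ _ ((hT.walk hx).reverse.append (hT.walk hz) hxz)
    (by simpa using (T.walk x).ne_nil) (T.walk z).ne_nil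

theorem step_self {x : X} (hx : x ∈ S) (h : V.Adj x x) : L.step hT hx hx h = 𝟙 _ := by
  have := L.step_trans hT hx hx hx h h h
  rwa [← cancel_epi (L.step hT hx hx h), Category.comp_id]

end Labelling

section transport

variable {G : Type*} [Category G] {o : X → G} (σ : ∀ {x y : X}, V.Adj x y → (o x ⟶ o y))

/-- The product of the steps along a sequence of successively adjacent points. -/
def transport (γ : ℕ → X) (h : ∀ i, V.Adj (γ i) (γ (i + 1))) : ∀ k, o (γ 0) ⟶ o (γ k)
  | 0 => 𝟙 _
  | k + 1 => transport γ h k ≫ σ (h k)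

end transport

theorem walk_map_range {γ : ℕ → X} (h : ∀ i, V.Adj (γ i) (γ (i + 1))) (hγ : ∀ i, γ i ∈ S) (k : ℕ) :
    Walk V S (γ 0) (γ k) ((List.range (k + 1)).map γ) := by
  induction k with
  | zero => exact .single (hγ 0)
  | succ k ih =>
    rw [List.range_succ, List.map_append]
    exact ih.append (.single (hγ _)) (h k)

/-- The intermediate tethers cancel one after another, by `path_step`, so only the two at the ends
remain. -/
theorem Labelling.transport_eq {G : Type*} [Groupoid G] {ob : RelFundGrpd V 𝒰 → G}
    (L : Labelling V 𝒰 S ob) {T : Tether V 𝒰} (hT : T.Stays S)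
    (σ : ∀ {x y : X}, V.Adj x y → (ob (T.pt x) ⟶ ob (T.pt y)))
    (hσ : ∀ {x y : X} (hx : x ∈ S) (hy : y ∈ S) (h : V.Adj x y), σ h = L.step hT hx hy h)
    {γ : ℕ → X} (h : ∀ i, V.Adj (γ i) (γ (i + 1))) (hγ : ∀ i, γ i ∈ S) (k : ℕ)
    (hw : Walk V S (T.base (γ 0)) (T.base (γ k))
      ((T.list (γ 0)).reverse ++ (List.range k).map γ ++ T.list (γ k))) :
    transport (o := fun x => ob (T.pt x)) σ γ h k =
      L.path hw (T.base_mem _) (T.base_mem _) := by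
  induction k with
  | zero =>
    rw [L.path_congr _ _ (by simp) hw ((hT.walk (hγ 0)).reverse.append (hT.walk (hγ 0))
      (Adj.refl _ _)), ← L.step_eq_path hT (hγ 0) (hγ 0) (Adj.refl _ _), L.step_self]
    rfl
  | succ k ih =>
    have hw' : Walk V S (T.base (γ 0)) (T.base (γ k))
        ((T.list (γ 0)).reverse ++ (List.range k).map γ ++ T.list (γ k)) := by
      rcases k with _ | k
      · simpa using (hT.walk (hγ 0)).reverse.append (hT.walk (hγ 0)) (Adj.refl _ _)
      · exact ((hT.walk (hγ 0)).reverse.append (walk_map_range h hγ k) (Adj.refl _ _)).append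
          (hT.walk (hγ (k + 1))) (h k)
    rw [transport, ih hw', hσ (hγ k) (hγ (k + 1)),
      L.path_step hT (hγ k) (hγ (k + 1)) hw' (by simp [(T.walk (γ 0)).ne_nil])
        (h k) (by rw [List.range_succ] at hw; simpa using hw)]
    exact L.path_congr _ _ (by simp [List.range_succ]) _ _

end RelFundGrpd

/-! ### Rays: admissible places to cut, and splitting off the first step. -/

namespace RelFundGrpd

open CMap

variable {X : Type u} {V : SemiCoarse X} {𝒰 : Set (Set X)} {S : Set X}

/-- The map which agrees with `f` on `[m, ∞)` and is constant on `(-∞, m]`. -/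
def fromIdx (f : CMap V 𝒰) (m : ℤ) (h : f.toFun m ∈ ⋃₀ 𝒰) : CMap V 𝒰 where
  toFun z := f.toFun (max z m)
  born := f.born.comp (bornologous_zOne fun a b h => by rw [abs_le] at h ⊢; omega)
  tails := by
    obtain ⟨-, U, hU, n, hn⟩ := f.tails
    obtain ⟨U', hU', hm⟩ := h
    exact ⟨⟨U', hU', m, fun z hz => by simpa [max_eq_right hz] using hm⟩, U, hU, n, fun z hz => hn _ (by omega)⟩

/-- The map which agrees with `f` on `(-∞, n]` and is constant on `[n, ∞)`. -/
def upTo (f : CMap V 𝒰) (n : ℤ) (h : f.toFun n ∈ ⋃₀ 𝒰) : CMap V 𝒰 where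
  toFun z := f.toFun (min z n)
  born := f.born.comp (bornologous_zOne fun a b h => by rw [abs_le] at h ⊢; omega)
  tails := by
    obtain ⟨⟨U, hU, m, hm⟩, -⟩ := f.tails
    obtain ⟨U', hU', hn⟩ := h
    exact ⟨⟨U, hU, m, fun z hz => hm _ (by omega)⟩, U', hU', n, fun z hz => by simpa [min_eq_right hz] using hn⟩

section

variable {f : CMap V 𝒰} {m : ℤ} (h : f.toFun m ∈ ⋃₀ 𝒰)

theorem fromIdx_of_le {z : ℤ} (hz : m ≤ z) : (fromIdx f m h).toFun z = f.toFun z :=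
  congrArg f.toFun (max_eq_left hz)

theorem fromIdx_of_ge {z : ℤ} (hz : z ≤ m) : (fromIdx f m h).toFun z = f.toFun m :=
  congrArg f.toFun (max_eq_right hz)

theorem upTo_of_le {z : ℤ} (hz : z ≤ m) : (upTo f m h).toFun z = f.toFun z :=
  congrArg f.toFun (min_eq_left hz)

theorem upTo_of_ge {z : ℤ} (hz : m ≤ z) : (upTo f m h).toFun z = f.toFun m :=
  congrArg f.toFun (min_eq_right hz)

theorem src_fromIdx : src (fromIdx f m h) = pt V h :=
  src_eq_pt h (N := m) fun _ hz => fromIdx_of_ge h hz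

theorem tgt_fromIdx : tgt (fromIdx f m h) = tgt f :=
  tgt_eq_of_eventually (N := m) 0 fun z hz => by rw [fromIdx_of_le h hz, add_zero]

theorem tgt_upTo : tgt (upTo f m h) = pt V h :=
  tgt_eq_pt h (N := m) fun _ hz => upTo_of_ge h hz

theorem src_upTo : src (upTo f m h) = src f :=
  src_eq_of_eventually (N := m) 0 fun z hz => by rw [upTo_of_le h hz, add_zero]

theorem inSet_fromIdx (hS : ∀ z ≥ m, f.toFun z ∈ S) : InSet S (fromIdx f m h) :=
  fun z => hS _ (le_max_right z m)

theorem inSet_upTo (hS : ∀ z ≤ m, f.toFun z ∈ S) : InSet S (upTo f m h) :=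
  fun z => hS _ (min_le_right z m)

end

/-- Translation by a large multiple of the period carries `[i, ∞)` into `[j, ∞)` without changing
`g` on `[i, ∞)`; precomposition with it turns a null homotopy on `[j, ∞)` into one on `[i, ∞)`. -/
theorem TailCondOn.mono {g : ℤ → X} {i j : ℤ} (h : TailCondOn V 𝒰 S g j) (hij : i ≤ j) :
    TailCondOn V 𝒰 S g i := by
  rintro hp ⟨k, hk, hk'⟩
  obtain ⟨c, hc⟩ := h (hp.mono (by omega)) ⟨k + (j - i), by omega, by
    rwa [show j - (k + (j - i)) = i - k by ring]⟩
  refine ⟨c, ?_⟩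
  obtain ⟨p, hp0, hp⟩ := hp
  obtain ⟨n, hn⟩ := exists_add_mul_le hp0 i j
  let φ : Set.Ici i → Set.Ici j := fun z => ⟨z + n * p, by
    have : i ≤ (z : ℤ) := z.2
    rw [Set.mem_Ici]
    omega⟩
  have hφ : Bornologous (zOne.sub (Set.Ici i)) (zOne.sub (Set.Ici j)) φ :=
    bornologous_sub ((bornologous_add (n * p)).comp (bornologous_val zOne _))
  have := HomotopicThrough.precomp hc (P' := fun h => RayIn 𝒰 h ∧ ∀ z, h z ∈ S) hφ (by
    rintro u ⟨⟨U, hU, N, hN⟩, hu⟩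
    refine ⟨⟨U, hU, N, fun z hz => hN _ ?_⟩, fun z => hu _⟩
    have : 0 ≤ n * p := by positivity
    change N ≤ (z : ℤ) + n * p
    omega)
  have e : (fun z : Set.Ici i => g (φ z)) = fun z : Set.Ici i => g z := by
    funext z
    have : i ≤ (z : ℤ) := z.2
    exact periodic_mul hp0 hp n (by omega)
  rwa [e] at this

/-- If the condition fails at 0, then `g` is not periodic from some `-k` on, and at `-k + 1` the
condition is vacuous. -/
theorem exists_tailCondOn (V : SemiCoarse X) (𝒰 : Set (Set X)) (S : Set X) (g : ℤ → X) :
    ∃ j, TailCondOn V 𝒰 S g j := by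
  by_contra! h
  have := h 0
  unfold TailCondOn at this
  push Not at this
  obtain ⟨-, ⟨k, -, hk⟩, -⟩ := this
  refine h (-k + 1) fun hp => absurd hp ?_
  rwa [show -k + 1 - 1 = 0 - k by ring]

theorem AdmOn.opp {f : CMap V 𝒰} {j : ℤ} (h : AdmOn V 𝒰 S f.toFun j) :
    AdmOn V 𝒰 S f.opp.toFun (-j) := by
  refine ⟨h.2, ?_⟩
  change TailCondOn V 𝒰 S (fun z => f.toFun (- -z)) (- -j)
  simpa using h.1

/-- The left condition persists when the index grows, so only the right one limits how far out the
cut may go. If it holds everywhere, the cut is moved into the tail. Otherwise there is a last index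
`a` where it holds; failure at `a + 1` means that `f` is periodic from `a` on, and each value there
recurs in the tail. -/
theorem exists_admOn_right {f : CMap V 𝒰} (h : ∃ j, AdmOn V 𝒰 S f.toFun j) :
    ∃ m, AdmOn V 𝒰 S f.toFun m ∧ ∀ z ≥ m, f.toFun z ∈ ⋃₀ 𝒰 := by
  obtain ⟨j, hj, hj'⟩ := h
  obtain ⟨-, U, hU, n, hn⟩ := f.tails
  by_cases H : ∀ j, TailCondOn V 𝒰 S f.toFun j
  · exact ⟨max j n, ⟨H _, hj'.mono (by omega)⟩, fun z hz => ⟨U, hU, hn z (by omega)⟩⟩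
  · push Not at H
    obtain ⟨j₁, h1⟩ := H
    obtain ⟨a, ha, ha'⟩ := Int.exists_greatest_of_bdd (P := TailCondOn V 𝒰 S f.toFun)
      ⟨j₁, fun z hz => by
        by_contra hlt
        exact h1 (hz.mono (by omega))⟩ ⟨j, hj⟩
    refine ⟨a, ⟨ha, hj'.mono (by have := ha' j hj; omega)⟩, fun z hz => ?_⟩
    have h2 : ¬ TailCondOn V 𝒰 S f.toFun (a + 1) := fun h => by
      have := ha' _ h
      omega
    unfold TailCondOn at h2
    push Not at h2
    obtain ⟨⟨p, hp0, hp⟩, -⟩ := h2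
    rw [add_sub_cancel_right] at hp
    obtain ⟨k, hk⟩ := exists_add_mul_le hp0 z n
    exact ⟨U, hU, by rw [← periodic_mul hp0 hp k hz]; exact hn _ hk⟩

/-- All pairs of points of `{u, v}` form a finite controlled set, so every function into `{u, v}` is
bornologous and the homotopy may jump from `g` to `u` in one stage. -/
theorem rayHomotopicOn_of_two {g : ℤ → X} {j : ℤ} {u v : X} (huv : V.Adj u v)
    (h : ∀ z ≥ j, g z = u ∨ g z = v) (hg : RayIn 𝒰 (fun z : Set.Ici j => g z)) (hu : u ∈ ⋃₀ 𝒰)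
    (hS : ∀ z ≥ j, g z ∈ S) (huS : u ∈ S) : RayHomotopicOn V 𝒰 S j g (fun _ => u) := by
  refine ⟨fun p => if p.2 ≤ 0 then g p.1 else u, ?_, ⟨0, 1, fun s => ⟨fun k hk => if_pos hk,
    fun k hk => if_neg (by omega)⟩⟩, fun k => ?_⟩
  · intro E _
    refine V.mem_of_subset (F := ({u, v} : Set X) ×ˢ {u, v}) (mem_sets_of_finite ?_ ?_) ?_
    · exact (Set.toFinite _).prod (Set.toFinite _)
    · have := Adj.refl V u
      have := Adj.refl V v
      have := huv.symm
      rintro ⟨a, b⟩ ⟨h1 | h1, h2 | h2⟩ <;> · dsimp only at h1 h2; subst h1 h2; assumption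
    · have key : ∀ p : Set.Ici j × ℤ, (if p.2 ≤ 0 then g p.1 else u) ∈ ({u, v} : Set X) := by
        intro p
        split_ifs
        · exact h _ p.1.2
        · exact Or.inl rfl
      rintro _ ⟨p, -, rfl⟩
      exact ⟨key _, key _⟩
  · dsimp only
    split_ifs
    · exact ⟨hg, fun z => hS z z.2⟩
    · obtain ⟨U, hU, hu⟩ := hu
      exact ⟨⟨U, hU, 0, fun _ _ => hu⟩, fun _ => huS⟩

namespace Labelling

variable {G : Type*} [Groupoid G] {ob : RelFundGrpd V 𝒰 → G} (L : Labelling V 𝒰 S ob)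
variable {T : Tether V 𝒰} (hT : T.Stays S)

include L hT

/-- Points of members of `𝒰` have trivial tethers, so the step is labelled by any map that jumps
once from `x` to `y`, wherever it jumps. -/
theorem step_eq {x y : X} (hx : x ∈ S) (hy : y ∈ S) (h : V.Adj x y) (hx' : x ∈ ⋃₀ 𝒰)
    (hy' : y ∈ ⋃₀ 𝒰) {g : CMap V 𝒰} {n : ℤ} (h1 : ∀ z ≤ n, g.toFun z = x)
    (h2 : ∀ z > n, g.toFun z = y) (hg : InSet S g) (ha : src g = T.pt x) (hb : tgt g = T.pt y) :
    L.step hT hx hy h = L.E g hg ha hb := by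
  refine L.shift n (fun z => ?_) _ _ _ _ _ _
  have hw := (hT.walk hx).reverse.append (hT.walk hy) h
  have hl : (T.list x).reverse ++ T.list y = [x, y] := by
    rw [T.list_of_mem x hx', T.list_of_mem y hy']
    rfl
  rcases le_or_gt z 0 with hz | hz
  · rw [h1 _ (by omega)]
    exact (pathFun_of_nonpos hw hz).trans (T.base_of_mem hx')
  · rw [h2 _ (by omega)]
    exact (pathFun_of_le hw (by simp [hl]; omega)).trans (T.base_of_mem hy')

theorem step_comp_of_eq {x y : X} (e : x = y) (hx : x ∈ S) (hy : y ∈ S) (h : V.Adj x y)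
    {b : RelFundGrpd V 𝒰} {f : CMap V 𝒰} (hf : InSet S f) (ha : src f = T.pt x)
    (ha' : src f = T.pt y) (hb : tgt f = b) :
    L.E f hf ha hb = L.step hT hx hy h ≫ L.E f hf ha' hb := by
  subst e
  rw [step_self, Category.id_comp]

/-- The first step along a ray can be split off, if the ray is admissible there. -/
theorem ray_step_of_tailCondOn {f : CMap V 𝒰} {m : ℤ} (hU : ∀ z ≥ m, f.toFun z ∈ ⋃₀ 𝒰)
    (hS : ∀ z ≥ m, f.toFun z ∈ S) (hU1 : f.toFun (m + 1) ∈ ⋃₀ 𝒰) (hS1 : f.toFun (m + 1) ∈ S)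
    (h : TailCondOn V 𝒰 S (fromIdx f m (hU m le_rfl)).toFun (m + 1))
    {c : RelFundGrpd V 𝒰} (hf : InSet S (fromIdx f m (hU m le_rfl)))
    (hf' : InSet S (fromIdx f (m + 1) hU1))
    (ha : src (fromIdx f m (hU m le_rfl)) = T.pt (f.toFun m))
    (hb : tgt (fromIdx f m (hU m le_rfl)) = c)
    (ha' : src (fromIdx f (m + 1) hU1) = T.pt (f.toFun (m + 1)))
    (hb' : tgt (fromIdx f (m + 1) hU1) = c) :
    L.E (fromIdx f m (hU m le_rfl)) hf ha hb =
      L.step hT (hS m le_rfl) hS1 (f.born.adj_succ m) ≫ L.E (fromIdx f (m + 1) hU1) hf' ha' hb' := by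
  let f₀ := fromIdx f m (hU m le_rfl)
  have hm : f₀.toFun (m + 1) = f.toFun (m + 1) := fromIdx_of_le _ (by omega)
  have hm' : f₀.toFun (m + 1) ∈ ⋃₀ 𝒰 := hm ▸ hU1
  let g := upTo f₀ (m + 1) hm'
  have hg : InSet S g := inSet_upTo _ fun z _ => hf z
  have g1 : ∀ z ≤ m, g.toFun z = f.toFun m := fun z hz =>
    (upTo_of_le _ (by omega)).trans (fromIdx_of_ge _ hz)
  have g2 : ∀ z > m, g.toFun z = f.toFun (m + 1) := fun z hz =>
    (upTo_of_ge _ (by omega)).trans hm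
  have es : src g = T.pt (f.toFun m) :=
    (src_eq_pt (hU m le_rfl) g1).trans (T.pt_of_mem _).symm
  have et : tgt g = T.pt (f.toFun (m + 1)) :=
    (tgt_eq_pt hU1 (N := m + 1) fun z hz => g2 z (by omega)).trans (T.pt_of_mem _).symm
  rw [L.step_eq hT _ _ _ (hU m le_rfl) hU1 g1 g2 hg es et]
  refine L.merge _ _ _ _ _ _ _ _ _ _ _ _ (f.toFun (m + 1)) (m + 1) (m + 1) (m + 1)
    (fun z hz => g2 z (by omega)) (fun z hz => fromIdx_of_ge _ hz) le_rfl le_rfl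
    (fun z => ?_) ⟨h, tailCondOn_of_const_left hf (N := m) (fun z hz => fromIdx_of_ge _ hz) _⟩
  split_ifs with hz
  · exact (upTo_of_le _ hz).symm
  · exact (fromIdx_of_le _ (by omega)).trans (fromIdx_of_le _ (by omega)).symm

section periodic

variable {x : CMap V 𝒰} (hU : ∀ z, x.toFun z ∈ ⋃₀ 𝒰) (hS : InSet S x)

/-- The step from `a` to `a + 1` can be split off the ray which starts at `a`. -/
def RayStep (x : CMap V 𝒰) (hU : ∀ z, x.toFun z ∈ ⋃₀ 𝒰) (hS : InSet S x) (a : ℤ) : Prop :=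
  L.E (fromIdx x a (hU a)) (inSet_fromIdx _ fun z _ => hS z)
      ((src_fromIdx _).trans (T.pt_of_mem (hU a)).symm) (tgt_fromIdx _) =
    L.step hT (hS a) (hS (a + 1)) (x.born.adj_succ a) ≫
      L.E (fromIdx x (a + 1) (hU (a + 1))) (inSet_fromIdx _ fun z _ => hS z)
      ((src_fromIdx _).trans (T.pt_of_mem (hU (a + 1))).symm) (tgt_fromIdx _)

theorem rayStep_of_eq {a : ℤ} (h : x.toFun a = x.toFun (a + 1)) : L.RayStep hT x hU hS a := by
  have e : fromIdx x a (hU a) = fromIdx x (a + 1) (hU (a + 1)) := by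
    ext z
    rcases le_or_gt z a with hz | hz
    · rw [fromIdx_of_ge _ hz, fromIdx_of_ge _ (by omega), h]
    · rw [fromIdx_of_le _ hz.le, fromIdx_of_le _ (by omega)]
  unfold RayStep
  rw [L.congr e _ (inSet_fromIdx _ fun z _ => hS z) _ _
    (e ▸ (src_fromIdx _).trans (T.pt_of_mem (hU a)).symm) (tgt_fromIdx _)]
  exact L.step_comp_of_eq hT h _ _ _ _ _ _ _

variable {p : ℤ} (hp0 : 0 < p) (hp : ∀ z, x.toFun (z + p) = x.toFun z)

include hp0 hp

/-- Merging at the first step of the ray may be inadmissible, so the reverse step is used: the ray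
from `a + 2` is shown to be the step back to `x (a + 1)` followed by the ray from `a + 1`. This
suffices since a step and its reverse cancel. The link between the two is the ray `f₀`, which makes
a detour from `x (a + 2)` back to `x (a + 1)` and then follows `x`. -/
theorem rayStep_of_ne {a : ℤ} (h : x.toFun (a + 2) ≠ x.toFun (a + 1))
    (h' : x.toFun (a + 2) = x.toFun a → L.RayStep hT x hU hS a) :
    L.RayStep hT x hU hS (a + 1) := by
  -- If `g` follows a translate of `x` after `i` and is periodic from `i` on, comparison at `i + p *
  -- q`, a common multiple of both periods away, shows that it already follows it at `i`. Both
  -- admissibility checks below are settled by this.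
  have hper : ∀ (g : ℤ → X) (i d : ℤ), (∀ z ≥ i + 1, g z = x.toFun (z + d)) → PeriodicFrom g i →
      g i = x.toFun (i + d) := by
    rintro g i d hg ⟨q, hq0, hq⟩
    lift p to ℕ using hp0.le with p' hp'
    lift q to ℕ using hq0.le with q' hq'
    have h1 : (1 : ℤ) ≤ p' * q' := by nlinarith
    rw [← periodic_mul hq0 hq p' le_rfl, hg _ (by omega),
      ← periodic_mul (a := i + d) hp0 (fun z _ => hp z) q' le_rfl]
    congr 1
    ring
  let r (i : ℤ) : CMap V 𝒰 := fromIdx x i (hU i)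
  have hr (i : ℤ) : InSet S (r i) := inSet_fromIdx _ fun z _ => hS z
  have sr (i : ℤ) : src (r i) = T.pt (x.toFun i) := (src_fromIdx _).trans (T.pt_of_mem (hU i)).symm
  have tr (i : ℤ) : tgt (r i) = tgt x := tgt_fromIdx _
  have hadj : V.Adj (x.toFun (a + 1)) (x.toFun (a + 2)) := by
    have := x.born.adj_succ (a + 1)
    rwa [show a + 1 + 1 = a + 2 by ring] at this
  have r1 (i z : ℤ) (hz : z ≤ i) : (r i).toFun z = x.toFun i := fromIdx_of_ge _ hz
  have r2 (i z : ℤ) (hz : i ≤ z) : (r i).toFun z = x.toFun z := fromIdx_of_le _ hz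
  let f₀ : CMap V 𝒰 :=
    ⟨fun z => if z < a + 2 then x.toFun (a + 2) else x.toFun (z - 1), by
      refine bornologous_of_steps (fun z => ?_) (a + 1) (a + 1)
        (V.union_mem V.diagonal_mem (bornologous_zOne_iff.1 x.born)) ?_
      · split_ifs with h1 h2
        · exact Adj.refl _ _
        · obtain rfl : z = a + 1 := by omega
          rw [add_sub_cancel_right]
          exact hadj.symm
        · omega
        · rw [show z + 1 - 1 = z - 1 + 1 by ring]
          exact x.born.adj_succ _
      · rintro z (hz | hz)
        · rw [if_pos (by omega), if_pos (by omega)]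
          exact Or.inl rfl
        · rw [if_neg (by omega), if_neg (by omega)]
          exact Or.inr ⟨z - 1, by simp⟩, by
      obtain ⟨-, U, hU', n, hn⟩ := x.tails
      obtain ⟨W, hW, hx⟩ := hU (a + 2)
      refine ⟨⟨W, hW, a + 1, fun z hz => ?_⟩, U, hU', max (n + 1) (a + 2), fun z hz => ?_⟩
      · dsimp only
        rwa [if_pos (by omega)]
      · dsimp only
        rw [if_neg (by omega)]
        exact hn _ (by omega)⟩
  have f1 (z : ℤ) (hz : z < a + 2) : f₀.toFun z = x.toFun (a + 2) := if_pos hz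
  have f2 (z : ℤ) (hz : a + 2 ≤ z) : f₀.toFun z = x.toFun (z - 1) := if_neg (by omega)
  have hf₀ : InSet S f₀ := fun z => by
    rcases lt_or_ge z (a + 2) with hz | hz
    · rw [f1 z hz]
      exact hS _
    · rw [f2 z hz]
      exact hS _
  have sf : src f₀ = T.pt (x.toFun (a + 2)) :=
    (src_eq_pt (hU _) (N := a + 1) fun z hz => f1 z (by omega)).trans (T.pt_of_mem _).symm
  have tf : tgt f₀ = tgt x := tgt_eq_of_eventually (N := a + 2) (-1) fun z hz => f2 z hz
  -- Deleting the point at `a + 2` removes the detour. Periodicity of the result from `a + 1` on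
  -- would give `x (a + 2) = x (a + 1)`, so the deletion is admissible.
  have hdel : L.E f₀ hf₀ sf tf = L.E (r (a + 2)) (hr _) (sr _) (tr _) := by
    refine L.del _ _ _ _ _ _ _ _ (a + 2) (fun z => ?_) ⟨fun hP => ?_,
      tailCondOn_of_const_left (hr _) (r1 (a + 2)) _⟩
    · split_ifs with hz
      · rw [f1 z hz, r1 _ _ hz.le]
      · rw [f2 _ (by omega), r2 _ _ (by omega), add_sub_cancel_right]
    · refine absurd ?_ h
      have := hper _ (a + 2 - 1) 0 (fun z hz => by rw [r2 _ _ (by omega), add_zero]) hP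
      rw [r1 _ _ (by omega)] at this
      rw [this]
      congr 1
      ring
  have hback : L.E (r (a + 2)) (hr _) (sr _) (tr _) =
      L.step hT (hS (a + 2)) (hS (a + 1)) hadj.symm ≫ L.E (r (a + 1)) (hr _) (sr _) (tr _) := by
    -- In the first case `f₀` is a translate of the ray from `a`, and the splitting at `a` applies.
    -- In the second, `f₀` can be cut after its first step, since periodicity from `a + 1` on would
    -- force the excluded equality.
    by_cases he : x.toFun (a + 2) = x.toFun a
    · have h1 : L.E f₀ hf₀ (sf.trans (by rw [he])) tf = L.E (r a) (hr _) (sr _) (tr _) := by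
        refine L.shift (-1) (fun z => ?_) _ _ _ _ _ _
        rcases lt_or_ge z (a + 2) with hz | hz
        · rw [f1 z hz, he]
          rcases eq_or_ne z (a + 1) with rfl | hne
          · rw [r1 _ _ (by omega)]
          · rw [r1 _ _ (by omega)]
        · rw [f2 z hz, r2 _ _ (by omega)]
          rfl
      have h2 : L.E (r a) (hr _) (sr _) (tr _) = _ := h' he
      rw [← hdel]
      have key : ∀ (y : X) (e : y = x.toFun a) (hy : y ∈ S) (hadj' : V.Adj y (x.toFun (a + 1)))
          (sf : src f₀ = T.pt y), L.E f₀ hf₀ sf tf =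
          L.step hT hy (hS (a + 1)) hadj' ≫ L.E (r (a + 1)) (hr _) (sr _) (tr _) := by
        rintro y rfl hy hadj' sf
        exact h1.trans h2
      exact key _ he _ _ _
    · have hU0 : f₀.toFun (a + 2) ∈ ⋃₀ 𝒰 := by
        rw [f2 _ le_rfl]
        exact hU _
      have e0 : f₀.toFun (a + 2) = x.toFun (a + 1) := by
        rw [f2 _ le_rfl]
        congr 1
        ring
      let g := upTo f₀ (a + 2) hU0
      let k := fromIdx f₀ (a + 2) hU0
      have hg : InSet S g := inSet_upTo _ fun z _ => hf₀ z
      have hk : InSet S k := inSet_fromIdx _ fun z _ => hf₀ z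
      have g1 : ∀ z ≤ a + 1, g.toFun z = x.toFun (a + 2) := fun z hz =>
        (upTo_of_le _ (by omega)).trans (f1 z (by omega))
      have g2 : ∀ z > a + 1, g.toFun z = x.toFun (a + 1) := fun z hz =>
        (upTo_of_ge _ (by omega)).trans e0
      have sg : src g = T.pt (x.toFun (a + 2)) := (src_upTo _).trans sf
      have tg : tgt g = T.pt (x.toFun (a + 1)) :=
        (tgt_eq_pt (hU _) (N := a + 2) fun z hz => g2 z (by omega)).trans (T.pt_of_mem _).symm
      have hkr : ∀ z, k.toFun z = (r (a + 1)).toFun (z + -1) := by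
        intro z
        rcases le_or_gt z (a + 2) with hz | hz
        · rw [r1 _ _ (by omega)]
          exact (fromIdx_of_ge _ hz).trans e0
        · rw [r2 _ _ (by omega)]
          exact (fromIdx_of_le _ hz.le).trans (f2 _ hz.le)
      have sk : src k = T.pt (x.toFun (a + 1)) :=
        (src_eq_of_eventually (N := 0) _ fun z _ => hkr z).trans (sr _)
      have tk : tgt k = tgt x := (tgt_fromIdx _).trans tf
      rw [L.step_eq hT _ _ _ (hU _) (hU _) g1 g2 hg sg tg,
        ← L.shift _ hkr hk _ sk tk _ _, ← hdel]
      refine L.merge _ _ _ _ _ _ _ _ _ _ _ _ (f₀.toFun (a + 2)) (a + 2) (a + 2) (a + 2)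
        (fun z hz => upTo_of_ge _ hz) (fun z hz => fromIdx_of_ge _ hz) le_rfl le_rfl
        (fun z => ?_) ⟨fun hP => ?_, tailCondOn_of_const_left hf₀ (N := a + 1)
          (fun z hz => f1 z (by omega)) _⟩
      · split_ifs with hz
        · exact (upTo_of_le _ hz).symm
        · exact (fromIdx_of_le _ (by omega)).symm
      · refine absurd ?_ he
        have := hper _ (a + 2 - 1) (-1) (fun z hz => f2 z (by omega)) hP
        rw [f1 _ (by omega)] at this
        rw [this]
        congr 1
        ring
  have e2 : a + 1 + 1 = a + 2 := by ring
  have key : ∀ i (e : i = a + 2) (hadj' : V.Adj (x.toFun (a + 1)) (x.toFun i)),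
      L.E (r (a + 1)) (hr _) (sr _) (tr _) =
      L.step hT (hS (a + 1)) (hS i) hadj' ≫ L.E (r i) (hr _) (sr _) (tr _) := by
    rintro _ rfl hadj'
    rw [hback, ← Category.assoc, L.step_trans hT _ _ _ _ _ (Adj.refl _ _), L.step_self,
      Category.id_comp]
  exact key _ e2 _

/-- A step can be split off a periodic ray, if the ray does not only run back and forth. -/
theorem rayStep_of_periodic (h : ∃ c, x.toFun (c + 2) = x.toFun (c + 1) ∨
    x.toFun (c + 2) ≠ x.toFun c) (a : ℤ) : L.RayStep hT x hU hS a := by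
  obtain ⟨c, hc⟩ := h
  have hx : ∀ (n : ℕ) z, x.toFun (z - n * p) = x.toFun z := fun n z => by
    rw [← periodic_mul (a := z - n * p) hp0 (fun z _ => hp z) n le_rfl, sub_add_cancel]
  -- By periodicity the place where `x` does not alternate can be moved to the left of `a`; the
  -- splitting then propagates to the right.
  obtain ⟨n, hn⟩ := exists_add_mul_le hp0 a (c + 1)
  have hc' : x.toFun (c - n * p + 2) = x.toFun (c - n * p + 1) ∨
      x.toFun (c - n * p + 2) ≠ x.toFun (c - n * p) := by
    rw [show c - n * p + 2 = c + 2 - n * p by ring, show c - n * p + 1 = c + 1 - n * p by ring]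
    simpa only [hx] using hc
  have main : ∀ i, c - n * p + 1 ≤ i → L.RayStep hT x hU hS i := by
    intro i hi
    have cases : ∀ i, (x.toFun (i + 2) ≠ x.toFun (i + 1) → L.RayStep hT x hU hS (i + 1)) →
        L.RayStep hT x hU hS (i + 1) := by
      intro i h
      by_cases e : x.toFun (i + 2) = x.toFun (i + 1)
      · exact L.rayStep_of_eq hT hU hS (by rw [← e]; congr 1; ring)
      · exact h e
    induction i, hi using Int.leInduction with
    | base =>
      -- Here the case `x (i + 2) = x i`, which would need the splitting one index earlier, is
      -- excluded by the choice of `c`.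
      refine cases _ fun hne => L.rayStep_of_ne hT hU hS hp0 hp hne fun e => ?_
      rcases hc' with h | h
      · exact absurd h hne
      · exact absurd e h
    | succ i hi ih =>
      exact cases _ fun hne => L.rayStep_of_ne hT hU hS hp0 hp hne fun _ => ih
  exact main a (by omega)

end periodic

/-- The first step of a ray in the members of `𝒰` can be split off. -/
theorem ray_step {f : CMap V 𝒰} {m : ℤ} (hU : ∀ z ≥ m, f.toFun z ∈ ⋃₀ 𝒰)
    (hS : ∀ z ≥ m, f.toFun z ∈ S) (hU1 : f.toFun (m + 1) ∈ ⋃₀ 𝒰) (hS1 : f.toFun (m + 1) ∈ S)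
    {c : RelFundGrpd V 𝒰} (hf : InSet S (fromIdx f m (hU m le_rfl)))
    (hf' : InSet S (fromIdx f (m + 1) hU1))
    (ha : src (fromIdx f m (hU m le_rfl)) = T.pt (f.toFun m))
    (hb : tgt (fromIdx f m (hU m le_rfl)) = c)
    (ha' : src (fromIdx f (m + 1) hU1) = T.pt (f.toFun (m + 1)))
    (hb' : tgt (fromIdx f (m + 1) hU1) = c) :
    L.E (fromIdx f m (hU m le_rfl)) hf ha hb =
      L.step hT (hS m le_rfl) hS1 (f.born.adj_succ m) ≫ L.E (fromIdx f (m + 1) hU1) hf' ha' hb' := by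
  by_cases h : TailCondOn V 𝒰 S (fromIdx f m (hU m le_rfl)).toFun (m + 1)
  · exact L.ray_step_of_tailCondOn hT hU hS hU1 hS1 h hf hf' ha hb ha' hb'
  · unfold TailCondOn at h
    push Not at h
    obtain ⟨⟨p, hp0, hp⟩, -, hnull⟩ := h
    rw [add_sub_cancel_right] at hp
    have hp' : ∀ z ≥ m, f.toFun (z + p) = f.toFun z := fun z hz => by
      have := hp z hz
      rwa [fromIdx_of_le _ hz, fromIdx_of_le _ (by omega)] at this
    -- `ξ` folds `ℤ` onto the period `[m, m + p)`, so `f ∘ ξ` continues the periodic ray to a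
    -- periodic map on all of `ℤ`.
    let ξ : ℤ → ℤ := fun z => m + (z - m) % p
    have hξ : ∀ z, m ≤ ξ z := fun z => by
      have := Int.emod_nonneg (z - m) hp0.ne'
      simp only [ξ]
      omega
    have hξf : ∀ z ≥ m, f.toFun (ξ z) = f.toFun z := by
      intro z hz
      have h1 := Int.emod_add_mul_ediv (z - m) p
      have h2 : 0 ≤ (z - m) / p := Int.ediv_nonneg (by omega) hp0.le
      obtain ⟨n, hn⟩ := Int.eq_ofNat_of_zero_le h2
      rw [← periodic_mul hp0 hp' n (hξ z)]
      congr 1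
      rw [hn] at h1
      simp only [ξ]
      linarith [mul_comm p (n : ℤ)]
    have hξs : ∀ z, f.toFun (ξ (z + 1)) = f.toFun (ξ z + 1) := by
      intro z
      rw [← hξf (ξ z + 1) (by have := hξ z; omega)]
      congr 1
      simp only [ξ]
      congr 1
      rw [show m + (z - m) % p + 1 - m = (z - m) % p + 1 by ring, Int.emod_add_emod]
      congr 1
      ring
    have hξp : ∀ z, ξ (z + p) = ξ z := fun z => by
      simp only [ξ]
      rw [show z + p - m = z - m + p by ring, Int.add_emod_right]
    obtain ⟨U, hU', n, hn⟩ := f.tails.2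
    have hξU : ∀ z, f.toFun (ξ z) ∈ U := fun z => by
      obtain ⟨k, hk⟩ := exists_add_mul_le hp0 (ξ z) n
      rw [← periodic_mul hp0 hp' k (hξ z)]
      exact hn _ hk
    let x : CMap V 𝒰 := ⟨fun z => f.toFun (ξ z), by
      rw [bornologous_zOne_iff]
      refine V.mem_of_subset (bornologous_zOne_iff.1 f.born) ?_
      rintro _ ⟨z, rfl⟩
      exact ⟨ξ z, by simp only [hξs]⟩, ⟨U, hU', 0, fun z _ => hξU z⟩, U, hU', 0, fun z _ => hξU z⟩
    have hxf : ∀ z ≥ m, x.toFun z = f.toFun z := hξf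
    have hxU : ∀ z, x.toFun z ∈ ⋃₀ 𝒰 := fun z => ⟨U, hU', hξU z⟩
    have hxS : InSet S x := fun z => hS _ (hξ z)
    have hxp : ∀ z, x.toFun (z + p) = x.toFun z := fun z => congrArg f.toFun (hξp z)
    have er : ∀ (i : ℤ) (hi : m ≤ i) (h : f.toFun i ∈ ⋃₀ 𝒰), fromIdx f i h =
        fromIdx x i (hxU i) := by
      intro i hi h
      ext z
      exact (hxf _ (hi.trans (le_max_right z i))).symm
    have key : L.RayStep hT x hxU hxS m := by
      refine L.rayStep_of_periodic hT hxU hxS hp0 hxp ?_ m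
      -- Otherwise `x` alternates between two adjacent points, and such a ray is null homotopic,
      -- against `hnull`.
      by_contra! H
      have two : ∀ z ≥ m, x.toFun z = x.toFun m ∨ x.toFun z = x.toFun (m + 1) := by
        have : ∀ z ≥ m, (x.toFun z = x.toFun m ∧ x.toFun (z + 1) = x.toFun (m + 1)) ∨
            (x.toFun z = x.toFun (m + 1) ∧ x.toFun (z + 1) = x.toFun m) := by
          intro z hz
          induction z, hz using Int.leInduction with
          | base => exact Or.inl ⟨rfl, rfl⟩
          | succ z hz ih =>
            have := (H z).2
            rw [show z + 2 = z + 1 + 1 by ring] at this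
            rw [this]
            tauto
        intro z hz
        exact (this z hz).imp And.left And.left
      refine hnull (x.toFun m) (rayHomotopicOn_of_two (x.born.adj_succ m) (fun z hz => ?_) ?_
        (hxU m) (fun z _ => hf z) (hxS m))
      · rw [er m le_rfl, fromIdx_of_le _ (by omega)]
        exact two z (by omega)
      · exact ⟨U, hU', n + |m|, fun z hz => by
          have := le_abs_self m
          have := neg_abs_le m
          have := z.2
          rw [Set.mem_Ici] at this
          have := abs_nonneg m
          dsimp only
          rw [fromIdx_of_le _ (by omega)]
          exact hn _ (by omega)⟩
    -- The points, rays and end objects for `f` and for `x` agree only propositionally; as variables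
    -- they can be substituted.
    have key' : ∀ (y y' : X) (e : y = x.toFun m) (e' : y' = x.toFun (m + 1)) (hy : y ∈ S)
        (hy' : y' ∈ S) (hadj : V.Adj y y') (g g' : CMap V 𝒰) (hg : InSet S g) (hg' : InSet S g')
        (eg : g = fromIdx x m (hxU m)) (eg' : g' = fromIdx x (m + 1) (hxU (m + 1)))
        (ha : src g = T.pt y) (hb : tgt g = tgt x) (ha' : src g' = T.pt y') (hb' : tgt g' = tgt x),
        L.E g hg ha hb = L.step hT hy hy' hadj ≫ L.E g' hg' ha' hb' := by
      rintro y y' rfl rfl hy hy' hadj _ _ hg hg' rfl rfl _ _ _ _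
      exact key
    obtain rfl : tgt x = c := by
      rw [← hb, er m le_rfl, tgt_fromIdx]
    exact key' _ _ (hxf _ le_rfl).symm (hxf _ (by omega)).symm _ _ _ _ _ _ _ (er _ le_rfl _)
      (er _ (by omega) _) _ _ _ _

end Labelling

end RelFundGrpd

/-! ### Transport along a map. -/

namespace RelFundGrpd

open CMap

variable {X : Type u} {V : SemiCoarse X} {𝒰 : Set (Set X)} {S : Set X}
variable {G : Type*} [Groupoid G] {ob : RelFundGrpd V 𝒰 → G} {T : Tether V 𝒰}

/-- Morphisms assigned to the steps between adjacent points and to the rays in members of `𝒰`, in a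
compatible way. -/
structure TransportData (T : Tether V 𝒰) {G : Type*} [Groupoid G] (ob : RelFundGrpd V 𝒰 → G) where
  /-- the morphism assigned to a step -/
  σ : ∀ {x y : X}, V.Adj x y → (ob (T.pt x) ⟶ ob (T.pt y))
  /-- the morphism assigned to the ray `f` on `[m, ∞)` -/
  ρ : ∀ (f : CMap V 𝒰) (m : ℤ), (∀ z ≥ m, f.toFun z ∈ ⋃₀ 𝒰) → ∀ {x : X} {c : RelFundGrpd V 𝒰},
    f.toFun m = x → tgt f = c → (ob (T.pt x) ⟶ ob c)
  σ_trans : ∀ {x y z : X} (hxy : V.Adj x y) (hyz : V.Adj y z) (hxz : V.Adj x z),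
    σ hxy ≫ σ hyz = σ hxz
  ρ_step : ∀ (f : CMap V 𝒰) (m : ℤ) (hm : ∀ z ≥ m, f.toFun z ∈ ⋃₀ 𝒰)
    (hm' : ∀ z ≥ m + 1, f.toFun z ∈ ⋃₀ 𝒰) {x y : X} {c : RelFundGrpd V 𝒰} (hx : f.toFun m = x)
    (hy : f.toFun (m + 1) = y) (hc : tgt f = c) (hxy : V.Adj x y),
    ρ f m hm hx hc = σ hxy ≫ ρ f (m + 1) hm' hy hc
  ρ_tail : ∀ (f g : CMap V 𝒰) (m d : ℤ) (hm : ∀ z ≥ m, f.toFun z ∈ ⋃₀ 𝒰)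
    (hm' : ∀ z ≥ m + d, g.toFun z ∈ ⋃₀ 𝒰) {x : X} {c : RelFundGrpd V 𝒰} (hx : f.toFun m = x)
    (hx' : g.toFun (m + d) = x) (hc : tgt f = c) (hc' : tgt g = c),
    (∀ z ≥ m, f.toFun z = g.toFun (z + d)) → ρ f m hm hx hc = ρ g (m + d) hm' hx' hc'
  ρ_const : ∀ (f : CMap V 𝒰) (m : ℤ) (hm : ∀ z ≥ m, f.toFun z ∈ ⋃₀ 𝒰) {x : X}
    (hx : f.toFun m = x) (hc : tgt f = T.pt x), (∀ z ≥ m, f.toFun z = x) → ρ f m hm hx hc = 𝟙 _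

theorem opp_toFun_neg {f : CMap V 𝒰} {z : ℤ} {x : X} (hx : f.toFun z = x) :
    f.opp.toFun (-z) = x :=
  (congrArg f.toFun (neg_neg z)).trans hx

namespace TransportData

variable (Γ : TransportData T ob) {f g h : CMap V 𝒰} {a b c : RelFundGrpd V 𝒰} {x y : X}

theorem σ_self (h : V.Adj x x) : Γ.σ h = 𝟙 _ := by
  have := Γ.σ_trans h h h
  rwa [← cancel_epi (Γ.σ h), Category.comp_id]

/-- Transport from the index `z` to the right end of `f`, if `f` is in the members of `𝒰` from
`z + k` on. -/
def toEndAux (f : CMap V 𝒰) (hc : tgt f = c) : (k : ℕ) → (z : ℤ) →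
    (∀ w ≥ z + k, f.toFun w ∈ ⋃₀ 𝒰) → {x : X} → f.toFun z = x → (ob (T.pt x) ⟶ ob c)
  | 0, z, h, _, hx => Γ.ρ f z (by simpa using h) hx hc
  | k + 1, z, h, _, hx => Γ.σ (hx ▸ f.born.adj_succ z) ≫
      toEndAux f hc k (z + 1) (fun w hw => h w (by push_cast; omega)) rfl

/-- By `ρ_step` it does not matter where the ray is taken to begin, once `f` is in the members of
`𝒰`. -/
theorem toEndAux_succ (hc : tgt f = c) (k : ℕ) {z : ℤ} (h : ∀ w ≥ z + k, f.toFun w ∈ ⋃₀ 𝒰)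
    (h' : ∀ w ≥ z + (k + 1 : ℕ), f.toFun w ∈ ⋃₀ 𝒰) (hx : f.toFun z = x) :
    Γ.toEndAux f hc (k + 1) z h' hx = Γ.toEndAux f hc k z h hx := by
  induction k generalizing z x with
  | zero => exact (Γ.ρ_step f z _ _ hx rfl hc _).symm
  | succ k ih =>
    rw [toEndAux, ih (fun w hw => h w (by push_cast at hw ⊢; omega))]
    rfl

theorem toEndAux_eq (hc : tgt f = c) {k l : ℕ} {z : ℤ} (h : ∀ w ≥ z + k, f.toFun w ∈ ⋃₀ 𝒰)
    (h' : ∀ w ≥ z + l, f.toFun w ∈ ⋃₀ 𝒰) (hx : f.toFun z = x) :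
    Γ.toEndAux f hc k z h hx = Γ.toEndAux f hc l z h' hx := by
  have : ∀ (d k : ℕ) (h : ∀ w ≥ z + k, f.toFun w ∈ ⋃₀ 𝒰)
      (h' : ∀ w ≥ z + (k + d : ℕ), f.toFun w ∈ ⋃₀ 𝒰),
      Γ.toEndAux f hc (k + d) z h' hx = Γ.toEndAux f hc k z h hx := by
    intro d
    induction d with
    | zero => exact fun _ _ _ => rfl
    | succ d ih =>
      intro k h h'
      have h'' : ∀ w ≥ z + (k + d : ℕ), f.toFun w ∈ ⋃₀ 𝒰 :=
        fun w hw => h w (by push_cast at hw; omega)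
      exact (Γ.toEndAux_succ hc (k + d) h'' h' hx).trans (ih k h h'')
  rcases le_total k l with hkl | hkl
  · obtain ⟨d, rfl⟩ := Nat.exists_eq_add_of_le hkl
    exact (this d k h h').symm
  · obtain ⟨d, rfl⟩ := Nat.exists_eq_add_of_le hkl
    exact this d l h' h

theorem exists_tail_mem (f : CMap V 𝒰) (z : ℤ) : ∃ k : ℕ, ∀ w ≥ z + k, f.toFun w ∈ ⋃₀ 𝒰 := by
  obtain ⟨-, U, hU, n, hn⟩ := f.tails
  exact ⟨(n - z).toNat, fun w hw => ⟨U, hU, hn w (by omega)⟩⟩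

/-- Transport from the index `z` to the right end of `f`. -/
noncomputable def toEnd (f : CMap V 𝒰) (z : ℤ) (hx : f.toFun z = x) (hc : tgt f = c) :
    ob (T.pt x) ⟶ ob c :=
  Γ.toEndAux f hc _ z (exists_tail_mem f z).choose_spec hx

theorem toEnd_step {z : ℤ} (hx : f.toFun z = x) (hy : f.toFun (z + 1) = y) (hc : tgt f = c)
    (hxy : V.Adj x y) : Γ.toEnd f z hx hc = Γ.σ hxy ≫ Γ.toEnd f (z + 1) hy hc := by
  subst hy
  obtain ⟨k, hk⟩ := exists_tail_mem f (z + 1)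
  rw [toEnd, Γ.toEndAux_eq hc _ (l := k + 1) (fun w hw => hk w (by push_cast at hw; omega)),
    toEndAux, toEnd]
  exact congrArg (Γ.σ hxy ≫ ·) (Γ.toEndAux_eq hc hk _ rfl)

theorem toEnd_eq_ρ {z : ℤ} (hm : ∀ w ≥ z, f.toFun w ∈ ⋃₀ 𝒰) (hx : f.toFun z = x)
    (hc : tgt f = c) : Γ.toEnd f z hx hc = Γ.ρ f z hm hx hc := by
  rw [toEnd, Γ.toEndAux_eq hc _ (l := 0) (by simpa using hm)]
  rfl

/-- Up to translation, transport to the right end sees only the values from `z` on: the steps do so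
by definition and the final ray by `ρ_tail`. -/
theorem toEnd_tail {z d : ℤ} {z' : ℤ} (e : z' = z + d) (h : ∀ w ≥ z, f.toFun w = g.toFun (w + d))
    (hx : f.toFun z = x) (hx' : g.toFun z' = x) (hc : tgt f = c) (hc' : tgt g = c) :
    Γ.toEnd f z hx hc = Γ.toEnd g z' hx' hc' := by
  subst e
  obtain ⟨k, hk⟩ := exists_tail_mem f z
  have hk' : ∀ w ≥ z + d + k, g.toFun w ∈ ⋃₀ 𝒰 := fun w hw => by
    have := hk (w - d) (by omega)
    rwa [h _ (by omega), sub_add_cancel] at this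
  rw [toEnd, Γ.toEndAux_eq hc _ hk, toEnd, Γ.toEndAux_eq hc' _ hk']
  induction k generalizing z x with
  | zero => exact Γ.ρ_tail f g z d _ _ hx hx' hc hc' h
  | succ k ih =>
    have e1 : z + d + 1 = z + 1 + d := by ring
    have key : ∀ (z₁ : ℤ) (e : z₁ = z + 1 + d) (y : X) (hy : g.toFun z₁ = y) (hxy : V.Adj x y)
        (hk₁ : ∀ w ≥ z₁ + k, g.toFun w ∈ ⋃₀ 𝒰),
        Γ.toEndAux f hc (k + 1) z hk hx = Γ.σ hxy ≫ Γ.toEndAux g hc' k z₁ hk₁ hy := by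
      rintro _ rfl y hy hxy hk₁
      obtain rfl : f.toFun (z + 1) = y := by rw [h _ (by omega), hy]
      rw [toEndAux, ih (fun w hw => h w (by omega)) rfl hy
        (fun w hw => hk w (by push_cast; omega)) hk₁]
    exact key _ e1 _ rfl _ _

/-- Transport from the index `z` to the left end of `f`. -/
noncomputable def toStart (f : CMap V 𝒰) (z : ℤ) (hx : f.toFun z = x) (ha : src f = a) :
    ob (T.pt x) ⟶ ob a :=
  Γ.toEnd f.opp (-z) (opp_toFun_neg hx) ha

theorem toStart_step {z : ℤ} (hx : f.toFun z = x) (hy : f.toFun (z + 1) = y) (ha : src f = a)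
    (hyx : V.Adj y x) : Γ.toStart f (z + 1) hy ha = Γ.σ hyx ≫ Γ.toStart f z hx ha := by
  have key : ∀ z' (_ : z' = -(z + 1) + 1) (hx : f.opp.toFun z' = x),
      Γ.toEnd f.opp (-(z + 1)) (opp_toFun_neg hy) ha = Γ.σ hyx ≫ Γ.toEnd f.opp z' hx ha := by
    rintro _ rfl hx
    exact Γ.toEnd_step _ hx ha hyx
  exact key _ (by ring) _

theorem toStart_eq_ρ {z : ℤ} (hm : ∀ w ≥ -z, f.opp.toFun w ∈ ⋃₀ 𝒰) (hx : f.toFun z = x)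
    (ha : src f = a) : Γ.toStart f z hx ha = Γ.ρ f.opp (-z) hm (opp_toFun_neg hx) ha :=
  Γ.toEnd_eq_ρ hm _ _

theorem toStart_head {z : ℤ} (h : ∀ w ≤ z, f.toFun w = g.toFun w) (hx : f.toFun z = x)
    (hx' : g.toFun z = x) (ha : src f = a) (ha' : src g = a) :
    Γ.toStart f z hx ha = Γ.toStart g z hx' ha' :=
  Γ.toEnd_tail (d := 0) (by ring) (fun w hw => by
    rw [add_zero]
    exact h (-w) (by omega)) _ _ _ _

theorem toStart_eq_toEnd {z z' : ℤ} (h : ∀ w ≤ z, f.toFun w = g.toFun (-(w - z) + z'))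
    (hx : f.toFun z = x) (hx' : g.toFun z' = x) (ha : src f = a) (ha' : tgt g = a) :
    Γ.toStart f z hx ha = Γ.toEnd g z' hx' ha' :=
  Γ.toEnd_tail (d := z + z') (by ring) (fun w hw => by
    refine (h (-w) (by omega)).trans ?_
    congr 1
    ring) _ _ _ _

theorem toEnd_of_const {z : ℤ} (hx : f.toFun z = x) (hc : tgt f = T.pt x)
    (h : ∀ w ≥ z, f.toFun w = x) : Γ.toEnd f z hx hc = 𝟙 _ := by
  have := mem_of_const_right f h
  rw [Γ.toEnd_eq_ρ (fun w hw => by rwa [h w hw])]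
  exact Γ.ρ_const _ _ _ _ _ h

/-- Transport along `f`, by way of the index `z`. -/
noncomputable def through (f : CMap V 𝒰) (z : ℤ) (hx : f.toFun z = x) (ha : src f = a)
    (hb : tgt f = b) : ob a ⟶ ob b :=
  Groupoid.inv (Γ.toStart f z hx ha) ≫ Γ.toEnd f z hx hb

/-- Moving the cut by one inserts a step and its reverse, which cancel by `σ_trans`. -/
theorem through_succ {z : ℤ} (hx : f.toFun z = x) (hy : f.toFun (z + 1) = y) (ha : src f = a)
    (hb : tgt f = b) : Γ.through f z hx ha hb = Γ.through f (z + 1) hy ha hb := by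
  have hxy : V.Adj x y := hx ▸ hy ▸ f.born.adj_succ z
  rw [through, through, Γ.toStart_step hx hy ha hxy.symm, Γ.toEnd_step hx hy hb hxy]
  simp only [Groupoid.inv_eq_inv, IsIso.inv_comp, Category.assoc]
  congr 1
  rw [← cancel_epi (Γ.σ hxy.symm), IsIso.hom_inv_id_assoc, ← Category.assoc,
    Γ.σ_trans _ _ (Adj.refl V y), σ_self, Category.id_comp]

theorem through_eq {z w : ℤ} (hx : f.toFun z = x) (hy : f.toFun w = y) (ha : src f = a)
    (hb : tgt f = b) : Γ.through f z hx ha hb = Γ.through f w hy ha hb := by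
  have key : ∀ z, Γ.through f z rfl ha hb = Γ.through f 0 rfl ha hb := by
    intro z
    induction z using Int.induction_on with
    | zero => rfl
    | succ z ih => rw [← ih]; exact (Γ.through_succ rfl rfl ha hb).symm
    | pred z ih =>
      rw [← ih]
      refine (Γ.through_succ (y := f.toFun (-z)) rfl (by rw [sub_add_cancel]) ha hb).trans ?_
      have : ∀ w (_ : w = -(z : ℤ)) (hw : f.toFun w = f.toFun (-z)),
          Γ.through f w hw ha hb = Γ.through f (-z) rfl ha hb := by
        rintro _ rfl _
        rfl
      exact this _ (sub_add_cancel _ _) _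
  subst hx hy
  rw [key z, key w]

/-- Transport along `f`. -/
noncomputable def value (f : CMap V 𝒰) (ha : src f = a) (hb : tgt f = b) : ob a ⟶ ob b :=
  Γ.through f 0 rfl ha hb

theorem value_eq (z : ℤ) (hx : f.toFun z = x) (ha : src f = a) (hb : tgt f = b) :
    Γ.value f ha hb = Γ.through f z hx ha hb := Γ.through_eq _ _ _ _

/-- If `f` is cut at 0 and `g` at the mirror index `-N`, the transport to the start of either map is
the transport to the end of the other. -/
theorem value_opp {N : ℤ} (h : ∀ z, f.toFun z = g.toFun (-(z + N))) (ha : src f = a)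
    (hb : tgt f = b) (hb' : src g = b) (ha' : tgt g = a) :
    Γ.value f ha hb ≫ Γ.value g hb' ha' = 𝟙 _ := by
  have hx : g.toFun (-N) = f.toFun 0 := by rw [h, zero_add]
  rw [Γ.value_eq 0 rfl, Γ.value_eq (-N) hx, through, through,
    Γ.toStart_eq_toEnd (g := g) (z' := -N) (fun w _ => (h w).trans (congrArg g.toFun (by ring)))
      rfl hx ha ha',
    Γ.toStart_eq_toEnd (g := f) (z' := 0) (fun w _ => by rw [h]; exact congrArg g.toFun (by ring))
      hx rfl hb' hb]
  simp

/-- All three maps are cut at `j`. There `f` has reached its constant right tail and `g` has not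
left its constant left tail, so these two halves transport trivially. -/
theorem value_merge {x₀ : X} {N M j : ℤ} (h1 : ∀ z ≥ N, f.toFun z = x₀)
    (h2 : ∀ z ≤ M, g.toFun z = x₀) (hN : N ≤ j) (hM : j ≤ M)
    (h3 : ∀ z, h.toFun z = if z ≤ j then f.toFun z else g.toFun z) (ha : src f = a)
    (hb : tgt f = b) (hb' : src g = b) (hc : tgt g = c) (ha' : src h = a) (hc' : tgt h = c) :
    Γ.value h ha' hc' = Γ.value f ha hb ≫ Γ.value g hb' hc := by
  have hx₀ := mem_of_const_right f h1
  obtain rfl : b = T.pt x₀ := by rw [← hb, tgt_eq_pt hx₀ h1, T.pt_of_mem hx₀]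
  have hf : f.toFun j = x₀ := h1 j hN
  have hg : g.toFun j = x₀ := h2 j hM
  have hh : h.toFun j = x₀ := by rw [h3, if_pos le_rfl, hf]
  have e1 : Γ.toEnd f j hf hb = 𝟙 _ :=
    Γ.toEnd_of_const _ _ fun w hw => h1 w (by omega)
  have e2 : Γ.toStart g j hg hb' = 𝟙 _ :=
    Γ.toEnd_of_const _ _ fun w hw => h2 (-w) (by omega)
  have e3 : Γ.toEnd h j hh hc' = Γ.toEnd g j hg hc :=
    Γ.toEnd_tail (d := 0) (by ring) (fun w hw => by
      rw [h3, add_zero]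
      split_ifs with hw'
      · rw [h1 _ (by omega), h2 _ (by omega)]
      · rfl) _ _ _ _
  have e4 : Γ.toStart h j hh ha' = Γ.toStart f j hf ha :=
    Γ.toStart_head (fun w hw => by rw [h3, if_pos hw]) _ _ _ _
  rw [Γ.value_eq j hf, Γ.value_eq j hg, Γ.value_eq j hh, through, through, through, e1, e2, e3, e4]
  simp

/-- Both maps are cut just to the right of the deleted point. What differs is two sides of the
triangle `f n, f (n + 1), f (n + 2)` against the third, and `σ_trans` identifies them. -/
theorem value_del {z₀ : ℤ} (h : ∀ z, g.toFun z = if z < z₀ then f.toFun z else f.toFun (z + 1))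
    (ha : src f = a) (hb : tgt f = b) (ha' : src g = a) (hb' : tgt g = b) :
    Γ.value f ha hb = Γ.value g ha' hb' := by
  obtain ⟨n, rfl⟩ : ∃ n, z₀ = n + 1 := ⟨z₀ - 1, by ring⟩
  have g1 : g.toFun (n + 1) = f.toFun (n + 1 + 1) := by rw [h, if_neg (by omega)]
  have g0 : g.toFun n = f.toFun n := by rw [h, if_pos (by omega)]
  have hyx : V.Adj (f.toFun (n + 1 + 1)) (f.toFun n) := by
    rw [← g1, ← g0]
    exact (g.born.adj_succ n).symm
  have e1 : Γ.toEnd g (n + 1) g1 hb' = Γ.toEnd f (n + 1 + 1) rfl hb :=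
    Γ.toEnd_tail (d := 1) rfl (fun w hw => by rw [h, if_neg (by omega)]) _ _ _ _
  have e2 : Γ.toStart g n g0 ha' = Γ.toStart f n rfl ha :=
    Γ.toStart_head (fun w hw => by rw [h, if_pos (by omega)]) _ _ _ _
  rw [Γ.value_eq (n + 1 + 1) rfl, Γ.value_eq (n + 1) g1, through, through, e1,
    Γ.toStart_step rfl rfl ha (f.born.adj_succ (n + 1)).symm,
    Γ.toStart_step rfl rfl ha (f.born.adj_succ n).symm, Γ.toStart_step g0 g1 ha' hyx, e2,
    ← Category.assoc, Γ.σ_trans _ _ hyx]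

theorem transport_comp_toEnd {n : ℤ} (k : ℕ) (hc : tgt f = c)
    (hadj : ∀ i : ℕ, V.Adj (f.toFun (n + i)) (f.toFun (n + (i + 1 : ℕ)))) :
    transport (o := fun x => ob (T.pt x)) Γ.σ (fun i : ℕ => f.toFun (n + i)) hadj k ≫
      Γ.toEnd f (n + k) rfl hc = Γ.toEnd f (n + (0 : ℕ)) rfl hc := by
  induction k with
  | zero => exact Category.id_comp _
  | succ k ih =>
    rw [← ih, transport, Category.assoc]
    congr 1
    have : ∀ w (_ : w = n + k + 1) (hw : V.Adj (f.toFun (n + k)) (f.toFun w)),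
        Γ.σ hw ≫ Γ.toEnd f w rfl hc = Γ.toEnd f (n + k) rfl hc := by
      rintro _ rfl hw
      exact (Γ.toEnd_step rfl rfl hc hw).symm
    exact this _ (by push_cast; ring) _

end TransportData

/-- The labelling `L` and the transport data `Γ` agree on the steps and the rays in `S`. -/
structure Labelling.Agrees (L : Labelling V 𝒰 S ob) (hT : T.Stays S) (Γ : TransportData T ob) :
    Prop where
  step : ∀ {x y : X} (hx : x ∈ S) (hy : y ∈ S) (h : V.Adj x y), Γ.σ h = L.step hT hx hy h
  ray : ∀ {f : CMap V 𝒰} {m : ℤ} (hm : ∀ z ≥ m, f.toFun z ∈ ⋃₀ 𝒰) {x : X}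
    {c : RelFundGrpd V 𝒰} (hx : f.toFun m = x) (hc : tgt f = c)
    (hS : InSet S (fromIdx f m (hm m le_rfl))) (ha : src (fromIdx f m (hm m le_rfl)) = T.pt x)
    (hb : tgt (fromIdx f m (hm m le_rfl)) = c), Γ.ρ f m hm hx hc = L.E _ hS ha hb

/-- The right cut is made first and the left cut in the truncated map, because the second merge
takes place in the latter. -/
theorem exists_split {f : CMap V 𝒰} (hf : InSet S f) (h : ∃ j, AdmOn V 𝒰 S f.toFun j) :
    ∃ (m : ℤ) (hm : ∀ z ≥ m, f.toFun z ∈ ⋃₀ 𝒰), AdmOn V 𝒰 S f.toFun m ∧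
      ∃ (n : ℤ) (k : ℕ) (_ : n + k = m) (_ : ∀ z ≤ n, f.toFun z ∈ ⋃₀ 𝒰),
        AdmOn V 𝒰 S (upTo f m (hm m le_rfl)).toFun n ∨ k = 0 := by
  obtain ⟨m, hadm, hm⟩ := exists_admOn_right h
  refine ⟨m, hm, hadm, ?_⟩
  let g := upTo f m (hm m le_rfl)
  have hg : InSet S g := fun z => hf _
  have hgc : ∀ z ≥ m, g.toFun z = f.toFun m := fun z hz => upTo_of_ge _ hz
  obtain ⟨j, hj⟩ := exists_tailCondOn V 𝒰 S g.opp.toFun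
  obtain ⟨n, hn, hn'⟩ := exists_admOn_right (f := g.opp) ⟨j, hj, by
    change TailCondOn V 𝒰 S (fun z => g.toFun (- -z)) _
    simpa using tailCondOn_of_const_right hg hgc _⟩
  have hn := hn.opp
  rw [opp_opp] at hn
  rcases le_or_gt (-n) m with hle | hlt
  · refine ⟨-n, (m + n).toNat, by rw [Int.toNat_of_nonneg (by omega)]; ring, fun z hz => ?_, Or.inl hn⟩
    have := hn' (-z) (by omega)
    change g.toFun (- -z) ∈ _ at this
    rwa [neg_neg, upTo_of_le _ (by omega)] at this
  -- The left cut lies beyond the right one, so `f` is in the members of `𝒰` up to `m` as well; both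
  -- cuts are put at `m` and the middle path is empty.
  · refine ⟨m, 0, by simp, fun z hz => ?_, Or.inr rfl⟩
    have := hn' (-z) (by omega)
    change g.toFun (- -z) ∈ _ at this
    rwa [neg_neg, upTo_of_le _ (by omega)] at this

/-- On splittable maps, a labelling is given by transport. -/
theorem Labelling.Agrees.eq_value {L : Labelling V 𝒰 S ob} {hT : T.Stays S}
    {Γ : TransportData T ob} (A : L.Agrees hT Γ) {f : CMap V 𝒰} (hf : InSet S f)
    (h : ∃ j, AdmOn V 𝒰 S f.toFun j) {a b : RelFundGrpd V 𝒰} (ha : src f = a) (hb : tgt f = b) :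
    L.E f hf ha hb = Γ.value f ha hb := by
  obtain ⟨m, hm, hadm, n, k, rfl, hn, hadm'⟩ := exists_split hf h
  have hmm := hm _ le_rfl
  have hnn := hn _ le_rfl
  have hn0 : f.toFun (n + (0 : ℕ)) = f.toFun n := by simp
  let l := upTo f n hnn
  let q := upTo f (n + k) hmm
  let r := fromIdx f (n + k) hmm
  have hqn : q.toFun n ∈ ⋃₀ 𝒰 := by
    rw [upTo_of_le _ (by omega)]
    exact hnn
  let s := fromIdx q n hqn
  have hl : InSet S l := fun z => hf _
  have hq : InSet S q := fun z => hf _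
  have hr : InSet S r := fun z => hf _
  have hs : InSet S s := fun z => hf _
  have sl : src l = a := (src_upTo _).trans ha
  have tl : tgt l = T.pt (f.toFun n) := (tgt_upTo _).trans (T.pt_of_mem hnn).symm
  have sq : src q = a := (src_upTo _).trans ha
  have tq : tgt q = T.pt (f.toFun (n + k)) := (tgt_upTo _).trans (T.pt_of_mem hmm).symm
  have sr : src r = T.pt (f.toFun (n + k)) := (src_fromIdx _).trans (T.pt_of_mem hmm).symm
  have tr : tgt r = b := (tgt_fromIdx _).trans hb
  have s1 : ∀ z ≤ n, s.toFun z = f.toFun n := fun z hz =>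
    (fromIdx_of_ge _ hz).trans (upTo_of_le _ (by omega))
  have ss : src s = T.pt (f.toFun n) :=
    (src_eq_pt hnn s1).trans (T.pt_of_mem hnn).symm
  have ts : tgt s = T.pt (f.toFun (n + k)) := (tgt_fromIdx _).trans tq
  have e1 : L.E f hf ha hb = L.E q hq sq tq ≫ L.E r hr sr tr := by
    refine L.merge _ _ _ _ _ _ _ _ _ _ _ _ (f.toFun (n + k)) (n + k) (n + k) (n + k)
      (fun z hz => upTo_of_ge _ hz) (fun z hz => fromIdx_of_ge _ hz) le_rfl le_rfl
      (fun z => ?_) hadm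
    split_ifs with hz
    · exact (upTo_of_le _ hz).symm
    · exact (fromIdx_of_le _ (by omega)).symm
  have e2 : L.E q hq sq tq = L.E l hl sl tl ≫ L.E s hs ss ts := by
    -- If the middle path is empty, `s` is constant and `q` coincides with `l`, so no second cut is
    -- needed.
    rcases hadm' with hadm' | rfl
    swap
    · have hc : f.toFun n = f.toFun (n + (0 : ℕ)) := hn0.symm
      have key : ∀ (d : RelFundGrpd V 𝒰) (_ : d = T.pt (f.toFun n)) (tl : tgt l = d)
          (ss : src s = d) (ts : tgt s = d) (sl' : src q = a) (tq : tgt q = d),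
          L.E q hq sq tq = L.E l hl sl tl ≫ L.E s hs ss ts := by
        intro d _ tl ss ts _ tq
        rw [L.const (f := s) (x := f.toFun n) (fun z =>
          (congrArg f.toFun (by omega) : f.toFun (min (max z n) (n + (0 : ℕ))) = f.toFun n)) hs ss ts, Category.comp_id]
        exact L.congr (by ext z; exact congrArg f.toFun (by omega)) _ _ _ _ _ _
      have key' : ∀ (x : X) (_ : f.toFun n = x) (ts : tgt s = T.pt x) (tq : tgt q = T.pt x),
          L.E q hq sq tq = L.E l hl sl tl ≫ L.E s hs ss ts := by
        rintro _ rfl ts tq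
        exact key _ rfl _ _ _ sq _
      exact key' _ hc _ _
    refine L.merge _ _ _ _ _ _ _ _ _ _ _ _ (f.toFun n) n n n
      (fun z hz => upTo_of_ge _ hz) s1 le_rfl le_rfl (fun z => ?_) hadm'
    split_ifs with hz
    · exact (upTo_of_le _ (by omega)).trans (upTo_of_le _ hz).symm
    · exact (fromIdx_of_le _ (by omega)).symm
  let γ : ℕ → X := fun i => f.toFun (n + i)
  have hadj : ∀ i, V.Adj (γ i) (γ (i + 1)) := fun i => by
    have := f.born.adj_succ (n + i)
    simpa [γ, add_assoc] using this
  have e3 : L.E s hs (ss.trans (congrArg T.pt hn0.symm)) ts =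
      transport (o := fun x => ob (T.pt x)) Γ.σ γ hadj k := by
    have hT0 : T.list (γ 0) = [γ 0] := T.list_of_mem _ (by simpa [γ] using hnn)
    have hTk : T.list (γ k) = [γ k] := T.list_of_mem _ hmm
    have hb0 : T.base (γ 0) = γ 0 := T.base_of_mem (by simpa [γ] using hnn)
    have hbk : T.base (γ k) = γ k := T.base_of_mem hmm
    have hw1 : Walk V S (γ 0) (γ k) ((List.range (k + 1)).map γ) :=
      walk_map_range hadj (fun i => hf _) k
    have el : (T.list (γ 0)).reverse ++ (List.range k).map γ ++ T.list (γ k) =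
        γ 0 :: (List.range (k + 1)).map γ := by
      rw [hT0, hTk, List.range_succ]
      simp
    have hw : Walk V S (T.base (γ 0)) (T.base (γ k))
        ((T.list (γ 0)).reverse ++ (List.range k).map γ ++ T.list (γ k)) := by
      rw [el, hb0, hbk]
      exact (Walk.single (hf _)).append hw1 (Adj.refl _ _)
    rw [L.transport_eq hT Γ.σ A.step hadj (fun i => hf _) k hw]
    -- The list contains `γ 0` twice at its start, hence the offset `1 - n` and not `-n`.
    refine L.shift (1 - n) (fun z => ?_) _ _ _ _ _ _
    change f.toFun (min (max z n) (n + k)) = pathFun _ hw.ne_nil (z + (1 - n))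
    have hp : ∀ w, pathFun ((List.range (k + 1)).map γ) hw1.ne_nil w =
        f.toFun (n + (min w.toNat k : ℕ)) := by
      intro w
      simp [pathFun, γ]
    have key : ∀ l (e : l = γ 0 :: (List.range (k + 1)).map γ) (hl : l ≠ []),
        pathFun l hl (z + (1 - n)) = f.toFun (n + (min (z - n).toNat k : ℕ)) := by
      rintro _ rfl hl
      rcases lt_or_ge z n with hz | hz
      · have hw2 : Walk V S (γ 0) (γ k) (γ 0 :: (List.range (k + 1)).map γ) :=
          (Walk.single (hf _)).append hw1 (Adj.refl _ _)
        have hz' : z + (1 - n) ≤ 0 := by omega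
        refine (pathFun_of_nonpos hw2 hz').trans ?_
        have : (z - n).toNat = 0 := by omega
        simp [γ, this]
      · rw [pathFun_cons hw1 hl (by omega), hp]
        have : z + (1 - n) - 1 = z - n := by ring
        rw [this]
    rw [key _ el]
    have : min (max z n) (n + k) = n + (min (z - n).toNat k : ℕ) := by omega
    exact congrArg f.toFun this
  have hn' : ∀ w ≥ -n, f.opp.toFun w ∈ ⋃₀ 𝒰 := fun w hw => hn _ (by omega)
  -- Reversed, the left ray is a ray of `f.opp`, which is what `toStart` labels; the relation `opp`
  -- makes the two labels inverse.
  have e4 : L.E l hl sl tl ≫ Γ.toStart f n rfl ha = 𝟙 _ := by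
    have hS : InSet S (fromIdx f.opp (-n) (hn' _ le_rfl)) := fun z => hf _
    have s0 : src (fromIdx f.opp (-n) (hn' _ le_rfl)) = T.pt (f.toFun n) :=
      (src_fromIdx _).trans ((T.pt_of_mem (hn' _ le_rfl)).symm.trans
        (congrArg T.pt (opp_toFun_neg rfl)))
    rw [Γ.toStart_eq_ρ hn', A.ray hn' (opp_toFun_neg rfl) ha hS s0 ((tgt_fromIdx _).trans ha)]
    refine L.opp _ _ _ _ _ _ _ _ 0 fun z => ?_
    change f.toFun (min z n) = f.toFun (-(max (-(z + 0)) (-n)))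
    congr 1
    omega
  have e5 : L.E r hr sr tr = Γ.toEnd f (n + k) rfl hb := by
    rw [Γ.toEnd_eq_ρ hm, A.ray hm rfl hb hr sr tr]
  have e6 : L.E s hs ss ts ≫ Γ.toEnd f (n + k) rfl hb = Γ.toEnd f n rfl hb := by
    have key : ∀ w (_ : f.toFun w = f.toFun n) (ss' : src s = T.pt (f.toFun w)),
        L.E s hs ss' ts ≫ Γ.toEnd f (n + k) rfl hb = Γ.toEnd f w rfl hb →
        w = n → L.E s hs ss ts ≫ Γ.toEnd f (n + k) rfl hb = Γ.toEnd f n rfl hb := by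
      rintro w _ ss' h rfl
      exact h
    refine key (n + (0 : ℕ)) hn0 (ss.trans (congrArg T.pt hn0.symm)) ?_ (by simp)
    rw [e3]
    exact Γ.transport_comp_toEnd k hb hadj
  rw [e1, e2, e5, Category.assoc, e6, Γ.value_eq n rfl, TransportData.through]
  congr 1
  rw [Groupoid.inv_eq_inv]
  exact IsIso.eq_inv_of_inv_hom_id e4

end RelFundGrpd

/-! ### Admissibility under shifts and inside components of `U`. -/

namespace RelFundGrpd

open CMap

variable {X : Type u} {V : SemiCoarse X} {𝒰 : Set (Set X)} {S : Set X} {U C : Set X}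

theorem RayHomotopicOn.precomp_add {f g : ℤ → X} {i j d : ℤ} (h : RayHomotopicOn V 𝒰 S j f g)
    (hd : j ≤ i + d) :
    RayHomotopicOn V 𝒰 S i (fun z => f (z + d)) (fun z => g (z + d)) := by
  let φ : Set.Ici i → Set.Ici j := fun z => ⟨z + d, by
    have : i ≤ (z : ℤ) := z.2
    rw [Set.mem_Ici]
    omega⟩
  have hφ : Bornologous (zOne.sub (Set.Ici i)) (zOne.sub (Set.Ici j)) φ :=
    bornologous_sub ((bornologous_add d).comp (bornologous_val zOne _))
  refine HomotopicThrough.precomp h (φ := φ) hφ ?_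
  rintro u ⟨⟨U, hU, N, hN⟩, hu⟩
  exact ⟨⟨U, hU, N - d, fun z hz => hN _ (by
    change N ≤ (z : ℤ) + d
    omega)⟩, fun z => hu _⟩

theorem tailCondOn_shift {f g : ℤ → X} {d j : ℤ} (h : ∀ z, f z = g (z + d))
    (hg : TailCondOn V 𝒰 S g (j + d)) : TailCondOn V 𝒰 S f j := by
  have hp : ∀ a, PeriodicFrom f a ↔ PeriodicFrom g (a + d) := by
    intro a
    constructor
    · rintro ⟨p, hp0, hp⟩
      refine ⟨p, hp0, fun z hz => ?_⟩
      have := hp (z - d) (by omega)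
      rw [h, h] at this
      convert this using 2 <;> ring
    · rintro ⟨p, hp0, hp⟩
      refine ⟨p, hp0, fun z hz => ?_⟩
      rw [h, h, ← hp (z + d) (by omega)]
      congr 1
      ring
  rintro h1 ⟨k, hk, hk'⟩
  rw [hp] at h1 hk'
  obtain ⟨c, hc⟩ := hg (by convert h1 using 1; ring) ⟨k, hk, by convert hk' using 2; ring⟩
  refine ⟨c, ?_⟩
  have := hc.precomp_add (i := j) (d := d) le_rfl
  rw [funext h]
  exact this

theorem AdmOn.shift {f g : ℤ → X} {d j : ℤ} (h : ∀ z, f z = g (z + d))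
    (hg : AdmOn V 𝒰 S g (j + d)) : AdmOn V 𝒰 S f j := by
  refine ⟨tailCondOn_shift h hg.1, tailCondOn_shift (d := -d) (g := fun z => g (-z))
    (fun z => ?_) ?_⟩
  · rw [h]
    congr 1
    ring
  · have := hg.2
    rwa [neg_add] at this

theorem exists_admOn_of_opp {f g : CMap V 𝒰} {N : ℤ} (h : ∀ z, f.toFun z = g.toFun (-(z + N)))
    (hg : ∃ j, AdmOn V 𝒰 S g.toFun j) : ∃ j, AdmOn V 𝒰 S f.toFun j := by
  obtain ⟨j, hj⟩ := hg
  refine ⟨-j - N, AdmOn.shift (g := g.opp.toFun) (d := N) h ?_⟩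
  rw [sub_add_cancel]
  exact hj.opp

theorem exists_admOn_of_const_right {f : CMap V 𝒰} (hf : InSet S f) {c : X} {N : ℤ}
    (h : ∀ z ≥ N, f.toFun z = c) : ∃ j, AdmOn V 𝒰 S f.toFun j := by
  obtain ⟨j, hj⟩ := exists_tailCondOn V 𝒰 S f.opp.toFun
  refine ⟨-j, tailCondOn_of_const_right hf h _, ?_⟩
  rw [neg_neg]
  exact hj

theorem exists_admOn_of_const_left {f : CMap V 𝒰} (hf : InSet S f) {c : X} {N : ℤ}
    (h : ∀ z ≤ N, f.toFun z = c) : ∃ j, AdmOn V 𝒰 S f.toFun j := by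
  obtain ⟨j, hj⟩ := exists_tailCondOn V 𝒰 S f.toFun
  exact ⟨j, hj, tailCondOn_of_const_left hf h _⟩

theorem mem_of_periodicFrom {f : CMap V 𝒰} {a z : ℤ} (h : PeriodicFrom f.toFun a) (hz : a ≤ z) :
    f.toFun z ∈ ⋃₀ 𝒰 := by
  obtain ⟨-, U, hU, n, hn⟩ := f.tails
  obtain ⟨p, hp0, hp⟩ := h
  obtain ⟨k, hk⟩ := exists_add_mul_le hp0 z n
  exact ⟨U, hU, by rw [← periodic_mul hp0 hp k hz]; exact hn _ hk⟩

/-- A map which is admissible nowhere takes values in the members of `𝒰`. -/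
theorem exists_admOn_or_mem (S : Set X) (f : CMap V 𝒰) :
    (∃ j, AdmOn V 𝒰 S f.toFun j) ∨ ∀ z, f.toFun z ∈ ⋃₀ 𝒰 := by
  by_contra! H
  obtain ⟨H, w, hw⟩ := H
  -- A failing condition forces periodicity, hence values in the members of `𝒰`, on that whole side
  -- from one index before the cut. At the index `w` of a point outside them neither condition can
  -- fail.
  have hR : ∀ j, ¬ TailCondOn V 𝒰 S f.toFun j → w < j - 1 := by
    intro j hj
    by_contra hlt
    unfold TailCondOn at hj
    push Not at hj
    exact hw (mem_of_periodicFrom hj.1 (by omega))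
  have hL : ∀ j, ¬ TailCondOn V 𝒰 S f.opp.toFun (-j) → j + 1 < w := by
    intro j hj
    by_contra hlt
    unfold TailCondOn at hj
    push Not at hj
    refine hw ?_
    have := mem_of_periodicFrom (f := f.opp) (z := -w) hj.1 (by omega)
    change f.toFun (- -w) ∈ _ at this
    rwa [neg_neg] at this
  refine H w ⟨?_, ?_⟩
  · by_contra h
    have := hR w h
    omega
  · by_contra h
    have := hL w h
    omega

/-- The tail of a homotopy takes values in one component of `U`. -/
theorem exists_component_of_rayHomotopic {f g : ℤ → X} {j : ℤ}
    (h : RayHomotopic V {U} j f g) :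
    ∃ C ∈ V.components U, ∃ n ≥ j, RayHomotopicOn V {U} C n f g := by
  obtain ⟨H, hH, ⟨M, N, hMN⟩, hP⟩ := h
  have hP' : ∀ k, ∃ n : ℤ, ∀ z : Set.Ici j, n ≤ z → H (z, k) ∈ U := by
    intro k
    obtain ⟨_, rfl, n, hn⟩ := hP k
    exact ⟨n, hn⟩
  choose n hn using hP'
  -- Outside `[M, max M N]` every stage is `f` or `g`, so only finitely many stages matter and one
  -- index serves them all.
  obtain ⟨n₀, hn₀⟩ := ((Set.finite_Icc M (max M N)).image n).bddAbove
  let m := max j n₀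
  have hm : j ≤ m := le_max_left _ _
  have hHU : ∀ (z : Set.Ici j) k, m ≤ z → H (z, k) ∈ U := by
    intro z k hz
    rcases le_or_gt k M with hk | hk
    · rw [(hMN z).1 k hk, ← (hMN z).1 M le_rfl]
      have : n M ≤ n₀ := hn₀ ⟨M, by simp, rfl⟩
      exact hn _ _ (by omega)
    rcases le_or_gt k (max M N) with hk' | hk'
    · have : n k ≤ n₀ := hn₀ ⟨k, ⟨hk.le, hk'⟩, rfl⟩
      exact hn _ _ (by omega)
    · rw [(hMN z).2 k (by omega), ← (hMN z).2 (max M N) (by omega)]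
      have : n (max M N) ≤ n₀ := hn₀ ⟨_, by simp, rfl⟩
      exact hn _ _ (by omega)
  have hadj : ∀ (z w : Set.Ici j) (k l : ℤ), |(w : ℤ) - z| ≤ 1 → |l - k| ≤ 1 →
      V.Adj (H (z, k)) (H (w, l)) := by
    intro z w k l h1 h2
    refine hH.adj ⟨{(z, w)}, sub_adj.2 (zOne_adj.2 h1), {(k, l)}, zOne_adj.2 h2, ?_⟩
    rintro _ rfl
    exact ⟨rfl, rfl⟩
  obtain ⟨C, hC, h0⟩ := exists_component (V := V) (hHU ⟨m, hm⟩ 0 le_rfl)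
  have h1 : ∀ z (hz : m ≤ z), H (⟨z, hm.trans hz⟩, 0) ∈ C := by
    intro z hz
    induction z, hz using Int.leInduction with
    | base => exact h0
    | succ z hz ih =>
      exact mem_component hC ih (hHU _ _ (by change m ≤ z + 1; omega))
        (hadj _ _ _ _ (by simp) (by simp))
  have h2 : ∀ z (hz : m ≤ z) k, H (⟨z, hm.trans hz⟩, k) ∈ C := by
    intro z hz k
    induction k using Int.induction_on with
    | zero => exact h1 z hz
    | succ k ih => exact mem_component hC ih (hHU _ _ hz) (hadj _ _ _ _ (by simp) (by simp))
    | pred k ih => exact mem_component hC ih (hHU _ _ hz) (hadj _ _ _ _ (by simp)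
        (abs_le.2 ⟨by omega, by omega⟩))
  let φ : Set.Ici m → Set.Ici j := fun z => ⟨z, hm.trans z.2⟩
  have hφ : Bornologous (zOne.sub (Set.Ici m)) (zOne.sub (Set.Ici j)) φ :=
    bornologous_sub (bornologous_val zOne _)
  exact ⟨C, hC, m, hm, H ∘ Prod.map φ (fun z => z), hH.comp (hφ.prodMap (bornologous_id _)),
    ⟨M, N, fun s => hMN (φ s)⟩, fun k => ⟨⟨U, rfl, m, fun z _ => hHU _ _ z.2⟩, fun z => h2 z z.2 k⟩⟩

theorem RayHomotopicOn.mono {S' : Set X} {f g : ℤ → X} {j : ℤ} (h : RayHomotopicOn V 𝒰 S j f g)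
    (hS : S ⊆ S') : RayHomotopicOn V 𝒰 S' j f g := by
  obtain ⟨H, hH, hMN, hP⟩ := h
  exact ⟨H, hH, hMN, fun k => ⟨(hP k).1, fun z => hS ((hP k).2 z)⟩⟩

theorem eq_of_mem_components {C C' : Set X} (hC : C ∈ V.components U) (hC' : C' ∈ V.components U)
    {x : X} (hx : x ∈ C) (hx' : x ∈ C') : C = C' := by
  have key : ∀ C ∈ V.components U, x ∈ C →
      C = {y | ∃ (hx : x ∈ U) (hy : y ∈ U), (V.sub U).Joined ⟨x, hx⟩ ⟨y, hy⟩} := by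
    rintro _ ⟨x₀, rfl⟩ ⟨x, h, rfl⟩
    simp only [Set.mem_ofPred_eq, joined_iff] at h
    ext y
    simp only [Set.mem_image, Set.mem_ofPred_eq, joined_iff]
    constructor
    · rintro ⟨y, hy, rfl⟩
      refine ⟨x.2, y.2, (Relation.ReflTransGen.mono (fun _ _ h => Adj.symm h) _ _
        (Relation.ReflTransGen.swap _ _ h)).trans hy⟩
    · rintro ⟨hx, hy, hxy⟩
      exact ⟨⟨y, hy⟩, h.trans hxy, rfl⟩
  rw [key C hC hx, key C' hC' hx']

/-- For a map with values in a component of `U`, null homotopies of periodic tails may be chosen in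
this component. -/
theorem TailCondOn.of_component {g : ℤ → X} {j : ℤ} (h : TailCondOn V {U} Set.univ g j)
    (hC : C ∈ V.components U) (hg : ∀ z, g z ∈ C) (hS : C ⊆ S) : TailCondOn V {U} S g j := by
  intro hp hk
  obtain ⟨c, hc⟩ := h hp hk
  have hc : RayHomotopic V {U} j g (fun _ => c) := by simpa [RayHomotopicOn, RayHomotopic] using hc
  refine ⟨c, ?_⟩
  obtain ⟨C', hC', n, hn, hH⟩ := exists_component_of_rayHomotopic hc
  have hgC' : g n ∈ C' := by
    obtain ⟨H, -, ⟨M, N, hMN⟩, hP⟩ := hH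
    have := (hP M).2 ⟨n, Set.mem_Ici.2 le_rfl⟩
    dsimp only at this
    rwa [(hMN _).1 M le_rfl] at this
  -- The homotopy starts at `g`, so its component is `C`. It exists only from `n` on, and is brought
  -- back to `j` by a translation by a multiple of the period.
  obtain rfl := eq_of_mem_components hC hC' (hg n) hgC'
  obtain ⟨p, hp0, hp⟩ := hp
  obtain ⟨k, hk⟩ := exists_add_mul_le hp0 j n
  have := hH.precomp_add (i := j) (d := k * p) hk
  have e : (fun z : Set.Ici j => g (z + k * p)) = fun z : Set.Ici j => g z := by
    funext z
    have : j ≤ (z : ℤ) := z.2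
    exact periodic_mul hp0 hp k (by omega)
  have := this.mono hS
  unfold RayHomotopicOn at this ⊢
  rwa [e] at this

theorem AdmOn.of_component {g : ℤ → X} {j : ℤ} (h : AdmOn V {U} Set.univ g j)
    (hC : C ∈ V.components U) (hg : ∀ z, g z ∈ C) (hS : C ⊆ S) : AdmOn V {U} S g j :=
  ⟨h.1.of_component hC hg hS, h.2.of_component hC (fun _ => hg _) hS⟩

end RelFundGrpd

/-! ### Extending steps across a well-split space. -/

namespace SemiCoarse

variable {X : Type u} {V : SemiCoarse X} {A B : Set X}

/-- Pigeonhole: two of the three points lie in the same member of the cover. -/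
theorem glue_adj_of_three {h : A ∪ B = Set.univ} {x y z : X} (hxy : V.Adj x y) (hyz : V.Adj y z)
    (hxz : V.Adj x z) : (V.glue A B h).Adj x y ∨ (V.glue A B h).Adj y z ∨ (V.glue A B h).Adj x z := by
  have hx : x ∈ A ∪ B := h ▸ Set.mem_univ x
  have hy : y ∈ A ∪ B := h ▸ Set.mem_univ y
  have hz : z ∈ A ∪ B := h ▸ Set.mem_univ z
  simp only [glue_adj, hxy, hyz, hxz, true_and]
  simp only [Set.mem_union] at hx hy hz
  tauto

/-- In a well-split space, three pairwise adjacent points have a common neighbour in the pushout. -/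
theorem WellSplit.exists_common {h : A ∪ B = Set.univ} (hs : V.WellSplit A B) {x y z : X}
    (hxy : V.Adj x y) (hyz : V.Adj y z) (hxz : V.Adj x z) :
    ∃ m, (V.glue A B h).Adj x m ∧ (V.glue A B h).Adj y m ∧ (V.glue A B h).Adj z m := by
  obtain ⟨-, -, h', hs⟩ := hs
  have key : ∀ {x y z : X}, V.Adj x y → V.Adj x z → (V.glue A B h).Adj y z →
      ∃ m, (V.glue A B h).Adj x m ∧ (V.glue A B h).Adj y m ∧ (V.glue A B h).Adj z m := by
    intro x y z hxy hxz hyz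
    -- If both pairs are controlled in the pushout, `x` itself is a common neighbour; otherwise
    -- condition (1) of well-splitting provides one.
    by_cases H : {(x, y), (x, z)} ∈ (V.glue A B h).sets
    · rw [pair_mem_sets] at H
      exact ⟨x, Adj.refl _ _, H.1.symm, H.2.symm⟩
    · obtain ⟨m, h1, h2⟩ := (hs x y z (pair_mem_sets.2 ⟨hxy, hxz⟩) H hyz).1
      rw [shortPath_iff] at h1 h2
      exact ⟨m, h1.1, h1.2.symm, h2.2.symm⟩
  rcases glue_adj_of_three (h := h) hxy hyz hxz with H | H | H
  · obtain ⟨m, h1, h2, h3⟩ := key hxz.symm hyz.symm H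
    exact ⟨m, h2, h3, h1⟩
  · exact key hxy hxz H
  · obtain ⟨m, h1, h2, h3⟩ := key hxy.symm hyz H
    exact ⟨m, h2, h1, h3⟩

/-- The common neighbours of two adjacent points which are not adjacent in the pushout are joined by
paths of such points in the pushout. -/
theorem WellSplit.joined_common {h : A ∪ B = Set.univ} (hs : V.WellSplit A B) {x y m m' : X}
    (hxy : V.Adj x y) (hn : ¬ (V.glue A B h).Adj x y) (h1 : (V.glue A B h).Adj x m)
    (h2 : (V.glue A B h).Adj m y) (h3 : (V.glue A B h).Adj x m') (h4 : (V.glue A B h).Adj m' y) :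
    Relation.ReflTransGen (fun u v => (V.glue A B h).Adj u v ∧
      ((V.glue A B h).Adj x u ∧ (V.glue A B h).Adj u y)) m m' := by
  obtain ⟨-, -, h', hs⟩ := hs
  have := (hs x y y (pair_mem_sets.2 ⟨hxy, hxy⟩) (fun H => hn (pair_mem_sets.1 H).1)
    (Adj.refl _ _)).2 ⟨m, shortPath_iff.2 ⟨h1, h2⟩⟩ ⟨m', shortPath_iff.2 ⟨h3, h4⟩⟩
  rw [joined_iff] at this
  refine Relation.ReflTransGen.lift Subtype.val ?_ _ _ this
  rintro ⟨u, hu⟩ ⟨v, hv⟩ huv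
  have hu := shortPath_iff.1 hu
  have hv := shortPath_iff.1 hv
  -- Since `x` and `y` share no member, all their common neighbours lie in `A ∩ B`; there adjacency
  -- in `X`, which is what condition (2) speaks of, is adjacency in the pushout.
  refine ⟨?_, hu⟩
  rw [sub_adj] at huv
  rw [glue_adj] at hn hu hv ⊢
  rw [glue_adj] at hu hv
  have hx : x ∈ A ∪ B := h ▸ Set.mem_univ x
  have hy : y ∈ A ∪ B := h ▸ Set.mem_univ y
  simp only [Set.mem_union] at hx hy
  simp only at huv ⊢
  tauto

section extend

variable {h : A ∪ B = Set.univ} (hs : V.WellSplit A B) {G : Type*} [Category G] {o : X → G}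
  (st : ∀ {x y : X}, (V.glue A B h).Adj x y → (o x ⟶ o y))

/-- The extension to `X` of an assignment of morphisms to the steps in the pushout. -/
noncomputable def WellSplit.extend {x y : X} (hxy : V.Adj x y) : o x ⟶ o y :=
  have H := hs.exists_common (h := h) hxy (Adj.refl V y) hxy
  st H.choose_spec.1 ≫ st H.choose_spec.2.1.symm

variable (st_trans : ∀ {x y z : X} (hxy : (V.glue A B h).Adj x y) (hyz : (V.glue A B h).Adj y z)
    (hxz : (V.glue A B h).Adj x z), st hxy ≫ st hyz = st hxz)

include hs st_trans

/-- Passing from one common neighbour to an adjacent one changes the product by two triangles that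
share the new edge, so it stays constant along a path of common neighbours. -/
theorem WellSplit.comp_eq {x y m m' : X} (hxy : V.Adj x y) (h1 : (V.glue A B h).Adj x m)
    (h2 : (V.glue A B h).Adj m y) (h3 : (V.glue A B h).Adj x m') (h4 : (V.glue A B h).Adj m' y) :
    st h1 ≫ st h2 = st h3 ≫ st h4 := by
  by_cases H : (V.glue A B h).Adj x y
  · rw [st_trans _ _ H, st_trans _ _ H]
  · have := hs.joined_common hxy H h1 h2 h3 h4
    induction this with
    | refl => rfl
    | @tail u v _ huv ih =>
      obtain ⟨huv, hxu, huy⟩ := huv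
      rw [ih hxu huy, ← st_trans hxu huv h3, Category.assoc, st_trans huv h4 huy]

theorem WellSplit.extend_eq {x y m : X} (hxy : V.Adj x y) (h1 : (V.glue A B h).Adj x m)
    (h2 : (V.glue A B h).Adj m y) : hs.extend st hxy = st h1 ≫ st h2 :=
  hs.comp_eq st st_trans hxy _ _ _ _

/-- All three sides factor through one common neighbour `m` of the corners, and the inner steps
cancel. -/
theorem WellSplit.extend_trans {x y z : X} (hxy : V.Adj x y) (hyz : V.Adj y z)
    (hxz : V.Adj x z) : hs.extend st hxy ≫ hs.extend st hyz = hs.extend st hxz := by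
  obtain ⟨m, h1, h2, h3⟩ := hs.exists_common (h := h) hxy hyz hxz
  rw [hs.extend_eq st st_trans hxy h1 h2.symm, hs.extend_eq st st_trans hyz h2 h3.symm,
    hs.extend_eq st st_trans hxz h1 h3.symm, Category.assoc, ← Category.assoc (st h2.symm),
    st_trans h2.symm h2 (Adj.refl _ _), st_trans (Adj.refl _ m) h3.symm h3.symm]

end extend

end SemiCoarse

/-! ### Gluing the labellings of the members of the cover. -/

namespace RelFundGrpd

open CMap

variable {X : Type u} {V : SemiCoarse X} {U : Set X}

/-- A well-splitting cover which contains the components of `U`, and a tether which stays in its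
members. -/
structure SplitCover (V : SemiCoarse X) (U : Set X) where
  /-- the cover -/
  S : Bool → Set X
  /-- the tether -/
  T : Tether V {U}
  cover : S true ∪ S false = Set.univ
  split : V.WellSplit (S true) (S false)
  sub : ∀ C ∈ V.components U, ∃ i, C ⊆ S i
  stays : ∀ i, T.Stays (S i)

/-- Labellings of the maps with values in the members of a cover, which agree on the common maps. -/
structure Gluing (V : SemiCoarse X) (U : Set X) {G : Type*} [Groupoid G]
    (ob : RelFundGrpd V {U} → G) extends SplitCover V U where
  /-- the labellings -/
  L : ∀ i, Labelling V {U} (S i) ob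
  agree : ∀ {i j : Bool} {f : CMap V {U}} (hi : InSet (S i) f) (hj : InSet (S j) f)
    {a b : RelFundGrpd V {U}} (ha : src f = a) (hb : tgt f = b),
    (L i).E f hi ha hb = (L j).E f hj ha hb

namespace Gluing

variable {G : Type*} [Groupoid G] {ob : RelFundGrpd V {U} → G} (D : Gluing V U ob)

/-- The pushout structure. -/
abbrev W : SemiCoarse X := V.glue (D.S true) (D.S false) D.cover

variable {D}

theorem adj_iff {x y : X} : D.W.Adj x y ↔ V.Adj x y ∧ ∃ i, x ∈ D.S i ∧ y ∈ D.S i := by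
  rw [glue_adj, Bool.exists_bool, or_comm]

theorem step_eq_step {i j : Bool} {x y : X} (hx : x ∈ D.S i) (hy : y ∈ D.S i) (hx' : x ∈ D.S j)
    (hy' : y ∈ D.S j) (h : V.Adj x y) :
    (D.L i).step (D.stays i) hx hy h = (D.L j).step (D.stays j) hx' hy' h :=
  D.agree _ _ _ _

variable (D)

/-- The morphism assigned to a step in the pushout. -/
noncomputable def st {x y : X} (h : D.W.Adj x y) : ob (D.T.pt x) ⟶ ob (D.T.pt y) :=
  (D.L _).step (D.stays _) (adj_iff.1 h).2.choose_spec.1 (adj_iff.1 h).2.choose_spec.2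
    (adj_iff.1 h).1

theorem st_eq {i : Bool} {x y : X} (h : D.W.Adj x y) (hx : x ∈ D.S i) (hy : y ∈ D.S i) :
    D.st h = (D.L i).step (D.stays i) hx hy (adj_iff.1 h).1 :=
  step_eq_step _ _ _ _ _

/-- Each side of the triangle lies in one of two members, so two sides share a member, and two sides
contain all the corners. -/
theorem st_trans {x y z : X} (hxy : D.W.Adj x y) (hyz : D.W.Adj y z) (hxz : D.W.Adj x z) :
    D.st hxy ≫ D.st hyz = D.st hxz := by
  obtain ⟨i, hx, hy, hz⟩ : ∃ i, x ∈ D.S i ∧ y ∈ D.S i ∧ z ∈ D.S i := by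
    have h1 := (adj_iff.1 hxy).2
    have h2 := (adj_iff.1 hyz).2
    have h3 := (adj_iff.1 hxz).2
    simp only [Bool.exists_bool] at h1 h2 h3 ⊢
    tauto
  rw [D.st_eq hxy hx hy, D.st_eq hyz hy hz, D.st_eq hxz hx hz]
  exact (D.L i).step_trans _ _ _ _ _ _ _

theorem exists_line {f : CMap V {U}} (h : ∀ z, f.toFun z ∈ ⋃₀ {U}) :
    ∃ C ∈ V.components U, (∀ z, f.toFun z ∈ C) ∧ ∃ i, C ⊆ D.S i := by
  rw [Set.sUnion_singleton] at h
  obtain ⟨C, hC, hf⟩ := exists_component_line (fun z => f.born.adj_succ z) h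
  exact ⟨C, hC, hf, D.sub C hC⟩

/-- A ray in `U` cannot leave its component, and each component is contained in a member; so rays
never have to be subdivided between `A` and `B`. -/
theorem exists_ray {f : CMap V {U}} {m : ℤ} (h : ∀ z ≥ m, f.toFun z ∈ ⋃₀ {U}) :
    ∃ i, ∀ z ≥ m, f.toFun z ∈ D.S i := by
  rw [Set.sUnion_singleton] at h
  obtain ⟨C, hC, hf⟩ := exists_component_ray (fun z => f.born.adj_succ z) h
  obtain ⟨i, hi⟩ := D.sub C hC
  exact ⟨i, fun z hz => hi (hf z hz)⟩

theorem src_fromIdx_eq {f : CMap V {U}} {m : ℤ} (h : f.toFun m ∈ ⋃₀ {U}) {x : X}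
    (hx : f.toFun m = x) : src (fromIdx f m h) = D.T.pt x :=
  (src_fromIdx _).trans ((D.T.pt_of_mem h).symm.trans (congrArg D.T.pt hx))

/-- The morphism assigned to a ray. -/
noncomputable def ray (f : CMap V {U}) (m : ℤ) (h : ∀ z ≥ m, f.toFun z ∈ ⋃₀ {U}) {x : X}
    {c : RelFundGrpd V {U}} (hx : f.toFun m = x) (hc : tgt f = c) : ob (D.T.pt x) ⟶ ob c :=
  (D.L _).E (fromIdx f m (h m le_rfl)) (inSet_fromIdx _ (D.exists_ray h).choose_spec)
    (D.src_fromIdx_eq _ hx) ((tgt_fromIdx _).trans hc)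

theorem ray_eq {f : CMap V {U}} {m : ℤ} (h : ∀ z ≥ m, f.toFun z ∈ ⋃₀ {U}) {x : X}
    {c : RelFundGrpd V {U}} (hx : f.toFun m = x) (hc : tgt f = c) {i : Bool}
    (hS : InSet (D.S i) (fromIdx f m (h m le_rfl))) (ha : src (fromIdx f m (h m le_rfl)) = D.T.pt x)
    (hb : tgt (fromIdx f m (h m le_rfl)) = c) :
    D.ray f m h hx hc = (D.L i).E _ hS ha hb :=
  D.agree _ _ _ _

theorem extend_eq_step {i : Bool} {x y : X} (hx : x ∈ D.S i) (hy : y ∈ D.S i) (h : V.Adj x y) :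
    D.split.extend D.st h = (D.L i).step (D.stays i) hx hy h := by
  have hW : D.W.Adj x y := adj_iff.2 ⟨h, i, hx, hy⟩
  rw [D.split.extend_eq D.st D.st_trans h (Adj.refl _ _) hW, D.st_trans _ _ hW, D.st_eq hW hx hy]

/-- The transport data defined by a gluing. -/
noncomputable def data : TransportData D.T ob where
  σ := D.split.extend D.st
  ρ := D.ray
  σ_trans := D.split.extend_trans D.st D.st_trans
  ρ_step := by
    rintro f m hm hm' x y c rfl rfl hc hxy
    obtain ⟨i, hi⟩ := D.exists_ray hm
    have hi' : ∀ z ≥ m + 1, f.toFun z ∈ D.S i := fun z hz => hi z (by omega)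
    have hb := (tgt_fromIdx (hm m le_rfl)).trans hc
    have hb' := (tgt_fromIdx (hm' _ le_rfl)).trans hc
    rw [D.extend_eq_step (hi m le_rfl) (hi' _ le_rfl),
      D.ray_eq hm rfl hc (inSet_fromIdx _ hi) (D.src_fromIdx_eq _ rfl) hb,
      D.ray_eq hm' rfl hc (inSet_fromIdx _ hi') (D.src_fromIdx_eq _ rfl) hb']
    exact (D.L i).ray_step (D.stays i) hm hi (hm' _ le_rfl) (hi' _ le_rfl) _ _ _ _ _ _
  ρ_tail := by
    intro f g m d hm hm' x c hx hx' hc hc' h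
    obtain ⟨i, hi⟩ := D.exists_ray hm
    have hi' : ∀ z ≥ m + d, g.toFun z ∈ D.S i := fun z hz => by
      have := hi (z - d) (by omega)
      rwa [h _ (by omega), sub_add_cancel] at this
    rw [D.ray_eq hm hx hc (inSet_fromIdx _ hi) (D.src_fromIdx_eq _ hx) ((tgt_fromIdx _).trans hc),
      D.ray_eq hm' hx' hc' (inSet_fromIdx _ hi') (D.src_fromIdx_eq _ hx')
        ((tgt_fromIdx _).trans hc')]
    refine (D.L i).shift d (fun z => ?_) _ _ _ _ _ _
    change f.toFun (max z m) = g.toFun (max (z + d) (m + d))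
    rw [h _ (le_max_right _ _)]
    congr 1
    omega
  ρ_const := by
    intro f m hm x hx hc h
    obtain ⟨i, hi⟩ := D.exists_ray hm
    rw [D.ray_eq hm hx hc (inSet_fromIdx _ hi) (D.src_fromIdx_eq _ hx) ((tgt_fromIdx _).trans hc)]
    exact (D.L i).const (f := fromIdx f m _) (fun z => h (max z m) (le_max_right _ _)) _ _ _

theorem agrees (i : Bool) : (D.L i).Agrees (D.stays i) D.data where
  step hx hy h := D.extend_eq_step hx hy h
  ray hm _ _ hx hc hS ha hb := D.ray_eq hm hx hc hS ha hb

open Classical in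
/-- The morphism assigned to a map. -/
noncomputable def val {a b : RelFundGrpd V {U}} (f : CMap V {U}) (ha : src f = a)
    (hb : tgt f = b) : ob a ⟶ ob b :=
  if h : ∃ j, AdmOn V {U} Set.univ f.toFun j then D.data.value f ha hb
  else
    have H := D.exists_line ((exists_admOn_or_mem _ f).resolve_left h)
    (D.L H.choose_spec.2.2.choose).E f
      (fun z => H.choose_spec.2.2.choose_spec (H.choose_spec.2.1 z)) ha hb

variable {D} {f g h : CMap V {U}} {a b c : RelFundGrpd V {U}}

theorem val_of_exists (h : ∃ j, AdmOn V {U} Set.univ f.toFun j) (ha : src f = a) (hb : tgt f = b) :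
    D.val f ha hb = D.data.value f ha hb := dif_pos h

theorem val_of_not_exists (h : ¬ ∃ j, AdmOn V {U} Set.univ f.toFun j) (ha : src f = a)
    (hb : tgt f = b) {i : Bool} (hf : InSet (D.S i) f) : D.val f ha hb = (D.L i).E f hf ha hb := by
  rw [val, dif_neg h]
  exact D.agree _ _ _ _

/-- If `f` can be cut with null homotopies in `S i`, its label there is transport. If it cannot, `f`
lies in one component of `U`; the labels may then be compared in a member containing that component,
where null homotopies of `X` can be moved. -/
theorem val_eq {i : Bool} (hf : InSet (D.S i) f) (ha : src f = a) (hb : tgt f = b) :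
    D.val f ha hb = (D.L i).E f hf ha hb := by
  by_cases h : ∃ j, AdmOn V {U} Set.univ f.toFun j
  · rw [val_of_exists h]
    rcases exists_admOn_or_mem (D.S i) f with h' | h'
    · exact ((D.agrees i).eq_value hf h' ha hb).symm
    · obtain ⟨C, hC, hfC, j, hj⟩ := D.exists_line h'
      obtain ⟨k, hk⟩ := h
      have hfj : InSet (D.S j) f := fun z => hj (hfC z)
      rw [D.agree hf hfj]
      exact ((D.agrees j).eq_value hfj ⟨k, hk.of_component hC hfC hj⟩ ha hb).symm
  · exact val_of_not_exists h _ _ hf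

variable (D)

/-- The glued labelling of all maps. -/
noncomputable def glued : Labelling V {U} Set.univ ob where
  E f _ ha hb := D.val f ha hb
  opp := by
    intro a b f g _ _ ha hb hb' ha' N h
    have h' : ∀ z, g.toFun z = f.toFun (-(z + N)) := fun z => by
      rw [h]
      congr 1
      ring
    by_cases hf : ∃ j, AdmOn V {U} Set.univ f.toFun j
    · rw [val_of_exists hf, val_of_exists (exists_admOn_of_opp h' hf)]
      exact D.data.value_opp h _ _ _ _
    · obtain ⟨C, -, hfC, i, hi⟩ := D.exists_line ((exists_admOn_or_mem _ f).resolve_left hf)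
      have hfi : InSet (D.S i) f := fun z => hi (hfC z)
      have hgi : InSet (D.S i) g := fun z => by
        rw [h']
        exact hfi _
      rw [val_eq hfi, val_eq hgi]
      exact (D.L i).opp f g _ _ _ _ _ _ N h
  merge := by
    intro a b c f g h _ _ _ ha hb hb' hc ha' hc' x₀ N M j h1 h2 h3 h4 h5 h6
    -- A constant tail makes each factor admissible somewhere, so all three maps are evaluated by
    -- transport.
    rw [val_of_exists ⟨j, h6⟩, val_of_exists (exists_admOn_of_const_right (fun _ => trivial) h1),
      val_of_exists (exists_admOn_of_const_left (fun _ => trivial) h2)]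
    exact D.data.value_merge h1 h2 h3 h4 h5 _ _ _ _ _ _
  del := by
    intro a b f g _ _ ha hb ha' hb' z₀ h hadm
    by_cases hf : ∃ j, AdmOn V {U} Set.univ f.toFun j
    · rw [val_of_exists hf, val_of_exists ⟨_, hadm⟩]
      exact D.data.value_del h _ _ _ _
    -- A map without admissible index lies in one component, and deleting a point keeps it there.
    -- The relation then comes from the member, after the null homotopies have been moved into the
    -- component.
    · obtain ⟨C, hC, hfC, i, hi⟩ := D.exists_line ((exists_admOn_or_mem _ f).resolve_left hf)
      have hgC : ∀ z, g.toFun z ∈ C := fun z => by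
        rw [h]
        split_ifs <;> exact hfC _
      have hfi : InSet (D.S i) f := fun z => hi (hfC z)
      have hgi : InSet (D.S i) g := fun z => hi (hgC z)
      rw [val_eq hfi, val_eq hgi]
      exact (D.L i).del f g _ _ _ _ _ _ z₀ h (hadm.of_component hC hgC hi)

theorem glued_E {i : Bool} (hf : InSet (D.S i) f) (hf' : InSet Set.univ f) (ha : src f = a)
    (hb : tgt f = b) : D.glued.E f hf' ha hb = (D.L i).E f hf ha hb :=
  val_eq hf ha hb

/-- A labelling of all maps is determined by its restrictions. -/
theorem eq_glued (L : Labelling V {U} Set.univ ob)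
    (hL : ∀ {i : Bool} {f : CMap V {U}} (hf : InSet (D.S i) f) {a b : RelFundGrpd V {U}}
      (ha : src f = a) (hb : tgt f = b),
      L.E f (fun _ => trivial) ha hb = (D.L i).E f hf ha hb)
    (hf : InSet Set.univ f) (ha : src f = a) (hb : tgt f = b) :
    L.E f hf ha hb = D.glued.E f hf ha hb := by
  have hst : ∀ {x y : X} (h : D.W.Adj x y),
      D.st h = L.step Tether.stays_univ trivial trivial (adj_iff.1 h).1 := fun h => (hL _ _ _).symm
  have A : L.Agrees Tether.stays_univ D.data :=
    { step := fun {x y} hx hy h => by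
        -- Every step of `X` is a product of two steps of the pushout, on which `L` is prescribed.
        obtain ⟨m, h1, h2, -⟩ := D.split.exists_common (h := D.cover) h (Adj.refl V y) h
        refine (D.split.extend_eq D.st D.st_trans h h1 h2.symm).trans ?_
        rw [hst, hst]
        exact L.step_trans _ _ _ _ _ _ _
      ray := fun {f m} hm x c hx hc hS ha hb => by
        obtain ⟨i, hi⟩ := D.exists_ray hm
        exact (D.ray_eq hm hx hc (inSet_fromIdx _ hi) ha hb).trans (hL _ _ _).symm }
  by_cases h : ∃ j, AdmOn V {U} Set.univ f.toFun j
  · exact (A.eq_value hf h ha hb).trans (val_of_exists h ha hb).symm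
  · obtain ⟨C, -, hfC, i, hi⟩ := D.exists_line ((exists_admOn_or_mem _ f).resolve_left h)
    have hfi : InSet (D.S i) f := fun z => hi (hfC z)
    rw [D.glued_E hfi]
    exact hL hfi ha hb

end Gluing

end RelFundGrpd

/-! ### From functors on a subspace to labellings. -/

namespace RelFundGrpd

open CMap

variable {X : Type u} {V : SemiCoarse X} {U S : Set X}

/-- The inclusion of the subspace `S`. -/
def valIncl (V : SemiCoarse X) (U S : Set X) :
    Incl (V.sub S) (trace (V.components U) S) V {U} where
  toFun := Subtype.val
  inj := Subtype.val_injective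
  born := bornologous_val V S
  mapsTo := by
    rintro _ ⟨C, hC, rfl⟩
    exact ⟨U, rfl, fun x hx => subset_of_mem_components V hC hx⟩

theorem exists_trace_of_ray {f : ℤ → S} (hf : ∀ z, V.Adj (f z) (f (z + 1))) {n : ℤ}
    (h : ∀ z ≥ n, (f z : X) ∈ U) : ∃ C ∈ trace (V.components U) S, ∀ z ≥ n, f z ∈ C := by
  obtain ⟨C, hC, hn⟩ := exists_component_ray hf h
  exact ⟨_, ⟨C, hC, rfl⟩, hn⟩

/-- The corestriction of a map with values in `S`. -/
def res (f : CMap V {U}) (hf : InSet S f) : CMap (V.sub S) (trace (V.components U) S) where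
  toFun z := ⟨f.toFun z, hf z⟩
  born := bornologous_sub f.born
  tails := by
    have key : ∀ g : CMap V {U}, ∀ hg : InSet S g,
        ∃ C ∈ trace (V.components U) S, ∃ n : ℤ, ∀ z ≥ n, ⟨g.toFun z, hg z⟩ ∈ C := by
      intro g hg
      obtain ⟨-, _, rfl, n, hn⟩ := g.tails
      obtain ⟨C, hC, h⟩ := exists_trace_of_ray (f := fun z => ⟨g.toFun z, hg z⟩)
        (fun z => g.born.adj_succ z) hn
      exact ⟨C, hC, n, h⟩
    refine ⟨?_, key f hf⟩
    obtain ⟨C, hC, n, h⟩ := key f.opp fun z => hf (-z)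
    refine ⟨C, hC, -n, fun z hz => ?_⟩
    have := h (-z) (by omega)
    change (⟨f.toFun (- -z), _⟩ : S) ∈ C at this
    simpa using this

theorem inSet_onMaps (f : CMap (V.sub S) (trace (V.components U) S)) :
    InSet S ((valIncl V U S).onMaps f) := fun z => (f.toFun z).2

theorem res_toFun_eq {f g : CMap V {U}} (hf : InSet S f) (hg : InSet S g) {z w : ℤ}
    (h : f.toFun z = g.toFun w) : (res f hf).toFun z = (res g hg).toFun w := Subtype.ext h

/-- Homotopies of rays inside `S` are homotopies in the subspace `S`. -/
theorem RayHomotopicOn.restrict {f g : ℤ → X} {j : ℤ} (h : RayHomotopicOn V {U} S j f g)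
    {f' g' : ℤ → S} (hf : ∀ z ≥ j, (f' z : X) = f z) (hg : ∀ z ≥ j, (g' z : X) = g z) :
    RayHomotopic (V.sub S) (trace (V.components U) S) j f' g' := by
  obtain ⟨H, hH, ⟨M, N, hMN⟩, hP⟩ := h
  refine ⟨fun p => ⟨H p, (hP p.2).2 p.1⟩, bornologous_sub hH, ⟨M, N, fun s => ⟨fun k hk => ?_,
    fun k hk => ?_⟩⟩, fun k => ?_⟩
  · exact Subtype.ext (((hMN s).1 k hk).trans (hf s s.2).symm)
  · exact Subtype.ext (((hMN s).2 k hk).trans (hg s s.2).symm)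
  · obtain ⟨⟨_, rfl, n, hn⟩, -⟩ := hP k
    -- The stage is continued constantly to the left of `j`, so that the statement about maps on `ℤ`
    -- puts its tail into one component.
    let ext (z : ℤ) : Set.Ici j := ⟨max z j, Set.mem_Ici.2 (le_max_right _ _)⟩
    have hadj : ∀ z, V.Adj (H (ext z, k)) (H (ext (z + 1), k)) := by
      intro z
      refine hH.adj ⟨{(ext z, ext (z + 1))}, sub_adj.2 (zOne_adj.2 ?_), {(k, k)}, Adj.refl _ _, ?_⟩
      · change |max (z + 1) j - max z j| ≤ 1
        rw [abs_le]
        omega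
      · rintro _ rfl
        exact ⟨rfl, rfl⟩
    obtain ⟨C, hC, hC'⟩ := exists_trace_of_ray (V := V) (n := n)
      (f := fun z => (⟨H (ext z, k), (hP k).2 _⟩ : S)) hadj
      (fun z hz => hn _ (by change n ≤ max z j; omega))
    refine ⟨C, hC, n, fun z hz => ?_⟩
    have := hC' z hz
    have e : ext z = z := Subtype.ext (max_eq_left z.2)
    rwa [e] at this

theorem TailCondOn.restrict {g : ℤ → X} {j : ℤ} (h : TailCondOn V {U} S g j) {g' : ℤ → S}
    (hg : ∀ z, (g' z : X) = g z) : TailCond (V.sub S) (trace (V.components U) S) g' j := by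
  have hp : ∀ a, PeriodicFrom g' a ↔ PeriodicFrom g a := fun a => by
    simp only [PeriodicFrom, ← hg, Subtype.coe_inj]
  intro h1 h2
  simp only [hp] at h1 h2
  obtain ⟨c, hc⟩ := h h1 h2
  have hcS : c ∈ S := by
    obtain ⟨H, -, ⟨M, N, hMN⟩, hP⟩ := hc
    have := (hP N).2 ⟨j, Set.mem_Ici.2 le_rfl⟩
    dsimp only at this
    rwa [(hMN _).2 N le_rfl] at this
  exact ⟨⟨c, hcS⟩, hc.restrict (fun z _ => hg z) fun _ _ => rfl⟩

theorem AdmOn.restrict {g : ℤ → X} {j : ℤ} (h : AdmOn V {U} S g j) {g' : ℤ → S}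
    (hg : ∀ z, (g' z : X) = g z) : Admissible (V.sub S) (trace (V.components U) S) g' j :=
  ⟨h.1.restrict hg, h.2.restrict fun z => hg (-z)⟩

section labelling

variable {G : Type*} [Groupoid G]

/-- The end objects of an edge can be named in several propositionally equal ways; the choice is
absorbed by the `eqToHom` factors. -/
theorem map_edge_congr {𝒰 : Set (Set X)} (F : RelFundGrpd V 𝒰 ⥤ G) {a b a' b' : RelFundGrpd V 𝒰}
    {f : CMap V 𝒰} (ha : src f = a) (hb : tgt f = b) (ha' : src f = a') (hb' : tgt f = b')
    {x y : G} (ea : x = F.obj a) (eb : F.obj b = y) (ea' : x = F.obj a') (eb' : F.obj b' = y) :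
    eqToHom ea ≫ F.map (edge f ha hb) ≫ eqToHom eb =
      eqToHom ea' ≫ F.map (edge f ha' hb') ≫ eqToHom eb' := by
  subst ha hb ha' hb'
  rfl

/-- The labelling defined by a functor. -/
def Labelling.ofFunctor {𝒰 : Set (Set X)} {ob : RelFundGrpd V 𝒰 → G} (F : RelFundGrpd V 𝒰 ⥤ G)
    (h : ∀ a, ob a = F.obj a) : Labelling V 𝒰 Set.univ ob where
  E f hf ha hb := eqToHom (h _) ≫ F.map ((edgeLabelling V 𝒰).E f hf ha hb) ≫ eqToHom (h _).symm
  opp f g hf hg ha hb hb' ha' N e := by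
    have := (edgeLabelling V 𝒰).opp f g hf hg ha hb hb' ha' N e
    simp [← Functor.map_comp_assoc, this]
  merge f g k hf hg hk ha hb hb' hc ha' hc' x₀ N M j h1 h2 h3 h4 h5 h6 := by
    have := (edgeLabelling V 𝒰).merge f g k hf hg hk ha hb hb' hc ha' hc' x₀ N M j h1 h2 h3 h4 h5 h6
    simp [this]
  del f g hf hg ha hb ha' hb' z₀ e h' := by
    rw [(edgeLabelling V 𝒰).del f g hf hg ha hb ha' hb' z₀ e h']

variable {ob : RelFundGrpd V {U} → G}

theorem ob_src (F : RelFundGrpd (V.sub S) (trace (V.components U) S) ⥤ G)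
    (h : ∀ a, ob ((valIncl V U S).obj a) = F.obj a) {f : CMap V {U}} (hf : InSet S f)
    {a : RelFundGrpd V {U}} (ha : src f = a) : ob a = F.obj (src (res f hf)) :=
  (congrArg ob ha.symm).trans (h (src (res f hf)))

theorem ob_tgt (F : RelFundGrpd (V.sub S) (trace (V.components U) S) ⥤ G)
    (h : ∀ a, ob ((valIncl V U S).obj a) = F.obj a) {f : CMap V {U}} (hf : InSet S f)
    {a : RelFundGrpd V {U}} (ha : tgt f = a) : ob a = F.obj (tgt (res f hf)) :=
  (congrArg ob ha.symm).trans (h (tgt (res f hf)))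

/-- The labelling of the maps with values in `S` defined by a functor on the relative fundamental
groupoid of `S`. -/
def Labelling.ofSubspace (F : RelFundGrpd (V.sub S) (trace (V.components U) S) ⥤ G)
    (h : ∀ a, ob ((valIncl V U S).obj a) = F.obj a) : Labelling V {U} S ob where
  E f hf ha hb := eqToHom (ob_src F h hf ha) ≫ F.map (edge (res f hf) rfl rfl) ≫
    eqToHom (ob_tgt F h hf hb).symm
  opp := by
    intro a b f g hf hg ha hb hb' ha' N e
    -- Equality of end objects in `X` says nothing about those in the subspace; it is recovered
    -- there from the pointwise relation between the maps.
    have e1 : src (res g hg) = tgt (res f hf) :=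
      tgt_eq_of_eventually (N := 0) (-N) fun z _ => res_toFun_eq _ _ (by
        rw [e]
        congr 1
        ring)
    have e2 : tgt (res g hg) = src (res f hf) :=
      tgt_eq_of_eventually (N := 0) N fun z _ => res_toFun_eq _ _ (by
        rw [e]
        congr 1
        ring)
    rw [map_edge_congr F rfl rfl e1 e2 _ _ (ob_tgt F h hf hb) (ob_src F h hf ha).symm]
    have : edge (res f hf) rfl rfl ≫ edge (res g hg) e1 e2 = 𝟙 _ :=
      (edgeLabelling _ _).opp (res f hf) (res g hg) (fun _ => trivial) (fun _ => trivial)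
      rfl rfl e1 e2 N fun z => res_toFun_eq _ _ (e z)
    simp [← Functor.map_comp_assoc, this]
  merge := by
    intro a b c f g k hf hg hk ha hb hb' hc ha' hc' x₀ N M j h1 h2 h3 h4 h5 h6
    have h1' : ∀ z ≥ N, (res f hf).toFun z = ⟨x₀, h1 N le_rfl ▸ hf N⟩ :=
      fun z hz => Subtype.ext (h1 z hz)
    have h2' : ∀ z ≤ M, (res g hg).toFun z = ⟨x₀, h1 N le_rfl ▸ hf N⟩ :=
      fun z hz => Subtype.ext (h2 z hz)
    have h5' : ∀ z, (res k hk).toFun z = if z ≤ j then (res f hf).toFun z else (res g hg).toFun z :=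
      fun z => Subtype.ext (by
        refine (h5 z).trans ?_
        split_ifs <;> rfl)
    have hx := mem_of_const_right _ h1'
    have e1 : src (res g hg) = tgt (res f hf) :=
      (src_eq_pt hx h2').trans (tgt_eq_pt hx h1').symm
    rw [map_edge_congr F (f := res f hf) rfl rfl (src_eq_of_merge h5').symm rfl _ _
        (ob_src F h hk ha') (ob_tgt F h hf hb).symm,
      map_edge_congr F (f := res g hg) rfl rfl e1 (tgt_eq_of_merge h5').symm _ _
        (ob_tgt F h hf hb) (ob_tgt F h hk hc').symm]
    have : edge (res k hk) rfl rfl =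
        edge (res f hf) (src_eq_of_merge h5').symm rfl ≫
          edge (res g hg) e1 (tgt_eq_of_merge h5').symm :=
      (edgeLabelling _ _).merge (res f hf) (res g hg) (res k hk) (fun _ => trivial)
      (fun _ => trivial) (fun _ => trivial) (src_eq_of_merge h5').symm rfl e1
      (tgt_eq_of_merge h5').symm rfl rfl _ N M j h1' h2' h3 h4 h5'
      (admOn_univ.2 (h6.restrict fun _ => rfl))
    rw [this]
    simp
  del := by
    intro a b f g hf hg ha hb ha' hb' z₀ e h'
    have e' : ∀ z, (res g hg).toFun z =
        if z < z₀ then (res f hf).toFun z else (res f hf).toFun (z + 1) :=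
      fun z => Subtype.ext (by
        refine (e z).trans ?_
        split_ifs <;> rfl)
    have : edge (res f hf) rfl rfl =
        edge (res g hg) (src_eq_of_del e').symm (tgt_eq_of_del e').symm :=
      (edgeLabelling _ _).del (res f hf) (res g hg) (fun _ => trivial) (fun _ => trivial)
      rfl rfl (src_eq_of_del e').symm (tgt_eq_of_del e').symm z₀ e'
      (admOn_univ.2 (h'.restrict fun _ => rfl))
    rw [this]
    exact map_edge_congr F _ _ _ _ _ _ _ _

end labelling

end RelFundGrpd

/-! ### Tethers, gluing of functors and the pushout. -/

namespace RelFundGrpd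

open CMap

variable {X : Type u} {V : SemiCoarse X} {U : Set X}

theorem exists_walk {S : Set X} {x y : S} (h : Relation.ReflTransGen (V.sub S).Adj x y) :
    ∃ l, Walk V S x y l := by
  induction h with
  | refl => exact ⟨_, .single x.2⟩
  | @tail y z _ hyz ih =>
    obtain ⟨l, hl⟩ := ih
    exact ⟨_, hl.append (.single z.2) (sub_adj.1 hyz)⟩

theorem exists_walk_of_meet {S : Set X}
    (h : ∀ C ∈ V.components S, ∃ U' ∈ V.components U, (C ∩ U').Nonempty) {x : X} (hx : x ∈ S) :
    ∃ y ∈ U, ∃ l, Walk V S x y l := by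
  obtain ⟨U', hU', _, ⟨y, hy, rfl⟩, hyU⟩ := h _ ⟨⟨x, hx⟩, rfl⟩
  exact ⟨y, subset_of_mem_components V hU' hyU, exists_walk (joined_iff.1 hy)⟩

/-- A point of `A ∩ B` outside `U` needs a path that stays in both members, hence one inside `A ∩
B`: this is why the components of the intersection must meet `U` too. Any other point outside `U`
lies in only one member. -/
theorem exists_tether {S : Bool → Set X} (hc : S true ∪ S false = Set.univ)
    (h : ∀ i, ∀ x ∈ S i, ∃ y ∈ U, ∃ l, Walk V (S i) x y l)
    (h' : ∀ x ∈ S true ∩ S false, ∃ y ∈ U, ∃ l, Walk V (S true ∩ S false) x y l) :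
    ∃ T : Tether V {U}, ∀ i, T.Stays (S i) := by
  have key : ∀ x, ∃ (l : List X) (y : X), Walk V Set.univ x y l ∧ y ∈ U ∧ (x ∈ U → l = [x]) ∧
      ∀ i, x ∈ S i → ∀ z ∈ l, z ∈ S i := by
    intro x
    by_cases hxU : x ∈ U
    · exact ⟨[x], x, .single trivial, hxU, fun _ => rfl, fun i hx z hz =>
        List.mem_singleton.1 hz ▸ hx⟩
    by_cases hx : x ∈ S true ∩ S false
    · obtain ⟨y, hy, l, hl⟩ := h' x hx
      refine ⟨l, y, ⟨hl.head, hl.last, hl.chain, fun _ _ => trivial⟩, hy, fun h => absurd h hxU,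
        fun i _ z hz => ?_⟩
      cases i
      · exact (hl.mem z hz).2
      · exact (hl.mem z hz).1
    · obtain ⟨i, hi⟩ : ∃ i, x ∈ S i := by
        have : x ∈ S true ∪ S false := hc ▸ Set.mem_univ x
        exact this.elim (fun h => ⟨_, h⟩) fun h => ⟨_, h⟩
      obtain ⟨y, hy, l, hl⟩ := h i x hi
      refine ⟨l, y, ⟨hl.head, hl.last, hl.chain, fun _ _ => trivial⟩, hy, fun h => absurd h hxU,
        fun j hj z hz => ?_⟩
      obtain rfl : i = j := by
        by_contra hij
        cases i <;> cases j <;> simp_all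
      exact hl.mem z hz
  choose l y h1 h2 h3 h4 using key
  exact ⟨⟨l, y, h1, fun x => ⟨U, rfl, h2 x⟩, fun x hx => h3 x (by simpa using hx)⟩,
    fun i x hx => h4 x i hx⟩

variable {G : Type*} [Groupoid G]

theorem functor_ext {𝒰 : Set (Set X)} {P Q : RelFundGrpd V 𝒰 ⥤ G} (hobj : ∀ a, P.obj a = Q.obj a)
    (hmap : ∀ f : CMap V 𝒰, P.map (edge f rfl rfl) =
      eqToHom (hobj (src f)) ≫ Q.map (edge f rfl rfl) ≫ eqToHom (hobj (tgt f)).symm) : P = Q := by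
  refine CategoryTheory.Functor.ext hobj fun a b φ => ?_
  refine hom_induction (P := fun {a b} φ => P.map φ =
    eqToHom (hobj a) ≫ Q.map φ ≫ eqToHom (hobj b).symm) hmap ?_ φ
  intro a b c φ ψ h1 h2
  simp [h1, h2]

/-- Compatible functors on the relative fundamental groupoids of the sets `S i`. -/
structure Compatible {S : Bool → Set X}
    (F : ∀ i, RelFundGrpd (V.sub (S i)) (trace (V.components U) (S i)) ⥤ G) : Prop where
  obj : ∀ {i j : Bool} {f : CMap V {U}} (hi : InSet (S i) f) (hj : InSet (S j) f),
    (F i).obj (tgt (res f hi)) = (F j).obj (tgt (res f hj))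
  map : ∀ {i j : Bool} {f : CMap V {U}} (hi : InSet (S i) f) (hj : InSet (S j) f)
    (es : (F i).obj (src (res f hi)) = (F j).obj (src (res f hj)))
    (et : (F j).obj (tgt (res f hj)) = (F i).obj (tgt (res f hi))),
    (F i).map (edge (res f hi) rfl rfl) =
      eqToHom es ≫ (F j).map (edge (res f hj) rfl rfl) ≫ eqToHom et

namespace SplitCover

variable (D : SplitCover V U)
  {F : ∀ i, RelFundGrpd (V.sub (D.S i)) (trace (V.components U) (D.S i)) ⥤ G} (hF : Compatible F)

theorem tgt_res_fromIdx {S : Set X} {f : CMap V {U}} (hf : InSet S f) {n : ℤ}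
    (hn : f.toFun n ∈ ⋃₀ {U}) (hf' : InSet S (fromIdx f n hn)) :
    tgt (res (fromIdx f n hn) hf') = tgt (res f hf) :=
  tgt_eq_of_eventually (N := n) 0 fun z hz => res_toFun_eq _ _ (by
    rw [fromIdx_of_le _ hz, add_zero])

-- Far out, the homotopy between the tails runs in one component of `U`, hence in one member `S k`.
-- The truncated maps lie in `S k` as well as in their own member, and in `S k` the homotopy
-- identifies their ends.
include hF in
theorem obj_eq_of_tgt_eq {i j : Bool} {f g : CMap V {U}} (hf : InSet (D.S i) f)
    (hg : InSet (D.S j) g) (h : tgt f = tgt g) :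
    (F i).obj (tgt (res f hf)) = (F j).obj (tgt (res g hg)) := by
  obtain ⟨N, M, h⟩ := tgt_eq_iff.1 h
  obtain ⟨C, hC, n, hn, hH⟩ := exists_component_of_rayHomotopic h
  obtain ⟨k, hk⟩ := D.sub C hC
  have hCU := subset_of_mem_components V hC
  have hCf : ∀ z ≥ n + N, f.toFun z ∈ C := by
    intro z hz
    obtain ⟨H, -, ⟨m, m', hm⟩, hP⟩ := hH
    have := (hP m).2 ⟨z - N, by rw [Set.mem_Ici]; omega⟩
    dsimp only at this
    rw [(hm _).1 m le_rfl] at this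
    simpa using this
  have hCg : ∀ z ≥ n + M, g.toFun z ∈ C := by
    intro z hz
    obtain ⟨H, -, ⟨m, m', hm⟩, hP⟩ := hH
    have := (hP m').2 ⟨z - M, by rw [Set.mem_Ici]; omega⟩
    dsimp only at this
    rw [(hm _).2 m' le_rfl] at this
    simpa using this
  have hfn : f.toFun (n + N) ∈ ⋃₀ {U} := ⟨U, rfl, hCU (hCf _ le_rfl)⟩
  have hgn : g.toFun (n + M) ∈ ⋃₀ {U} := ⟨U, rfl, hCU (hCg _ le_rfl)⟩
  have hfi : InSet (D.S i) (fromIdx f _ hfn) := fun z => hf _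
  have hgj : InSet (D.S j) (fromIdx g _ hgn) := fun z => hg _
  have hfk : InSet (D.S k) (fromIdx f _ hfn) := inSet_fromIdx _ fun z hz => hk (hCf z hz)
  have hgk : InSet (D.S k) (fromIdx g _ hgn) := inSet_fromIdx _ fun z hz => hk (hCg z hz)
  rw [← tgt_res_fromIdx hf hfn hfi, ← tgt_res_fromIdx hg hgn hgj, hF.obj hfi hfk, hF.obj hgj hgk]
  congr 1
  refine tgt_eq_iff.2 ⟨n + N, n + M, ?_⟩
  refine ((hH.mono hk).precomp_add (i := 0) (d := n) (by omega)).restrict (fun z hz => ?_)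
    fun z hz => ?_
  · change (fromIdx f _ hfn).toFun _ = _
    rw [fromIdx_of_le _ (by omega), add_assoc]
  · change (fromIdx g _ hgn).toFun _ = _
    rw [fromIdx_of_le _ (by omega), add_assoc]

/-- An object depends only on a tail, and a tail in `U` lies in one component, so what precedes it
can be made constant. -/
theorem exists_inSet_tgt (c : RelFundGrpd V {U}) :
    ∃ (i : Bool) (f : CMap V {U}), InSet (D.S i) f ∧ tgt f = c := by
  obtain ⟨f, rfl⟩ := exists_tgt c
  obtain ⟨-, U', hU', n, hn⟩ := f.tails
  have h : f.toFun n ∈ ⋃₀ {U} := ⟨U', hU', hn n le_rfl⟩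
  obtain rfl : U' = U := hU'
  obtain ⟨C, hC, hf⟩ := exists_component_ray (fun z => f.born.adj_succ z) hn
  obtain ⟨i, hi⟩ := D.sub C hC
  exact ⟨i, fromIdx f n h, inSet_fromIdx _ fun z hz => hi (hf z hz), tgt_fromIdx _⟩

variable (F) in
/-- The object map of the glued functor. -/
noncomputable def ob (c : RelFundGrpd V {U}) : G :=
  (F _).obj (tgt (res _ (D.exists_inSet_tgt c).choose_spec.choose_spec.1))

include hF in
theorem ob_eq {i : Bool} (a : RelFundGrpd (V.sub (D.S i)) (trace (V.components U) (D.S i))) :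
    D.ob F ((valIncl V U (D.S i)).obj a) = (F i).obj a := by
  obtain ⟨f, rfl⟩ := exists_tgt a
  exact D.obj_eq_of_tgt_eq hF _ (inSet_onMaps f) (D.exists_inSet_tgt _).choose_spec.choose_spec.2

/-- The gluing of compatible functors. -/
noncomputable def gluing : Gluing V U (D.ob F) where
  toSplitCover := D
  L i := Labelling.ofSubspace (F i) (D.ob_eq hF)
  agree := by
    intro i j f hi hj a b ha hb
    change eqToHom _ ≫ _ ≫ eqToHom _ = eqToHom _ ≫ _ ≫ eqToHom _
    have es : (F i).obj (src (res f hi)) = (F j).obj (src (res f hj)) :=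
      hF.obj (f := f.opp) (fun z => hi (-z)) fun z => hj (-z)
    rw [hF.map hi hj es (hF.obj hj hi)]
    simp

include hF in
theorem exists_functor : ∃ Ψ : RelFundGrpd V {U} ⥤ G,
    ∀ i, (valIncl V U (D.S i)).functor ⋙ Ψ = F i := by
  refine ⟨(D.gluing hF).glued.functor, fun i => functor_ext (D.ob_eq hF) fun f => ?_⟩
  refine ((D.gluing hF).glued.functor_edge ((valIncl V U (D.S i)).onMaps f) rfl rfl).trans ?_
  exact (D.gluing hF).glued_E (inSet_onMaps f) _ _ _

/-- Functors on the relative fundamental groupoid of `X` which agree on the members of the cover are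
equal. -/
theorem functor_unique {P Q : RelFundGrpd V {U} ⥤ G}
    (h : ∀ i, (valIncl V U (D.S i)).functor ⋙ P = (valIncl V U (D.S i)).functor ⋙ Q) : P = Q := by
  have hobj : ∀ a, P.obj a = Q.obj a := by
    intro a
    obtain ⟨i, f, hf, rfl⟩ := D.exists_inSet_tgt a
    exact Functor.congr_obj (h i) (tgt (res f hf))
  have hE : ∀ {i : Bool} {f : CMap V {U}} (hf : InSet (D.S i) f) {a b : RelFundGrpd V {U}}
      (ha : src f = a) (hb : tgt f = b),
      (Labelling.ofSubspace ((valIncl V U (D.S i)).functor ⋙ P) (ob := P.obj) fun _ => rfl).E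
        f hf ha hb = P.map (edge f ha hb) := by
    intro i f hf a b ha hb
    subst ha hb
    change 𝟙 _ ≫ P.map (edge f rfl rfl) ≫ 𝟙 _ = _
    simp
  -- The gluing of the restrictions of `P`. Both `P` and `Q`, the latter conjugated so as to have
  -- the objects of `P`, are labellings with these restrictions, so both equal the glued one.
  let D' : Gluing V U P.obj :=
    { toSplitCover := D
      L := fun i => Labelling.ofSubspace ((valIncl V U (D.S i)).functor ⋙ P) fun _ => rfl
      agree := fun hi hj _ _ ha hb => (hE hi ha hb).trans (hE hj ha hb).symm }
  have hP : ∀ f : CMap V {U}, P.map (edge f rfl rfl) =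
      D'.glued.E f (fun _ => trivial) rfl rfl := by
    intro f
    refine Eq.trans ?_ (D'.eq_glued (Labelling.ofFunctor P fun _ => rfl) ?_ (fun _ => trivial) rfl rfl)
    · change _ = 𝟙 _ ≫ P.map (edge f rfl rfl) ≫ 𝟙 _
      simp
    · intro i f hf a b ha hb
      refine Eq.trans ?_ (hE hf ha hb).symm
      change 𝟙 _ ≫ P.map (edge f ha hb) ≫ 𝟙 _ = _
      simp
  have hQ : ∀ f : CMap V {U},
      eqToHom (hobj (src f)) ≫ Q.map (edge f rfl rfl) ≫ eqToHom (hobj (tgt f)).symm =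
      D'.glued.E f (fun _ => trivial) rfl rfl := by
    intro f
    refine D'.eq_glued (Labelling.ofFunctor Q hobj) ?_ (fun _ => trivial) rfl rfl
    intro i f hf a b ha hb
    refine Eq.trans ?_ (hE hf ha hb).symm
    subst ha hb
    exact (Functor.congr_hom (h i) (edge (res f hf) rfl rfl)).symm
  exact functor_ext hobj fun f => (hP f).trans (hQ f).symm

end SplitCover

variable {A B : Set X}

theorem inclOn_toWhole_comm (V : SemiCoarse X) (U A B : Set X) :
    inclOn V (V.components U) (Set.inter_subset_left : A ∩ B ⊆ A) ≫ toWhole V U A =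
      inclOn V (V.components U) (Set.inter_subset_right : A ∩ B ⊆ B) ≫ toWhole V U B := by
  refine functor_ext (fun a => ?_) fun f => ?_
  · induction a using Quot.ind
    rfl
  · refine Eq.trans ?_ ((Category.id_comp _).trans (Category.comp_id _)).symm
    rfl

/-- The functors of a commutative square, as a family indexed by `Bool`. -/
def pairFunctor (P : RelFundGrpd (V.sub A) (trace (V.components U) A) ⥤ G)
    (Q : RelFundGrpd (V.sub B) (trace (V.components U) B) ⥤ G) :
    ∀ i, RelFundGrpd (V.sub (cond i A B)) (trace (V.components U) (cond i A B)) ⥤ G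
  | true => P
  | false => Q

/-- A map with values in both members is a map into `A ∩ B`, where the commutative square compares
the two functors. The variables `P'` and `Q'` let a square of groupoids be read as an equality of
functors. -/
theorem compatible_pairFunctor {P : RelFundGrpd (V.sub A) (trace (V.components U) A) ⥤ G}
    {Q : RelFundGrpd (V.sub B) (trace (V.components U) B) ⥤ G}
    {P' : RelFundGrpd (V.sub (A ∩ B : Set X)) (trace (V.components U) (A ∩ B)) ⥤
      RelFundGrpd (V.sub A) (trace (V.components U) A)}
    {Q' : RelFundGrpd (V.sub (A ∩ B : Set X)) (trace (V.components U) (A ∩ B)) ⥤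
      RelFundGrpd (V.sub B) (trace (V.components U) B)}
    (hP : P' = inclOn V (V.components U) (Set.inter_subset_left : A ∩ B ⊆ A))
    (hQ : Q' = inclOn V (V.components U) (Set.inter_subset_right : A ∩ B ⊆ B))
    (h : P' ⋙ P = Q' ⋙ Q) :
    Compatible (S := fun i => cond i A B) (pairFunctor P Q) := by
  subst hP hQ
  have ho : ∀ {f : CMap V {U}} (hA : InSet A f) (hB : InSet B f),
      P.obj (tgt (res f hA)) = Q.obj (tgt (res f hB)) :=
    fun {f} hA hB => Functor.congr_obj h (tgt (res (S := A ∩ B) f fun z => ⟨hA z, hB z⟩))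
  have hm : ∀ {f : CMap V {U}} (hA : InSet A f) (hB : InSet B f) es et,
      P.map (edge (res f hA) rfl rfl) =
        eqToHom es ≫ Q.map (edge (res f hB) rfl rfl) ≫ eqToHom et :=
    fun {f} hA hB _ _ => Functor.congr_hom h
      (edge (res (S := A ∩ B) f fun z => ⟨hA z, hB z⟩) rfl rfl)
  have hm' : ∀ {f : CMap V {U}} (hA : InSet A f) (hB : InSet B f) es et,
      Q.map (edge (res f hB) rfl rfl) =
        eqToHom es ≫ P.map (edge (res f hA) rfl rfl) ≫ eqToHom et :=
    fun {f} hA hB _ _ => Functor.congr_hom h.symm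
      (edge (res (S := A ∩ B) f fun z => ⟨hA z, hB z⟩) rfl rfl)
  constructor
  · rintro (_ | _) (_ | _) f hi hj
    · rfl
    · exact (ho hj hi).symm
    · exact ho hi hj
    · rfl
  · rintro (_ | _) (_ | _) f hi hj es et
    · simp
    · exact hm' hj hi es et
    · exact hm hi hj es et
    · simp

theorem exists_splitCover (hsplit : V.WellSplit A B)
    (hmeet : ∀ C ∈ V.components A ∪ V.components B ∪ V.components (A ∩ B),
      ∃ U' ∈ V.components U, (C ∩ U').Nonempty)
    (hsub : ∀ U' ∈ V.components U, U' ⊆ A ∨ U' ⊆ B) :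
    ∃ D : SplitCover V U, D.S = fun i => cond i A B := by
  have hc : A ∪ B = Set.univ := hsplit.2.2.choose
  obtain ⟨T, hT⟩ := exists_tether (V := V) (U := U) (S := fun i => cond i A B) hc
    (by
      rintro (_ | _) x hx
      · exact exists_walk_of_meet (fun C hC => hmeet C (Or.inl (Or.inr hC))) hx
      · exact exists_walk_of_meet (fun C hC => hmeet C (Or.inl (Or.inl hC))) hx)
    fun x hx => exists_walk_of_meet (fun C hC => hmeet C (Or.inr hC)) hx
  exact ⟨⟨_, T, hc, hsplit, fun C hC => (hsub C hC).elim (fun h => ⟨true, h⟩)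
    fun h => ⟨false, h⟩, hT⟩, rfl⟩

end RelFundGrpd

theorem mainTheorem5 {X : Type u} (V : SemiCoarse X) (U A B : Set X)
    (hsplit : V.WellSplit A B)
    (hmeet : ∀ C ∈ V.components A ∪ V.components B ∪ V.components (A ∩ B),
      ∃ U' ∈ V.components U, (C ∩ U').Nonempty)
    (hsub : ∀ U' ∈ V.components U, U' ⊆ A ∨ U' ⊆ B) :
    IsPushout
      (RelFundGrpd.inclOn V (V.components U) (Set.inter_subset_left : A ∩ B ⊆ A))
      (RelFundGrpd.inclOn V (V.components U) (Set.inter_subset_right : A ∩ B ⊆ B))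
      (RelFundGrpd.toWhole V U A)
      (RelFundGrpd.toWhole V U B) := by
  obtain ⟨⟨S, T, hc, hs, hS, hT⟩, rfl⟩ := RelFundGrpd.exists_splitCover hsplit hmeet hsub
  let D : RelFundGrpd.SplitCover V U := ⟨_, T, hc, hs, hS, hT⟩
  have hex : ∀ s : Limits.PushoutCocone
      (RelFundGrpd.inclOn V (V.components U) (Set.inter_subset_left : A ∩ B ⊆ A))
      (RelFundGrpd.inclOn V (V.components U) (Set.inter_subset_right : A ∩ B ⊆ B)),
      ∃ Ψ : RelFundGrpd.grpd V {U} ⟶ s.pt,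
        RelFundGrpd.toWhole V U A ≫ Ψ = s.inl ∧ RelFundGrpd.toWhole V U B ≫ Ψ = s.inr := by
    intro s
    obtain ⟨Ψ, hΨ⟩ := D.exists_functor
      (RelFundGrpd.compatible_pairFunctor (P := s.inl) (Q := s.inr) rfl rfl s.condition)
    exact ⟨Ψ, hΨ true, hΨ false⟩
  choose desc h1 h2 using hex
  refine ⟨⟨RelFundGrpd.inclOn_toWhole_comm V U A B⟩,
    ⟨Limits.PushoutCocone.IsColimit.mk _ desc h1 h2 fun s m h3 h4 => ?_⟩⟩
  refine D.functor_unique (P := m) (Q := desc s) ?_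
  rintro (_ | _)
  · exact h4.trans (h2 s).symm
  · exact h3.trans (h1 s).symm
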